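/- **Setting.** Let $n\ge 2$, $B(r)=\{x\in\mathbb R^n:|x|<r\}$ and $B^\complement(r)=\{x\in\mathbb R^n:|x|>r\}$; all functions are real-valued and functions on open sets are identified when they agree almost everywhere. Let $r_0,R_0>0$, and let $\Gamma,\Omega,\mathsf P\subset\mathbb R^n$ be open sets such that * $\Gamma$ is a cone ($tx\in\Gamma$ for $x\in\Gamma$, $t>0$) and, with $\hat\Gamma=\Gamma\cap\mathbb S^{n-1}$, the set $\mathbb S^{n-1}\setminus\hat\Gamma$ has positive capacity in $\mathbb S^{n-1}$, i.e. $\inf \|u\|_{H^1(\mathbb S^{n-1})}>0$, the infimum being over all smooth $u$ on $\mathbb S^{n-1}$ with $u=1$ in a neighbourhood of $\mathbb S^{n-1}\setminus\hat\Gamma$; * $\Omega$ is bounded and connected, and $\Omega\cap B(r_0)=\Gamma\cap B(r_0)$; * $\mathsf P$ is unbounded, and $\mathsf P\cap B^\complement(R_0)=\Gamma\cap B^\complement(R_0)$. Let $\psi\in H^1_0(\hat\Gamma)$, $\|\psi\|_{L^2(\hat\Gamma)}=1$, be an eigenfunction of the positive Laplace–Beltrami operator with Dirichlet conditions on $\hat\Gamma$,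 with eigenvalue $\mu$: $\int_{\hat\Gamma}\nabla_T\psi\cdot\nabla_T v\,d\sigma=\mu\int_{\hat\Gamma}\psi v\,d\sigma$ for all $v\in H^1_0(\hat\Gamma)$ (for instance $\psi=\psi_j$, $\mu=\mu_j$ for a member of an orthonormal basis of eigenfunctions). Put $$\lambda^\pm=1-\tfrac n2\pm\sqrt{(1-\tfrac n2)^2+\mu},\qquad h^\pm(x)=|x|^{\lambda^\pm}\,\psi(x/|x|)\quad (x\in\Gamma).$$ For an open set $U$, $C^\infty_0(U)$ is the space of smooth functions with compact support in $U$; $H^1_{\mathsf w}(U)$ has the norm $\big(\int_U \frac{|u|^2}{(1+|x|)^2}+\int_U|\nabla u|^2\big)^{1/2}$; $H^1_0(U)$ and $H^1_{\mathsf w,0}(U)$ are the closures of $C^\infty_0(U)$ in $H^1(U)$ and $H^1_{\mathsf w}(U)$. For $\rho>0$, $H^1_0(U\cap\overline{B(\rho)})$, $H^1_0(U\cap\overline{B^\complement(\rho)})$ and $H^1_{\mathsf w,0}(U\cap\overline{B^\complement(\rho)})$ are the closures of the restrictions of functions in $C^\infty_0(U)$ in $H^1(U\cap B(\rho))$, $H^1(U\cap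 B^\complement(\rho))$ and $H^1_{\mathsf w}(U\cap B^\complement(\rho))$. The Laplacian is taken in the sense of distributions. **Statement.** a) There is a unique $K^+\in L^2_{\rm loc}(\mathsf P)$ such that $$\Delta K^+=0\ \text{in }\mathsf P,\qquad K^+\in H^1_0(\mathsf P\cap\overline{B(\rho)})\ \text{for all }\rho>0,\qquad K^+-h^+\in H^1_{\mathsf w,0}(\Gamma\cap\overline{B^\complement(R_0)}).$$ Moreover, for every smooth $\Phi$ on $\mathbb R^n$ with $\Phi=1$ on $B^\complement(2R_0)$ and $\Phi=0$ on $B(R_0)$, there is a unique $Y^+\in H^1_{\mathsf w,0}(\mathsf P)$ with $\Delta Y^+=\Delta(\Phi h^+)$ in $\mathsf P$, and $K^+=\Phi h^+-Y^+$ in $\mathsf P$. b) There is a unique $K^-\in L^2_{\rm loc}(\Omega)$ such that $$\Delta K^-=0\ \text{in }\Omega,\qquad K^-\in H^1_0(\Omega\cap\overline{B^\complement(\rho)})\ \text{for all }\rho>0,\qquad K^--h^-\in H^1_0(\Gamma\cap\overline{B(r_0)}).$$ Moreover, for every smooth $\varphi$ on $\mathbb R^n$ with $\varphi=1$ on $B(r_0/2)$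 and $\varphi=0$ on $B^\complement(r_0)$, there is a unique $Y^-\in H^1_0(\Omega)$ with $\Delta Y^-=\Delta(\varphi h^-)$ in $\Omega$, and $K^-=\varphi h^--Y^-$ in $\Omega$. -/

import Mathlib

open MeasureTheory Metric Set Filter Topology
open scoped ContDiff ENNReal InnerProductSpace

noncomputable section

/-- The space `ℝⁿ` with its Euclidean norm. -/
abbrev Eucl (n : ℕ) : Type := EuclideanSpace ℝ (Fin n)

/-- The unit sphere `𝕊ⁿ⁻¹` of `ℝⁿ`. -/
abbrev USphere (n : ℕ) : Type := sphere (0 : Eucl n) 1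

/-! ### Sobolev spaces on open subsets of `ℝⁿ`

Functions on an open set `V` are represented by functions on `ℝⁿ`, of which only the values almost
everywhere on `V` matter. -/

/-- The elements of `C^∞_0(U)`: smooth functions with compact support contained in `U`. -/
structure IsTestFunction {n : ℕ} (U : Set (Eucl n)) (g : Eucl n → ℝ) : Prop where
  smooth : ContDiff ℝ ∞ g
  compact : HasCompactSupport g
  support_subset : tsupport g ⊆ U

/-- `u ∈ L²_loc(U)`. -/
def MemL2Loc {n : ℕ} (U : Set (Eucl n)) (u : Eucl n → ℝ) : Prop :=
  ∀ C : Set (Eucl n), C ⊆ U → IsCompact C → MemLp u 2 (volume.restrict C)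

/-- The integration by parts identity: `G` is the distributional gradient of `u` in `V`. It is only
used together with `u ∈ L²_loc(V)` and `G ∈ L²(V)`, so that both integrals converge. -/
def HasWeakGradient {n : ℕ} (V : Set (Eucl n)) (u : Eucl n → ℝ) (G : Eucl n → Eucl n) : Prop :=
  ∀ g : Eucl n → ℝ, IsTestFunction V g →
    ∫ x in V, u x • gradient g x = -∫ x in V, g x • G x

/-- `u` belongs to the Sobolev space on `V` with norm `(‖w u‖²_{L²(V)} + ‖∇u‖²_{L²(V)})^{1/2}`
(where `w` is a positive continuous weight), and `G` is its gradient. -/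
structure HasSobolevGradient {n : ℕ} (w : Eucl n → ℝ) (V : Set (Eucl n))
    (u : Eucl n → ℝ) (G : Eucl n → Eucl n) : Prop where
  memLp : MemLp (fun x => w x * u x) 2 (volume.restrict V)
  memLp_grad : MemLp G 2 (volume.restrict V)
  weak : HasWeakGradient V u G

/-- For open `V ⊆ U`: `u` belongs to the closure, in the Sobolev space on `V` with weight `w`, of
the restrictions to `V` of the functions in `C^∞_0(U)`. -/
def MemSobolevClosure {n : ℕ} (w : Eucl n → ℝ) (U V : Set (Eucl n)) (u : Eucl n → ℝ) : Prop :=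
  ∃ G : Eucl n → Eucl n, HasSobolevGradient w V u G ∧
    ∀ ε : ℝ≥0∞, 0 < ε → ∃ g : Eucl n → ℝ, IsTestFunction U g ∧
      eLpNorm (fun x => w x * (u x - g x)) 2 (volume.restrict V)
        + eLpNorm (fun x => G x - gradient g x) 2 (volume.restrict V) < ε

/-- The weight `1 / (1 + |x|)` of the spaces `H¹_w`. -/
def decayWeight {n : ℕ} (x : Eucl n) : ℝ := (1 + ‖x‖)⁻¹

/-- `B^∁(ρ)`, the complement of the closed ball of radius `ρ` centred at the origin. -/
def outerBall (n : ℕ) (ρ : ℝ) : Set (Eucl n) := {x | ρ < ‖x‖}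

/-- `H¹₀(U)`. -/
def MemH10 {n : ℕ} (U : Set (Eucl n)) (u : Eucl n → ℝ) : Prop :=
  MemSobolevClosure (fun _ => 1) U U u

/-- `H¹_{w,0}(U)`. -/
def MemHw10 {n : ℕ} (U : Set (Eucl n)) (u : Eucl n → ℝ) : Prop :=
  MemSobolevClosure decayWeight U U u

/-- `H¹₀(U ∩ closure B(ρ))`: the closure in `H¹(U ∩ B(ρ))` of the restrictions of the functions in
`C^∞_0(U)`. -/
def MemH10Inner {n : ℕ} (U : Set (Eucl n)) (ρ : ℝ) (u : Eucl n → ℝ) : Prop :=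
  MemSobolevClosure (fun _ => 1) U (U ∩ ball 0 ρ) u

/-- `H¹₀(U ∩ closure B^∁(ρ))`: the closure in `H¹(U ∩ B^∁(ρ))` of the restrictions of the functions
in `C^∞_0(U)`. -/
def MemH10Outer {n : ℕ} (U : Set (Eucl n)) (ρ : ℝ) (u : Eucl n → ℝ) : Prop :=
  MemSobolevClosure (fun _ => 1) U (U ∩ outerBall n ρ) u

/-- `H¹_{w,0}(U ∩ closure B^∁(ρ))`: the closure in `H¹_w(U ∩ B^∁(ρ))` of the restrictions of the
functions in `C^∞_0(U)`. -/
def MemHw10Outer {n : ℕ} (U : Set (Eucl n)) (ρ : ℝ) (u : Eucl n → ℝ) : Prop :=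
  MemSobolevClosure decayWeight U (U ∩ outerBall n ρ) u

/-- `Δu = Δv` in the sense of distributions in the open set `U`
(for `u, v ∈ L²_loc(U)`). -/
def LaplacianEqIn {n : ℕ} (U : Set (Eucl n)) (u v : Eucl n → ℝ) : Prop :=
  ∀ g : Eucl n → ℝ, IsTestFunction U g →
    ∫ x in U, u x * Laplacian.laplacian g x
      = ∫ x in U, v x * Laplacian.laplacian g x

/-- `Δu = 0` in the sense of distributions in the open set `U` (for `u ∈ L²_loc(U)`). -/
def IsHarmonicIn {n : ℕ} (U : Set (Eucl n)) (u : Eucl n → ℝ) : Prop :=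
  ∀ g : Eucl n → ℝ, IsTestFunction U g →
    ∫ x in U, u x * Laplacian.laplacian g x = 0

/-! ### The unit sphere -/

/-- The surface measure of the unit sphere. -/
def surfaceMeasure (n : ℕ) : Measure (USphere n) := (volume : Measure (Eucl n)).toSphere

/-- The tangential gradient at `θ` of the restriction to the unit sphere of a smooth `g`. -/
def tangentialGradient {n : ℕ} (g : Eucl n → ℝ) (θ : USphere n) : Eucl n :=
  gradient g (θ : Eucl n) - ⟪(θ : Eucl n), gradient g (θ : Eucl n)⟫_ℝ • (θ : Eucl n)

/-- The (Sobolev) capacity of a closed subset `A` of the unit sphere: the infimum of the squared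
`H¹(𝕊ⁿ⁻¹)` norms of the smooth functions on the sphere that equal `1` in a neighbourhood of `A`.
Smooth functions on the sphere are the restrictions of smooth functions on `ℝⁿ`. -/
def sphereCapacity {n : ℕ} (A : Set (USphere n)) : ℝ≥0∞ :=
  ⨅ (u : Eucl n → ℝ) (_ : ContDiff ℝ ∞ u) (_ : ∀ᶠ θ : USphere n in 𝓝ˢ A, u θ = 1),
    ∫⁻ θ : USphere n, ENNReal.ofReal (u θ ^ 2 + ‖tangentialGradient u θ‖ ^ 2) ∂(surfaceMeasure n)

/-- The section `Γ ∩ 𝕊ⁿ⁻¹` of `Γ`. -/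
def sphericalSection {n : ℕ} (Γ : Set (Eucl n)) : Set (USphere n) := {θ | (θ : Eucl n) ∈ Γ}

/-- `ψ` belongs to `H¹₀(Γ ∩ 𝕊ⁿ⁻¹)` and `G` is its tangential gradient: `(ψ, G)` lies in the
`L²`-closure of the pairs `(g, ∇_T g)` with `g` a smooth function with compact support in
`Γ ∩ 𝕊ⁿ⁻¹`. For an open cone `Γ`, such `g` are the restrictions to the sphere of the functions in
`C^∞_0(Γ)`. -/
structure HasSphereH10Gradient {n : ℕ} (Γ : Set (Eucl n))
    (ψ : USphere n → ℝ) (G : USphere n → Eucl n) : Prop where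
  memLp : MemLp ψ 2 ((surfaceMeasure n).restrict (sphericalSection Γ))
  memLp_grad : MemLp G 2 ((surfaceMeasure n).restrict (sphericalSection Γ))
  approx : ∀ ε : ℝ≥0∞, 0 < ε → ∃ g : Eucl n → ℝ, IsTestFunction Γ g ∧
    eLpNorm (fun θ : USphere n => ψ θ - g θ) 2
        ((surfaceMeasure n).restrict (sphericalSection Γ))
      + eLpNorm (fun θ : USphere n => G θ - tangentialGradient g θ) 2
        ((surfaceMeasure n).restrict (sphericalSection Γ)) < ε

/-- `ψ` is an `L²`-normalized eigenfunction, for the eigenvalue `μ`, of the positive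
Laplace-Beltrami operator with Dirichlet conditions on `Γ ∩ 𝕊ⁿ⁻¹`. -/
def IsDirichletEigenfunction {n : ℕ} (Γ : Set (Eucl n)) (μ : ℝ) (ψ : USphere n → ℝ) : Prop :=
  (∫ θ in sphericalSection Γ, ψ θ ^ 2 ∂(surfaceMeasure n)) = 1 ∧
  ∃ G : USphere n → Eucl n, HasSphereH10Gradient Γ ψ G ∧
    ∀ (v : USphere n → ℝ) (Gv : USphere n → Eucl n), HasSphereH10Gradient Γ v Gv →
      ∫ θ in sphericalSection Γ, ⟪G θ, Gv θ⟫_ℝ ∂(surfaceMeasure n)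
        = μ * ∫ θ in sphericalSection Γ, ψ θ * v θ ∂(surfaceMeasure n)

/-! ### Geometry, exponents, homogeneous functions, cutoffs -/

/-- Generating triple: an open cone `Γ` whose section has a complement of positive capacity in the
sphere, a bounded domain `Ω` that coincides with `Γ` in `B(r₀)`, and an unbounded open set `P` that
coincides with `Γ` in `B^∁(R₀)`. -/
structure IsGeneratingTriple {n : ℕ} (Γ Ω P : Set (Eucl n)) (r₀ R₀ : ℝ) : Prop where
  isOpen_cone : IsOpen Γ
  cone_smul : ∀ x ∈ Γ, ∀ t : ℝ, 0 < t → t • x ∈ Γ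
  capacity_pos : 0 < sphereCapacity (sphericalSection Γ)ᶜ
  isOpen_domain : IsOpen Ω
  isConnected_domain : IsConnected Ω
  isBounded_domain : Bornology.IsBounded Ω
  r₀_pos : 0 < r₀
  domain_inter_ball : Ω ∩ ball 0 r₀ = Γ ∩ ball 0 r₀
  isOpen_pattern : IsOpen P
  not_isBounded_pattern : ¬ Bornology.IsBounded P
  R₀_pos : 0 < R₀
  pattern_inter_outerBall : P ∩ outerBall n R₀ = Γ ∩ outerBall n R₀

/-- `λ⁺ = 1 - n/2 + √((1 - n/2)² + μ)`. -/
def lambdaPlus (n : ℕ) (μ : ℝ) : ℝ := 1 - (n : ℝ) / 2 + √((1 - (n : ℝ) / 2) ^ 2 + μ)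

/-- `λ⁻ = 1 - n/2 - √((1 - n/2)² + μ)`. -/
def lambdaMinus (n : ℕ) (μ : ℝ) : ℝ := 1 - (n : ℝ) / 2 - √((1 - (n : ℝ) / 2) ^ 2 + μ)

/-- The function `x ↦ |x|^a ψ(x/|x|)` (with value `0` at the origin). -/
def homogeneousExtension {n : ℕ} (a : ℝ) (ψ : USphere n → ℝ) (x : Eucl n) : ℝ :=
  if hx : x = 0 then 0 else ‖x‖ ^ a * ψ ⟨‖x‖⁻¹ • x, by simp [norm_smul, hx]⟩

/-- `h⁺(x) = |x|^{λ⁺} ψ(x/|x|)`. -/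
def hPlus {n : ℕ} (μ : ℝ) (ψ : USphere n → ℝ) : Eucl n → ℝ :=
  homogeneousExtension (lambdaPlus n μ) ψ

/-- `h⁻(x) = |x|^{λ⁻} ψ(x/|x|)`. -/
def hMinus {n : ℕ} (μ : ℝ) (ψ : USphere n → ℝ) : Eucl n → ℝ :=
  homogeneousExtension (lambdaMinus n μ) ψ

/-- A cutoff `Φ` at infinity: smooth, `1` on `B^∁(2R₀)` and `0` on `B(R₀)`. -/
structure IsCutoffAtInfinity {n : ℕ} (R₀ : ℝ) (Φ : Eucl n → ℝ) : Prop where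
  smooth : ContDiff ℝ ∞ Φ
  eq_one : ∀ x ∈ outerBall n (2 * R₀), Φ x = 1
  eq_zero : ∀ x ∈ ball (0 : Eucl n) R₀, Φ x = 0

/-- A cutoff `φ` at the vertex: smooth, `1` on `B(r₀/2)` and `0` on `B^∁(r₀)`. -/
structure IsCutoffAtVertex {n : ℕ} (r₀ : ℝ) (φ : Eucl n → ℝ) : Prop where
  smooth : ContDiff ℝ ∞ φ
  eq_one : ∀ x ∈ ball (0 : Eucl n) (r₀ / 2), φ x = 1
  eq_zero : ∀ x ∈ outerBall n r₀, φ x = 0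

/-! ### The canonical harmonic functions and their correctors -/

/-- The conditions on `K⁺`. In the last one, the space is that of functions on
`Γ ∩ B^∁(R₀) = P ∩ B^∁(R₀)`, with Dirichlet conditions on the lateral boundary of the cone. -/
structure IsKPlus {n : ℕ} (Γ P : Set (Eucl n)) (R₀ : ℝ) (h K : Eucl n → ℝ) : Prop where
  memL2Loc : MemL2Loc P K
  harmonic : IsHarmonicIn P K
  dirichlet : ∀ ρ : ℝ, 0 < ρ → MemH10Inner P ρ K
  atInfinity : MemHw10Outer Γ R₀ (fun x => K x - h x)

/-- The conditions on `K⁻`. In the last one, the space is that of functions on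
`Γ ∩ B(r₀) = Ω ∩ B(r₀)`, with Dirichlet conditions on the lateral boundary of the cone. -/
structure IsKMinus {n : ℕ} (Γ Ω : Set (Eucl n)) (r₀ : ℝ) (h K : Eucl n → ℝ) : Prop where
  memL2Loc : MemL2Loc Ω K
  harmonic : IsHarmonicIn Ω K
  dirichlet : ∀ ρ : ℝ, 0 < ρ → MemH10Outer Ω ρ K
  atVertex : MemH10Inner Γ r₀ (fun x => K x - h x)

/-- The problem for the corrector `Y⁺`: `Y ∈ H¹_{w,0}(P)` and `ΔY = Δ(Φ h⁺)` in `P`. -/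
def IsCorrectorPlus {n : ℕ} (P : Set (Eucl n)) (Φ h Y : Eucl n → ℝ) : Prop :=
  MemHw10 P Y ∧ LaplacianEqIn P Y (fun x => Φ x * h x)

/-- The problem for the corrector `Y⁻`: `Y ∈ H¹₀(Ω)` and `ΔY = Δ(φ h⁻)` in `Ω`. -/
def IsCorrectorMinus {n : ℕ} (Ω : Set (Eucl n)) (φ h Y : Eucl n → ℝ) : Prop :=
  MemH10 Ω Y ∧ LaplacianEqIn Ω Y (fun x => φ x * h x)

end

/-!
The functions `K⁺` and `K⁻` are found in the form `K = χ h - Y`, where `χ` is a cutoff that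
localizes the homogeneous function `h` to the end of the domain (infinity, or the vertex) where the
domain is a cone, and where the corrector `Y` has finite energy. Both parts are instances of one
statement about a perturbed cone, `IsPerturbedCone.exists_unique_asymptoticSolution`.

* *Harmonicity of `h`.* The exponents satisfy `λ (λ + n - 2) = μ`, so `r^λ ψ` is harmonic in the
  cone: in polar coordinates this is the weak eigenvalue equation on each sphere combined with an
  integration by parts along each ray (`isHarmonicIn_homogeneousExtension`).
* *The corrector.* As `h` is harmonic, `Δ(χ h)` pairs with `v` as `∫ h (2 ⟨∇χ, ∇v⟩ + v Δχ)` up to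
  sign, a functional supported where `χ` varies, hence bounded for the energy norm once a Poincaré
  inequality `‖w v‖ ≤ C ‖∇v‖` is known. The Lax–Milgram theorem in the closure of the pairs
  `(w v, ∇v)` gives `Y` (`exists_dirichlet_solution`, `IsPerturbedCone.exists_corrector`).
* *Uniqueness.* The conditions on the difference of two solutions are local; a partition of unity
  puts it into the energy space of the whole domain (`IsPerturbedCone.memSobolevClosure_of_local`),
  where the gradient of a harmonic function is orthogonal to itself
  (`MemSobolevClosure.ae_eq_zero`).
* *Cutoffs touching the boundary of the conical region.* The cutoffs of the statement only vanish
  outside the closure of the region where the domain and the cone agree. Composition with dilations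
  close to the identity approximates them by cutoffs supported inside (`tendsto_dilate_mul`).

The Poincaré inequality on the bounded domain is the Friedrichs inequality (`exists_friedrichs`).
On the unbounded pattern it is a Hardy inequality (`exists_hardy`): on each large sphere,
the functions vanish near a set of positive capacity and thus obey a Friedrichs inequality
(`exists_lintegral_sq_le_of_capacity_pos`). Indeed, a function `g` with small gradient is close to a
constant `m`, and `1 - g / m` is a competitor for the capacity, which bounds `m`.

That `g` is close to a constant is the Poincaré inequality on the sphere
(`exists_lintegral_sq_sub_const_le`). Extend `g` to a homogeneous function of degree zero and move
from `x` to `y` along `x cos t + y sin t`. The rotation of the pair `(x, y)` preserves the Gaussian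
measure of `ℝⁿ × ℝⁿ` and the Gram determinant of `(x, y)`, so the fundamental theorem of calculus
bounds the mean of `(g(x) - g(y))²`, weighted by the Gram determinant, by the energy of `g`. The
weight, which degenerates for collinear pairs, is removed by passing through a third point.
-/

/-! ### Gradients and test functions -/

theorem continuous_gradient {n : ℕ} {f : Eucl n → ℝ} (hf : ContDiff ℝ ∞ f) :
    Continuous (gradient f) :=
  (LinearIsometryEquiv.continuous _).comp (hf.continuous_fderiv (by simp))

theorem gradient_mul {n : ℕ} {f g : Eucl n → ℝ} {x : Eucl n} (hf : DifferentiableAt ℝ f x)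
    (hg : DifferentiableAt ℝ g x) :
    gradient (fun y => f y * g y) x = f x • gradient g x + g x • gradient f x := by
  simp only [gradient]
  rw [fderiv_fun_mul hf hg]
  simp

theorem gradient_sub {n : ℕ} {f g : Eucl n → ℝ} {x : Eucl n} (hf : DifferentiableAt ℝ f x)
    (hg : DifferentiableAt ℝ g x) :
    gradient (fun y => f y - g y) x = gradient f x - gradient g x := by
  simp only [gradient]
  rw [fderiv_fun_sub hf hg]
  simp

theorem gradient_add {n : ℕ} {f g : Eucl n → ℝ} {x : Eucl n} (hf : DifferentiableAt ℝ f x)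
    (hg : DifferentiableAt ℝ g x) :
    gradient (fun y => f y + g y) x = gradient f x + gradient g x := by
  simp only [gradient]
  rw [fderiv_fun_add hf hg]
  simp

theorem gradient_const_mul {n : ℕ} {f : Eucl n → ℝ} {x : Eucl n} (hf : DifferentiableAt ℝ f x)
    (c : ℝ) : gradient (fun y => c * f y) x = c • gradient f x := by
  simp only [gradient]
  rw [fderiv_const_mul hf]
  simp

theorem gradient_comp_smul {n : ℕ} (v : Eucl n → ℝ) (r : ℝ) (x : Eucl n) :
    gradient (fun y => v (r • y)) x = r • gradient v (r • x) := by
  simp only [gradient]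
  rw [fderiv_comp_smul]
  simp

theorem tsupport_gradient_subset {n : ℕ} (f : Eucl n → ℝ) :
    tsupport (gradient f) ⊆ tsupport f := by
  refine (tsupport_fderiv_subset ℝ (f := f)).trans' (closure_mono ?_)
  intro x hx hx'
  apply hx
  simp [gradient, hx']

theorem gradient_eq_zero_of_notMem_tsupport {n : ℕ} {f : Eucl n → ℝ} {x : Eucl n}
    (hx : x ∉ tsupport f) : gradient f x = 0 :=
  image_eq_zero_of_notMem_tsupport fun h => hx (tsupport_gradient_subset f h)

/-- A function that is constant near `x` has gradient zero at `x`. -/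
theorem gradient_eq_zero_of_notMem_tsupport_sub {n : ℕ} {f : Eucl n → ℝ} {c : ℝ} {x : Eucl n}
    (hx : x ∉ tsupport fun y => f y - c) : gradient f x = 0 := by
  have h := gradient_eq_zero_of_notMem_tsupport hx
  rwa [gradient, fderiv_sub_const] at h

namespace IsTestFunction

variable {n : ℕ} {U : Set (Eucl n)} {f g : Eucl n → ℝ}

theorem continuous (hg : IsTestFunction U g) : Continuous g := hg.smooth.continuous

theorem differentiable (hg : IsTestFunction U g) : Differentiable ℝ g :=
  hg.smooth.differentiable (by simp)

theorem hasCompactSupport_gradient (hg : IsTestFunction U g) : HasCompactSupport (gradient g) :=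
  hg.compact.mono' ((subset_tsupport _).trans (tsupport_gradient_subset g))

theorem memLp_gradient (hg : IsTestFunction U g) (V : Set (Eucl n)) :
    MemLp (gradient g) 2 (volume.restrict V) :=
  ((continuous_gradient hg.smooth).memLp_of_hasCompactSupport hg.hasCompactSupport_gradient).mono_measure
    Measure.restrict_le_self

theorem memLp_mul {w : Eucl n → ℝ} (hw : Continuous w) (hg : IsTestFunction U g)
    (V : Set (Eucl n)) : MemLp (fun x => w x * g x) 2 (volume.restrict V) :=
  ((hw.mul hg.continuous).memLp_of_hasCompactSupport hg.compact.mul_left).mono_measure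
    Measure.restrict_le_self

theorem add (hf : IsTestFunction U f) (hg : IsTestFunction U g) :
    IsTestFunction U (fun x => f x + g x) :=
  ⟨hf.smooth.add hg.smooth, hf.compact.add hg.compact,
    (tsupport_add f g).trans (union_subset hf.support_subset hg.support_subset)⟩

theorem const_mul (c : ℝ) (hg : IsTestFunction U g) : IsTestFunction U (fun x => c * g x) :=
  ⟨contDiff_const.mul hg.smooth, hg.compact.mul_left,
    (tsupport_mul_subset_right (f := fun _ => c)).trans hg.support_subset⟩

theorem sub (hf : IsTestFunction U f) (hg : IsTestFunction U g) :
    IsTestFunction U (fun x => f x - g x) := by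
  simpa [sub_eq_add_neg] using hf.add (hg.const_mul (-1))

theorem zero (U : Set (Eucl n)) : IsTestFunction U fun _ => 0 :=
  ⟨contDiff_const, HasCompactSupport.zero, by simp [tsupport]⟩

theorem mul_left {η : Eucl n → ℝ} (hη : ContDiff ℝ ∞ η) {U' : Set (Eucl n)}
    (hg : IsTestFunction U g) (h : tsupport η ∩ tsupport g ⊆ U') :
    IsTestFunction U' (fun x => η x * g x) :=
  ⟨hη.mul hg.smooth, hg.compact.mul_left,
    (subset_inter tsupport_mul_subset_left tsupport_mul_subset_right).trans h⟩

theorem fderiv_apply (hg : IsTestFunction U g) (v : Eucl n) :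
    IsTestFunction U (fun x => fderiv ℝ g x v) := by
  have h : tsupport (fun x => fderiv ℝ g x v) ⊆ tsupport g := tsupport_fderiv_apply_subset ℝ v
  exact ⟨(hg.smooth.fderiv_right (m := ∞) (by simp)).clm_apply contDiff_const,
    hg.compact.mono' ((subset_tsupport _).trans h), h.trans hg.support_subset⟩

end IsTestFunction

theorem setIntegral_eq_integral_of_tsupport {n : ℕ} {F : Type*} [NormedAddCommGroup F]
    [NormedSpace ℝ F] {V : Set (Eucl n)} {g : Eucl n → ℝ} {f : Eucl n → F}
    (hg : tsupport g ⊆ V) (h : ∀ x, x ∉ tsupport g → f x = 0) :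
    ∫ x in V, f x = ∫ x, f x :=
  setIntegral_eq_integral_of_forall_compl_eq_zero fun x hx => h x fun h' => hx (hg h')

/-- Integration by parts for smooth functions, one of which has compact support. -/
theorem integral_smul_gradient {n : ℕ} {V : Set (Eucl n)} {g φ : Eucl n → ℝ}
    (hg : ContDiff ℝ ∞ g) (hφ : IsTestFunction V φ) :
    ∫ x in V, g x • gradient φ x = -∫ x in V, φ x • gradient g x := by
  have hz : ∀ x, x ∉ tsupport φ → gradient φ x = 0 := fun x hx =>
    gradient_eq_zero_of_notMem_tsupport hx
  have hz' : ∀ x, x ∉ tsupport φ → φ x = 0 := fun x hx => image_eq_zero_of_notMem_tsupport hx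
  rw [setIntegral_eq_integral_of_tsupport hφ.support_subset fun x hx => by rw [hz x hx, smul_zero],
    setIntegral_eq_integral_of_tsupport hφ.support_subset fun x hx => by rw [hz' x hx, zero_smul]]
  have hgd := continuous_gradient hg
  have hφd := continuous_gradient hφ.smooth
  have i1 : Integrable (fun x => g x • gradient φ x) :=
    (hg.continuous.smul hφd).integrable_of_hasCompactSupport
      (hφ.hasCompactSupport_gradient.smul_left (f := g))
  have i2 : Integrable (fun x => φ x • gradient g x) :=
    (hφ.continuous.smul hgd).integrable_of_hasCompactSupport
      (hφ.compact.smul_right (f' := gradient g))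
  have i3 : Integrable (fun x => g x * φ x) :=
    (hg.continuous.mul hφ.continuous).integrable_of_hasCompactSupport hφ.compact.mul_left
  refine ext_inner_left ℝ fun v => ?_
  rw [inner_neg_right, ← integral_inner i1, ← integral_inner i2]
  have key := integral_mul_fderiv_eq_neg_fderiv_mul_of_integrable (μ := (volume : Measure (Eucl n)))
    (f := g) (g := φ) (v := v) ?_ ?_ i3 (fun x _ => hg.differentiable (by simp) x)
    (fun x _ => hφ.differentiable x)
  · have e1 : ∀ x, ⟪v, g x • gradient φ x⟫_ℝ = g x * fderiv ℝ φ x v := fun x => by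
      rw [inner_smul_right, inner_gradient_right]; simp
    have e2 : ∀ x, ⟪v, φ x • gradient g x⟫_ℝ = fderiv ℝ g x v * φ x := fun x => by
      rw [inner_smul_right, inner_gradient_right, mul_comm]; simp
    simp_rw [e1, e2]
    exact key
  · refine (i2.const_inner v).congr (ae_of_all _ fun x => ?_)
    simp only [inner_smul_right, inner_gradient_right]
    simp [mul_comm]
  · refine (i1.const_inner v).congr (ae_of_all _ fun x => ?_)
    simp only [inner_smul_right, inner_gradient_right]
    simp

/-! ### Estimates in `L²` -/

theorem enorm_integral_smul_le {α F : Type*} [MeasurableSpace α] [NormedAddCommGroup F]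
    [NormedSpace ℝ F] {ν : Measure α} {a : α → ℝ} {b : α → F} (ha : AEStronglyMeasurable a ν)
    (hb : AEStronglyMeasurable b ν) :
    ‖∫ x, a x • b x ∂ν‖ₑ ≤ eLpNorm a 2 ν * eLpNorm b 2 ν := by
  refine (enorm_integral_le_lintegral_enorm _).trans ?_
  rw [← eLpNorm_one_eq_lintegral_enorm]
  exact eLpNorm_smul_le_mul_eLpNorm hb ha

theorem enorm_integral_inner_le {α F : Type*} [MeasurableSpace α] [NormedAddCommGroup F]
    [InnerProductSpace ℝ F] {ν : Measure α} {a b : α → F} (ha : AEStronglyMeasurable a ν)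
    (hb : AEStronglyMeasurable b ν) :
    ‖∫ x, ⟪a x, b x⟫_ℝ ∂ν‖ₑ ≤ eLpNorm a 2 ν * eLpNorm b 2 ν := by
  refine (enorm_integral_le_lintegral_enorm _).trans ?_
  rw [← eLpNorm_one_eq_lintegral_enorm]
  have := eLpNorm_le_eLpNorm_mul_eLpNorm_of_nnnorm (p := 2) (q := 2) (r := 1) ha hb
    (fun x y => ⟪x, y⟫_ℝ) 1 (ae_of_all _ fun x => by simpa using nnnorm_inner_le_nnnorm (𝕜 := ℝ) (a x) (b x))
  simpa using this

theorem integrable_smul_of_memLp {α F : Type*} [MeasurableSpace α] [NormedAddCommGroup F]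
    [NormedSpace ℝ F] {ν : Measure α} {a : α → ℝ} {b : α → F} (ha : MemLp a 2 ν)
    (hb : MemLp b 2 ν) : Integrable (fun x => a x • b x) ν :=
  memLp_one_iff_integrable.1 (hb.smul ha)

theorem ENNReal.eq_zero_of_forall_le_mul {x M : ℝ≥0∞} (hM : M ≠ ⊤)
    (h : ∀ ε : ℝ≥0∞, 0 < ε → x ≤ M * ε) : x = 0 := by
  have hlim : Tendsto (fun ε : ℝ≥0∞ => M * ε) (𝓝[>] 0) (𝓝 (M * 0)) :=
    (ENNReal.Tendsto.const_mul tendsto_id (Or.inr hM)).mono_left nhdsWithin_le_nhds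
  rw [mul_zero] at hlim
  exact le_antisymm (ge_of_tendsto hlim (eventually_mem_nhdsWithin.mono fun ε hε => h ε hε)) bot_le

/-- Comparison of `L²` norms over two sets: a function on `V'` that is controlled on `V' ∩ V` by a
function on `V`, and vanishes elsewhere. -/
theorem eLpNorm_restrict_le_of_le {n : ℕ} {F F' : Type*} [NormedAddCommGroup F]
    [NormedAddCommGroup F'] {V V' : Set (Eucl n)} (hV : MeasurableSet V) (hV' : MeasurableSet V')
    {f : Eucl n → F} {g : Eucl n → F'} {C : ℝ} (hC : 0 ≤ C)
    (h : ∀ x ∈ V' ∩ V, ‖f x‖ ≤ C * ‖g x‖)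
    (h0 : ∀ x ∈ V' \ V, f x = 0) :
    eLpNorm f 2 (volume.restrict V') ≤ ENNReal.ofReal C * eLpNorm g 2 (volume.restrict V) := by
  rw [← eLpNorm_indicator_eq_eLpNorm_restrict hV, ← eLpNorm_indicator_eq_eLpNorm_restrict hV']
  refine eLpNorm_le_mul_eLpNorm_of_ae_le_mul (ae_of_all _ fun x => ?_) 2
  by_cases hx' : x ∈ V'
  · by_cases hx : x ∈ V
    · simpa [hx, hx'] using h x ⟨hx', hx⟩
    · simp [hx, hx', h0 x ⟨hx', hx⟩]
  · by_cases hx : x ∈ V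
    · simp only [indicator_of_notMem hx', norm_zero]
      positivity
    · simp [hx, hx']

theorem aestronglyMeasurable_restrict_of_eq_zero {n : ℕ} {F : Type*} [NormedAddCommGroup F]
    {V V' : Set (Eucl n)} (hV : MeasurableSet V) (hV' : MeasurableSet V') {f : Eucl n → F}
    (hf : AEStronglyMeasurable f (volume.restrict V)) (h0 : ∀ x ∈ V' \ V, f x = 0) :
    AEStronglyMeasurable f (volume.restrict V') := by
  have h : AEStronglyMeasurable (V.indicator f) volume :=
    (aestronglyMeasurable_indicator_iff hV).2 hf
  refine (h.mono_measure Measure.restrict_le_self).congr ?_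
  filter_upwards [ae_restrict_mem hV'] with x hx'
  by_cases hx : x ∈ V
  · simp [hx]
  · simp [hx, h0 x ⟨hx', hx⟩]

/-! ### Weighted Sobolev spaces with Dirichlet conditions -/

/-- A distributional gradient may be computed along an approximating sequence of smooth functions
whose gradients converge. -/
theorem hasWeakGradient_of_approx {n : ℕ} {w : Eucl n → ℝ} (hw : Continuous w)
    (hw0 : ∀ x, 0 < w x) {V : Set (Eucl n)} {u : Eucl n → ℝ} {G : Eucl n → Eucl n}
    (hu : MemLp (fun x => w x * u x) 2 (volume.restrict V)) (hG : MemLp G 2 (volume.restrict V))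
    {K : ℝ≥0∞} (hK : K ≠ ⊤)
    (happ : ∀ ε : ℝ≥0∞, 0 < ε → ∃ g : Eucl n → ℝ, ContDiff ℝ ∞ g ∧
      MemLp (fun x => w x * g x) 2 (volume.restrict V) ∧
      MemLp (gradient g) 2 (volume.restrict V) ∧
      eLpNorm (fun x => w x * (u x - g x)) 2 (volume.restrict V)
        + eLpNorm (fun x => G x - gradient g x) 2 (volume.restrict V) ≤ K * ε) :
    HasWeakGradient V u G := by
  intro φ hφ
  have hwi : Continuous fun x => (w x)⁻¹ := hw.inv₀ fun x => (hw0 x).ne'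
  have hb : MemLp (fun x => (w x)⁻¹ • gradient φ x) 2 (volume.restrict V) :=
    ((hwi.smul (continuous_gradient hφ.smooth)).memLp_of_hasCompactSupport
      (hφ.hasCompactSupport_gradient.smul_left (f := fun x => (w x)⁻¹))).mono_measure
      Measure.restrict_le_self
  have hφ2 : MemLp φ 2 (volume.restrict V) := by
    simpa using hφ.memLp_mul (w := fun _ => 1) continuous_const V
  have hsplit : ∀ (v : Eucl n → ℝ) (x : Eucl n),
      v x • gradient φ x = (w x * v x) • ((w x)⁻¹ • gradient φ x) := fun v x => by
    rw [smul_smul, mul_right_comm, mul_inv_cancel₀ (hw0 x).ne', one_mul]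
  have hint : ∀ v : Eucl n → ℝ, MemLp (fun x => w x * v x) 2 (volume.restrict V) →
      Integrable (fun x => v x • gradient φ x) (volume.restrict V) := fun v hv => by
    simp_rw [hsplit v]
    exact integrable_smul_of_memLp hv hb
  rw [eq_neg_iff_add_eq_zero, ← enorm_eq_zero]
  set M := eLpNorm (fun x => (w x)⁻¹ • gradient φ x) 2 (volume.restrict V)
    + eLpNorm φ 2 (volume.restrict V) with hM
  have hMt : M ≠ ⊤ := by
    rw [hM]; exact ENNReal.add_ne_top.2 ⟨hb.2.ne, hφ2.2.ne⟩
  refine ENNReal.eq_zero_of_forall_le_mul (M := M * K) (ENNReal.mul_ne_top hMt hK) fun ε hε => ?_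
  obtain ⟨g, hg, hwg, hgg, hgε⟩ := happ ε hε
  have hparts := integral_smul_gradient (V := V) hg hφ
  have e1 : ∫ x in V, (u x - g x) • gradient φ x
      = (∫ x in V, u x • gradient φ x) - ∫ x in V, g x • gradient φ x := by
    rw [← integral_sub (hint u hu) (hint g hwg)]
    simp_rw [sub_smul]
  have e2 : ∫ x in V, φ x • (G x - gradient g x)
      = (∫ x in V, φ x • G x) - ∫ x in V, φ x • gradient g x := by
    rw [← integral_sub (integrable_smul_of_memLp hφ2 hG) (integrable_smul_of_memLp hφ2 hgg)]
    simp_rw [smul_sub]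
  have e3 : (∫ x in V, u x • gradient φ x) + ∫ x in V, φ x • G x
      = (∫ x in V, (u x - g x) • gradient φ x) + ∫ x in V, φ x • (G x - gradient g x) := by
    rw [e1, e2, hparts]; abel
  rw [e3]
  refine (enorm_add_le _ _).trans ?_
  have hdu : MemLp (fun x => w x * (u x - g x)) 2 (volume.restrict V) := by
    simp_rw [mul_sub]; exact hu.sub hwg
  have b1 : ‖∫ x in V, (u x - g x) • gradient φ x‖ₑ
      ≤ eLpNorm (fun x => w x * (u x - g x)) 2 (volume.restrict V) *
        eLpNorm (fun x => (w x)⁻¹ • gradient φ x) 2 (volume.restrict V) := by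
    have := enorm_integral_smul_le hdu.1 hb.1
    simpa only [← hsplit (fun x => u x - g x)] using this
  have b2 : ‖∫ x in V, φ x • (G x - gradient g x)‖ₑ
      ≤ eLpNorm φ 2 (volume.restrict V) *
        eLpNorm (fun x => G x - gradient g x) 2 (volume.restrict V) :=
    enorm_integral_smul_le hφ2.1 (hG.sub hgg).1
  calc _ ≤ (K * ε) * eLpNorm (fun x => (w x)⁻¹ • gradient φ x) 2 (volume.restrict V)
        + eLpNorm φ 2 (volume.restrict V) * (K * ε) := by
        gcongr
        · exact b1.trans (by gcongr; exact le_self_add.trans hgε)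
        · exact b2.trans (by gcongr; exact le_add_self.trans hgε)
    _ = M * K * ε := by rw [hM]; ring

/-- Membership in a Sobolev closure from approximation up to a fixed factor; the weak gradient is
automatic. -/
theorem memSobolevClosure_of_approx {n : ℕ} {w : Eucl n → ℝ} (hw : Continuous w)
    (hw0 : ∀ x, 0 < w x) {U V : Set (Eucl n)} {u : Eucl n → ℝ} {G : Eucl n → Eucl n}
    (hu : MemLp (fun x => w x * u x) 2 (volume.restrict V)) (hG : MemLp G 2 (volume.restrict V))
    {K : ℝ≥0∞} (hK : K ≠ ⊤)
    (happ : ∀ ε : ℝ≥0∞, 0 < ε → ∃ g : Eucl n → ℝ, IsTestFunction U g ∧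
      eLpNorm (fun x => w x * (u x - g x)) 2 (volume.restrict V)
        + eLpNorm (fun x => G x - gradient g x) 2 (volume.restrict V) ≤ K * ε) :
    HasSobolevGradient w V u G ∧ MemSobolevClosure w U V u := by
  have h : HasSobolevGradient w V u G := ⟨hu, hG, hasWeakGradient_of_approx hw hw0 hu hG hK
    fun ε hε => let ⟨g, hg, hgε⟩ := happ ε hε
      ⟨g, hg.smooth, hg.memLp_mul hw V, hg.memLp_gradient V, hgε⟩⟩
  refine ⟨h, G, h, fun ε hε => ?_⟩
  obtain ⟨δ, hδ, hδε⟩ := ENNReal.exists_nnreal_pos_mul_lt hK hε.ne'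
  obtain ⟨g, hg, hgε⟩ := happ δ (by simpa using hδ)
  exact ⟨g, hg, hgε.trans_lt (by rwa [mul_comm])⟩

theorem MemSobolevClosure.sub {n : ℕ} {w : Eucl n → ℝ} (hw : Continuous w) (hw0 : ∀ x, 0 < w x)
    {U V : Set (Eucl n)} {u v : Eucl n → ℝ} (hu : MemSobolevClosure w U V u)
    (hv : MemSobolevClosure w U V v) : MemSobolevClosure w U V (fun x => u x - v x) := by
  obtain ⟨G, hG, hGa⟩ := hu
  obtain ⟨H, hH, hHa⟩ := hv
  refine (memSobolevClosure_of_approx hw hw0 (G := fun x => G x - H x) ?_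
    (hG.memLp_grad.sub hH.memLp_grad) (K := 2) (by simp) fun ε hε => ?_).2
  · simp_rw [mul_sub]; exact hG.memLp.sub hH.memLp
  obtain ⟨g, hg, hgε⟩ := hGa ε hε
  obtain ⟨k, hk, hkε⟩ := hHa ε hε
  refine ⟨fun x => g x - k x, hg.sub hk, ?_⟩
  have i1 : MemLp (fun x => w x * (u x - g x)) 2 (volume.restrict V) := by
    simp_rw [mul_sub]; exact hG.memLp.sub (hg.memLp_mul hw V)
  have i2 : MemLp (fun x => w x * (v x - k x)) 2 (volume.restrict V) := by
    simp_rw [mul_sub]; exact hH.memLp.sub (hk.memLp_mul hw V)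
  have b1 : eLpNorm (fun x => w x * (u x - v x - (g x - k x))) 2 (volume.restrict V)
      ≤ eLpNorm (fun x => w x * (u x - g x)) 2 (volume.restrict V)
        + eLpNorm (fun x => w x * (v x - k x)) 2 (volume.restrict V) := by
    refine le_trans (le_of_eq ?_) (eLpNorm_sub_le i1.1 i2.1 (by norm_num))
    congr 1; ext x; simp only [Pi.sub_apply]; ring
  have b2 : eLpNorm (fun x => G x - H x - gradient (fun y => g y - k y) x) 2 (volume.restrict V)
      ≤ eLpNorm (fun x => G x - gradient g x) 2 (volume.restrict V)
        + eLpNorm (fun x => H x - gradient k x) 2 (volume.restrict V) := by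
    refine le_trans (le_of_eq ?_) (eLpNorm_sub_le (hG.memLp_grad.sub (hg.memLp_gradient V)).1
      (hH.memLp_grad.sub (hk.memLp_gradient V)).1 (by norm_num))
    congr 1; ext1 x
    rw [gradient_sub (hg.differentiable x) (hk.differentiable x)]
    simp only [Pi.sub_apply]; abel
  calc _ ≤ _ := add_le_add b1 b2
    _ = (eLpNorm (fun x => w x * (u x - g x)) 2 (volume.restrict V)
          + eLpNorm (fun x => G x - gradient g x) 2 (volume.restrict V))
        + (eLpNorm (fun x => w x * (v x - k x)) 2 (volume.restrict V)
          + eLpNorm (fun x => H x - gradient k x) 2 (volume.restrict V)) := by abel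
    _ ≤ ε + ε := add_le_add hgε.le hkε.le
    _ = 2 * ε := by ring

/-- Multiplication by a smooth function `η`, combined with a change of the domain (from `V` to `V'`,
extending by zero where `η` vanishes), of the weight, and of the space of test functions. The
products of `η` with the old test functions need only be limits of new ones. -/
theorem MemSobolevClosure.mul_transfer {n : ℕ} {w w' : Eucl n → ℝ} (hw : Continuous w)
    (hw0 : ∀ x, 0 < w x) (hw' : Continuous w') (hw0' : ∀ x, 0 < w' x) {U U' V V' : Set (Eucl n)}
    (hV : MeasurableSet V) (hV' : MeasurableSet V') {η : Eucl n → ℝ} (hη : ContDiff ℝ ∞ η)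
    {C : ℝ} (hC : 0 ≤ C) (h1 : ∀ x ∈ V' ∩ V, w' x * |η x| ≤ C * w x)
    (h2 : ∀ x ∈ V' ∩ V, |η x| ≤ C) (h3 : ∀ x ∈ V' ∩ V, ‖gradient η x‖ ≤ C * w x)
    (h0 : ∀ x ∈ V' \ V, η x = 0 ∧ gradient η x = 0)
    (htest : ∀ g, IsTestFunction U g → ∀ ε : ℝ≥0∞, 0 < ε → ∃ g', IsTestFunction U' g' ∧
      eLpNorm (fun x => w' x * (η x * g x - g' x)) 2 (volume.restrict V')
        + eLpNorm (fun x => gradient (fun y => η y * g y) x - gradient g' x) 2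
          (volume.restrict V') ≤ ε)
    {u : Eucl n → ℝ} (hu : MemSobolevClosure w U V u) :
    MemSobolevClosure w' U' V' (fun x => η x * u x) := by
  obtain ⟨G, hG, hGa⟩ := hu
  have hwi : Continuous fun x => (w x)⁻¹ := hw.inv₀ fun x => (hw0 x).ne'
  have hηg := continuous_gradient hη
  have hum : AEStronglyMeasurable u (volume.restrict V) := by
    refine (hwi.aestronglyMeasurable.mul hG.memLp.1).congr (ae_of_all _ fun x => ?_)
    simp only [Pi.mul_apply]
    rw [← mul_assoc, inv_mul_cancel₀ (hw0 x).ne', one_mul]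
  -- `∇(η v) = η ∇v + v ∇η`; the bounds are stated separately for `v` and for `F` in place of `∇v`
  have bnd1 : ∀ v : Eucl n → ℝ, eLpNorm (fun x => w' x * (η x * v x)) 2 (volume.restrict V')
      ≤ ENNReal.ofReal C * eLpNorm (fun x => w x * v x) 2 (volume.restrict V) := fun v => by
    refine eLpNorm_restrict_le_of_le hV hV' hC (fun x hx => ?_) fun x hx => by simp [(h0 x hx).1]
    rw [norm_mul, norm_mul, norm_mul, Real.norm_eq_abs (w' x), Real.norm_eq_abs (w x),
      abs_of_pos (hw0' x), abs_of_pos (hw0 x), ← mul_assoc, ← mul_assoc]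
    exact mul_le_mul_of_nonneg_right (h1 x hx) (norm_nonneg _)
  have bnd2 : ∀ F : Eucl n → Eucl n, eLpNorm (fun x => η x • F x) 2 (volume.restrict V')
      ≤ ENNReal.ofReal C * eLpNorm F 2 (volume.restrict V) := fun F => by
    refine eLpNorm_restrict_le_of_le hV hV' hC (fun x hx => ?_) fun x hx => by simp [(h0 x hx).1]
    rw [norm_smul]
    exact mul_le_mul_of_nonneg_right (h2 x hx) (norm_nonneg _)
  have bnd3 : ∀ v : Eucl n → ℝ, eLpNorm (fun x => v x • gradient η x) 2 (volume.restrict V')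
      ≤ ENNReal.ofReal C * eLpNorm (fun x => w x * v x) 2 (volume.restrict V) := fun v => by
    refine eLpNorm_restrict_le_of_le hV hV' hC (fun x hx => ?_) fun x hx => by simp [(h0 x hx).2]
    rw [norm_smul, norm_mul, Real.norm_eq_abs (w x), abs_of_pos (hw0 x), mul_comm, ← mul_assoc]
    exact mul_le_mul_of_nonneg_right (h3 x hx) (norm_nonneg _)
  have m1 : ∀ v : Eucl n → ℝ, AEStronglyMeasurable v (volume.restrict V) →
      AEStronglyMeasurable (fun x => w' x * (η x * v x)) (volume.restrict V') := fun v hv =>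
    aestronglyMeasurable_restrict_of_eq_zero hV hV'
      (hw'.aestronglyMeasurable.mul (hη.continuous.aestronglyMeasurable.mul hv))
      fun x hx => by simp [(h0 x hx).1]
  have m2 : ∀ F : Eucl n → Eucl n, AEStronglyMeasurable F (volume.restrict V) →
      AEStronglyMeasurable (fun x => η x • F x) (volume.restrict V') := fun F hF =>
    aestronglyMeasurable_restrict_of_eq_zero hV hV'
      (hη.continuous.aestronglyMeasurable.smul hF) fun x hx => by simp [(h0 x hx).1]
  have m3 : ∀ v : Eucl n → ℝ, AEStronglyMeasurable v (volume.restrict V) →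
      AEStronglyMeasurable (fun x => v x • gradient η x) (volume.restrict V') := fun v hv =>
    aestronglyMeasurable_restrict_of_eq_zero hV hV'
      (hv.smul hηg.aestronglyMeasurable) fun x hx => by simp [(h0 x hx).2]
  refine (memSobolevClosure_of_approx hw' hw0' (G := fun x => η x • G x + u x • gradient η x)
    ⟨m1 u hum, (bnd1 u).trans_lt (ENNReal.mul_lt_top ENNReal.ofReal_lt_top hG.memLp.2)⟩
    (MemLp.add ⟨m2 G hG.memLp_grad.1,
        (bnd2 G).trans_lt (ENNReal.mul_lt_top ENNReal.ofReal_lt_top hG.memLp_grad.2)⟩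
      ⟨m3 u hum, (bnd3 u).trans_lt (ENNReal.mul_lt_top ENNReal.ofReal_lt_top hG.memLp.2)⟩)
    (K := 2 * ENNReal.ofReal C + 1) (by finiteness) fun ε hε => ?_).2
  obtain ⟨g, hg, hgε⟩ := hGa ε hε
  obtain ⟨g', hg', hgε'⟩ := htest g hg ε hε
  refine ⟨g', hg', ?_⟩
  have hgm : AEStronglyMeasurable g (volume.restrict V) := hg.continuous.aestronglyMeasurable
  have hηgs : ContDiff ℝ ∞ fun x => η x * g x := hη.mul hg.smooth
  have c1 : eLpNorm (fun x => w' x * (η x * u x - g' x)) 2 (volume.restrict V')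
      ≤ eLpNorm (fun x => w' x * (η x * (u x - g x))) 2 (volume.restrict V')
        + eLpNorm (fun x => w' x * (η x * g x - g' x)) 2 (volume.restrict V') := by
    refine le_trans (le_of_eq ?_) (eLpNorm_add_le (m1 _ (hum.sub hgm))
      (hw'.mul (hηgs.continuous.sub hg'.continuous)).aestronglyMeasurable (by norm_num))
    congr 1; ext x; simp only [Pi.add_apply]; ring
  have c2 : eLpNorm (fun x => η x • G x + u x • gradient η x - gradient g' x) 2
        (volume.restrict V')
      ≤ (eLpNorm (fun x => η x • (G x - gradient g x)) 2 (volume.restrict V')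
        + eLpNorm (fun x => (u x - g x) • gradient η x) 2 (volume.restrict V'))
        + eLpNorm (fun x => gradient (fun y => η y * g y) x - gradient g' x) 2
          (volume.restrict V') := by
    have a1 := m2 _ (hG.memLp_grad.1.sub (continuous_gradient hg.smooth).aestronglyMeasurable)
    have a2 := m3 _ (hum.sub hgm)
    have a3 : AEStronglyMeasurable (fun x => gradient (fun y => η y * g y) x - gradient g' x)
        (volume.restrict V') :=
      ((continuous_gradient hηgs).sub (continuous_gradient hg'.smooth)).aestronglyMeasurable
    refine le_trans (le_of_eq ?_) ((eLpNorm_add_le (a1.add a2) a3 (by norm_num)).trans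
      (add_le_add_left (eLpNorm_add_le a1 a2 (by norm_num)) _))
    congr 1; ext1 x
    rw [Pi.add_apply, Pi.add_apply,
      gradient_mul (hη.differentiable (by simp) x) (hg.differentiable x)]
    simp only [Pi.sub_apply, smul_sub, sub_smul]; abel
  set e1 := eLpNorm (fun x => w x * (u x - g x)) 2 (volume.restrict V)
  set e2 := eLpNorm (fun x => G x - gradient g x) 2 (volume.restrict V)
  calc _ ≤ _ := add_le_add (c1.trans (add_le_add_left (bnd1 _) _))
        (c2.trans (add_le_add_left (add_le_add (bnd2 _) (bnd3 _)) _))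
    _ = ENNReal.ofReal C * (2 * e1 + e2)
        + (eLpNorm (fun x => w' x * (η x * g x - g' x)) 2 (volume.restrict V')
        + eLpNorm (fun x => gradient (fun y => η y * g y) x - gradient g' x) 2
          (volume.restrict V')) := by ring
    _ ≤ ENNReal.ofReal C * (2 * (e1 + e2)) + ε := by
        gcongr
        rw [mul_add]
        gcongr
        exact le_mul_of_one_le_left' (by norm_num)
    _ ≤ ENNReal.ofReal C * (2 * ε) + ε := by gcongr
    _ = (2 * ENNReal.ofReal C + 1) * ε := by ring

/-! ### The Laplacian -/

theorem laplacian_eq_sum {n : ℕ} {f : Eucl n → ℝ} (hf : ContDiff ℝ ∞ f) (x : Eucl n) :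
    Laplacian.laplacian f x = ∑ i,
      fderiv ℝ (fun y => fderiv ℝ f y (EuclideanSpace.basisFun (Fin n) ℝ i)) x
        (EuclideanSpace.basisFun (Fin n) ℝ i) := by
  rw [InnerProductSpace.laplacian_eq_iteratedFDeriv_orthonormalBasis f
    (EuclideanSpace.basisFun (Fin n) ℝ)]
  refine Finset.sum_congr rfl fun i _ => ?_
  rw [iteratedFDeriv_two_apply]
  have h : DifferentiableAt ℝ (fderiv ℝ f) x :=
    (hf.fderiv_right (m := ∞) (by simp)).differentiable (by simp) x
  rw [fderiv_clm_apply h (differentiableAt_const _)]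
  simp

theorem continuous_laplacian {n : ℕ} {f : Eucl n → ℝ} (hf : ContDiff ℝ ∞ f) :
    Continuous (Laplacian.laplacian f) := by
  have h : Laplacian.laplacian f = fun x => ∑ i, fderiv ℝ
      (fun y => fderiv ℝ f y (EuclideanSpace.basisFun (Fin n) ℝ i)) x
      (EuclideanSpace.basisFun (Fin n) ℝ i) := funext (laplacian_eq_sum hf)
  rw [h]
  refine continuous_finsetSum _ fun i _ => ?_
  have h2 : ContDiff ℝ ∞ (fun y => fderiv ℝ f y (EuclideanSpace.basisFun (Fin n) ℝ i)) :=
    (hf.fderiv_right (m := ∞) (by simp)).clm_apply contDiff_const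
  exact (h2.continuous_fderiv (by simp)).clm_apply continuous_const

theorem laplacian_eq_zero_of_notMem_tsupport_sub {n : ℕ} {f : Eucl n → ℝ} {c : ℝ} {x : Eucl n}
    (hx : x ∉ tsupport fun y => f y - c) : Laplacian.laplacian f x = 0 := by
  have h : f =ᶠ[𝓝 x] fun _ => c := by
    filter_upwards [notMem_tsupport_iff_eventuallyEq.1 hx] with y hy
    simpa [sub_eq_zero] using hy
  rw [(InnerProductSpace.laplacian_congr_nhds h).eq_of_nhds]
  simp

theorem laplacian_eq_zero_of_notMem_tsupport {n : ℕ} {f : Eucl n → ℝ} {x : Eucl n}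
    (hx : x ∉ tsupport f) : Laplacian.laplacian f x = 0 :=
  laplacian_eq_zero_of_notMem_tsupport_sub (c := 0) (by simpa using hx)

theorem laplacian_mul {n : ℕ} {f g : Eucl n → ℝ} (hf : ContDiff ℝ ∞ f) (hg : ContDiff ℝ ∞ g)
    (x : Eucl n) :
    Laplacian.laplacian (fun y => f y * g y) x
      = f x * Laplacian.laplacian g x + 2 * ⟪gradient f x, gradient g x⟫_ℝ
        + g x * Laplacian.laplacian f x := by
  rw [laplacian_eq_sum (hf.mul hg), laplacian_eq_sum hf, laplacian_eq_sum hg,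
    ← (EuclideanSpace.basisFun (Fin n) ℝ).sum_inner_mul_inner, Finset.mul_sum, Finset.mul_sum,
    Finset.mul_sum, ← Finset.sum_add_distrib, ← Finset.sum_add_distrib]
  refine Finset.sum_congr rfl fun i _ => ?_
  set e := EuclideanSpace.basisFun (Fin n) ℝ i
  have hfd := hf.differentiable (by simp)
  have hgd := hg.differentiable (by simp)
  have hf' : Differentiable ℝ fun y => fderiv ℝ f y e :=
    ((hf.fderiv_right (m := ∞) (by simp)).clm_apply contDiff_const).differentiable (by simp)
  have hg' : Differentiable ℝ fun y => fderiv ℝ g y e :=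
    ((hg.fderiv_right (m := ∞) (by simp)).clm_apply contDiff_const).differentiable (by simp)
  have h1 : (fun y => fderiv ℝ (fun y => f y * g y) y e)
      = fun y => f y * fderiv ℝ g y e + g y * fderiv ℝ f y e := by
    ext y
    rw [fderiv_fun_mul (hfd y) (hgd y)]
    simp
  rw [h1, fderiv_fun_add ((hfd x).fun_mul (hg' x)) ((hgd x).fun_mul (hf' x)),
    fderiv_fun_mul (hfd x) (hg' x), fderiv_fun_mul (hgd x) (hf' x), inner_gradient_left,
    inner_gradient_right]
  simp only [add_apply, smul_apply, smul_eq_mul, conj_trivial]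
  ring

theorem IsTestFunction.hasCompactSupport_laplacian {n : ℕ} {U : Set (Eucl n)} {g : Eucl n → ℝ}
    (hg : IsTestFunction U g) : HasCompactSupport (Laplacian.laplacian g) := by
  refine hg.compact.mono' fun x hx => ?_
  by_contra h
  exact hx (laplacian_eq_zero_of_notMem_tsupport h)

/-- Green's formula for the weak gradient, from testing it against the partial derivatives of `g`. -/
theorem HasSobolevGradient.integral_mul_laplacian {n : ℕ} {w : Eucl n → ℝ} (hw : Continuous w)
    (hw0 : ∀ x, 0 < w x) {V : Set (Eucl n)} {u : Eucl n → ℝ} {G : Eucl n → Eucl n}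
    (hu : HasSobolevGradient w V u G) {g : Eucl n → ℝ} (hg : IsTestFunction V g) :
    ∫ x in V, u x * Laplacian.laplacian g x = -∫ x in V, ⟪G x, gradient g x⟫_ℝ := by
  have hwi : Continuous fun x => (w x)⁻¹ := hw.inv₀ fun x => (hw0 x).ne'
  set e := fun i => EuclideanSpace.basisFun (Fin n) ℝ i
  have ht : ∀ i, IsTestFunction V (fun x => fderiv ℝ g x (e i)) := fun i => hg.fderiv_apply (e i)
  have i1 : ∀ i, Integrable (fun x => u x • gradient (fun y => fderiv ℝ g y (e i)) x)
      (volume.restrict V) := fun i => by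
    have hb : MemLp (fun x => (w x)⁻¹ • gradient (fun y => fderiv ℝ g y (e i)) x) 2
        (volume.restrict V) :=
      ((hwi.smul (continuous_gradient (ht i).smooth)).memLp_of_hasCompactSupport
        ((ht i).hasCompactSupport_gradient.smul_left (f := fun x => (w x)⁻¹))).mono_measure
        Measure.restrict_le_self
    refine (integrable_smul_of_memLp hu.memLp hb).congr (ae_of_all _ fun x => ?_)
    beta_reduce
    rw [smul_smul, mul_right_comm, mul_inv_cancel₀ (hw0 x).ne', one_mul]
  have i2 : ∀ i, Integrable (fun x => fderiv ℝ g x (e i) • G x) (volume.restrict V) := fun i =>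
    integrable_smul_of_memLp (by simpa using (ht i).memLp_mul (w := fun _ => 1) continuous_const V)
      hu.memLp_grad
  have key : ∀ i, ∫ x in V, u x * fderiv ℝ (fun y => fderiv ℝ g y (e i)) x (e i)
      = -∫ x in V, ⟪G x, e i⟫_ℝ * ⟪e i, gradient g x⟫_ℝ := fun i => by
    have h := congrArg (fun v => ⟪e i, v⟫_ℝ) (hu.weak _ (ht i))
    simp only [inner_neg_right] at h
    rw [← integral_inner (i1 i), ← integral_inner (i2 i)] at h
    have e1 : ∀ x, ⟪e i, u x • gradient (fun y => fderiv ℝ g y (e i)) x⟫_ℝ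
        = u x * fderiv ℝ (fun y => fderiv ℝ g y (e i)) x (e i) := fun x => by
      rw [inner_smul_right, inner_gradient_right]; simp
    have e2 : ∀ x, ⟪e i, fderiv ℝ g x (e i) • G x⟫_ℝ = ⟪G x, e i⟫_ℝ * ⟪e i, gradient g x⟫_ℝ :=
      fun x => by
        rw [inner_smul_right, inner_gradient_right, real_inner_comm]; simp [mul_comm]
    simp_rw [e1, e2] at h
    exact h
  have j1 : ∀ i, Integrable (fun x => u x * fderiv ℝ (fun y => fderiv ℝ g y (e i)) x (e i))
      (volume.restrict V) := fun i => ((i1 i).const_inner (e i)).congr (ae_of_all _ fun x => by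
        simp only [inner_smul_right, inner_gradient_right]; simp)
  have j2 : ∀ i, Integrable (fun x => ⟪G x, e i⟫_ℝ * ⟪e i, gradient g x⟫_ℝ)
      (volume.restrict V) := fun i => ((i2 i).const_inner (e i)).congr (ae_of_all _ fun x => by
        beta_reduce
        rw [inner_smul_right, inner_gradient_right, real_inner_comm (e i)]; simp [mul_comm])
  have hs : ∀ x, ⟪G x, gradient g x⟫_ℝ = ∑ i, ⟪G x, e i⟫_ℝ * ⟪e i, gradient g x⟫_ℝ := fun x =>
    ((EuclideanSpace.basisFun (Fin n) ℝ).sum_inner_mul_inner (G x) (gradient g x)).symm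
  simp_rw [laplacian_eq_sum hg.smooth, Finset.mul_sum, hs]
  rw [integral_finsetSum _ fun i _ => j1 i, integral_finsetSum _ fun i _ => j2 i,
    ← Finset.sum_neg_distrib]
  exact Finset.sum_congr rfl fun i _ => key i

/-! ### The Dirichlet problem -/

/-- The graph of `g ↦ (w g, ∇g)` on `C^∞_0(U)`, as a subspace of `L²(U) × L²(U; ℝⁿ)`. -/
def testGraph {n : ℕ} (w : Eucl n → ℝ) (U : Set (Eucl n)) :
    Submodule ℝ (WithLp 2 (Lp ℝ 2 (volume.restrict U) × Lp (Eucl n) 2 (volume.restrict U))) where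
  carrier := {z | ∃ g : Eucl n → ℝ, IsTestFunction U g ∧
    (z.fst =ᵐ[volume.restrict U] fun x => w x * g x) ∧ z.snd =ᵐ[volume.restrict U] gradient g}
  add_mem' := by
    rintro y z ⟨f, hf, hf1, hf2⟩ ⟨g, hg, hg1, hg2⟩
    refine ⟨_, hf.add hg, ?_, ?_⟩
    · filter_upwards [Lp.coeFn_add y.fst z.fst, hf1, hg1] with x h1 h2 h3
      rw [WithLp.add_fst, h1, Pi.add_apply, h2, h3, mul_add]
    · filter_upwards [Lp.coeFn_add y.snd z.snd, hf2, hg2] with x h1 h2 h3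
      rw [WithLp.add_snd, h1, Pi.add_apply, h2, h3,
        gradient_add (hf.differentiable x) (hg.differentiable x)]
  zero_mem' := by
    refine ⟨_, IsTestFunction.zero U, ?_, ?_⟩
    · filter_upwards [Lp.coeFn_zero ℝ 2 (volume.restrict U)] with x h1
      rw [WithLp.zero_fst, h1, mul_zero, Pi.zero_apply]
    · filter_upwards [Lp.coeFn_zero (Eucl n) 2 (volume.restrict U)] with x h1
      rw [WithLp.zero_snd, h1, gradient_fun_const, Pi.zero_apply]
  smul_mem' := by
    rintro c z ⟨g, hg, hg1, hg2⟩
    refine ⟨_, hg.const_mul c, ?_, ?_⟩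
    · filter_upwards [Lp.coeFn_smul c z.fst, hg1] with x h1 h2
      rw [WithLp.smul_fst, h1, Pi.smul_apply, h2, smul_eq_mul]
      ring
    · filter_upwards [Lp.coeFn_smul c z.snd, hg2] with x h1 h2
      rw [WithLp.smul_snd, h1, Pi.smul_apply, h2, gradient_const_mul (hg.differentiable x)]

/-- The Poincaré inequality extends from the test functions to the closure of their graph. -/
theorem norm_fst_le_of_mem_closure_testGraph {n : ℕ} {w : Eucl n → ℝ} {U : Set (Eucl n)}
    {C : ℝ} (hC : 0 ≤ C)
    (hP : ∀ g, IsTestFunction U g → eLpNorm (fun x => w x * g x) 2 (volume.restrict U)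
      ≤ ENNReal.ofReal C * eLpNorm (gradient g) 2 (volume.restrict U))
    {z : WithLp 2 (Lp ℝ 2 (volume.restrict U) × Lp (Eucl n) 2 (volume.restrict U))}
    (hz : z ∈ (testGraph w U).topologicalClosure) : ‖z.fst‖ ≤ C * ‖z.snd‖ := by
  have hcl : IsClosed {z : WithLp 2 (Lp ℝ 2 (volume.restrict U) ×
      Lp (Eucl n) 2 (volume.restrict U)) | ‖z.fst‖ ≤ C * ‖z.snd‖} :=
    isClosed_le (WithLp.fstL 2 ℝ _ _).continuous.norm
      (continuous_const.mul (WithLp.sndL 2 ℝ _ _).continuous.norm)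
  refine closure_minimal ?_ hcl hz
  rintro z ⟨g, hg, h1, h2⟩
  have h := hP g hg
  rw [← eLpNorm_congr_ae h1, ← eLpNorm_congr_ae h2] at h
  rw [mem_ofPred_eq, Lp.norm_def, Lp.norm_def, ← ENNReal.toReal_ofReal hC, ← ENNReal.toReal_mul]
  exact ENNReal.toReal_mono (ENNReal.mul_ne_top ENNReal.ofReal_ne_top (Lp.eLpNorm_ne_top _)) h

/-- The Lax–Milgram theorem on the closure of a subspace `S` of a product, for the form
`(y, z) ↦ ⟪y₂, z₂⟫` that is coercive because the second component controls the first. -/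
theorem exists_closure_inner_snd_eq {E₁ E₂ : Type*} [NormedAddCommGroup E₁]
    [InnerProductSpace ℝ E₁] [CompleteSpace E₁] [NormedAddCommGroup E₂] [InnerProductSpace ℝ E₂]
    [CompleteSpace E₂] (S : Submodule ℝ (WithLp 2 (E₁ × E₂))) {C : ℝ}
    (hS : ∀ z ∈ S.topologicalClosure, ‖z.fst‖ ≤ C * ‖z.snd‖) (a : E₂) (b : E₁) :
    ∃ z ∈ S.topologicalClosure, ∀ y ∈ S, ⟪z.snd, y.snd⟫_ℝ = ⟪a, y.snd⟫_ℝ + ⟪b, y.fst⟫_ℝ := by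
  set H := S.topologicalClosure with hH
  have : CompleteSpace H := S.isClosed_topologicalClosure.completeSpace_coe
  let p1 : H →L[ℝ] E₁ := (WithLp.fstL 2 ℝ _ _).comp H.subtypeL
  let p2 : H →L[ℝ] E₂ := (WithLp.sndL 2 ℝ _ _).comp H.subtypeL
  obtain ⟨B, hB⟩ : ∃ B : H →L[ℝ] H →L[ℝ] ℝ, ∀ y z, B y z = ⟪p2 y, p2 z⟫_ℝ :=
    ⟨(innerSL ℝ).bilinearComp p2 p2, fun y z => rfl⟩
  have hco : IsCoercive B := by
    refine ⟨(C ^ 2 + 1)⁻¹, by positivity, fun z => ?_⟩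
    have h1 : ‖p1 z‖ ≤ C * ‖p2 z‖ := hS z z.2
    have h2 : ‖z‖ ^ 2 = ‖p1 z‖ ^ 2 + ‖p2 z‖ ^ 2 :=
      WithLp.prod_norm_sq_eq_of_L2 (z : WithLp 2 (E₁ × E₂))
    rw [hB, real_inner_self_eq_norm_sq, mul_assoc, ← sq, h2, inv_mul_le_iff₀ (by positivity)]
    have := pow_le_pow_left₀ (norm_nonneg _) h1 2
    nlinarith
  let f : H := ContinuousLinearMap.adjoint p2 a + ContinuousLinearMap.adjoint p1 b
  let z : H := hco.continuousLinearEquivOfBilin.symm f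
  refine ⟨z, z.2, fun y hy => ?_⟩
  have h := hco.continuousLinearEquivOfBilin_apply z ⟨y, S.le_topologicalClosure hy⟩
  rw [ContinuousLinearEquiv.apply_symm_apply, hB, inner_add_left,
    ContinuousLinearMap.adjoint_inner_left, ContinuousLinearMap.adjoint_inner_left] at h
  exact h.symm

theorem integrable_inner_of_memLp {α F : Type*} [MeasurableSpace α] [NormedAddCommGroup F]
    [InnerProductSpace ℝ F] {ν : Measure α} {a b : α → F} (ha : MemLp a 2 ν) (hb : MemLp b 2 ν) :
    Integrable (fun x => ⟪a x, b x⟫_ℝ) ν :=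
  (ha.norm.integrable_mul hb.norm).mono' (ha.1.inner hb.1)
    (ae_of_all _ fun x => norm_inner_le_norm (a x) (b x))

/-- Solvability of the Dirichlet problem `⟨∇Y, ∇v⟩ = ⟨a, ∇v⟩ + ⟨b, w v⟩` when the Poincaré
inequality `‖w g‖ ≤ C ‖∇g‖` holds on `C^∞_0(U)`: the Dirichlet form is then coercive on the closure
of the graph of `g ↦ (w g, ∇g)`. -/
theorem exists_dirichlet_solution {n : ℕ} {w : Eucl n → ℝ} (hw : Continuous w)
    (hw0 : ∀ x, 0 < w x) {U : Set (Eucl n)} {C : ℝ} (hC : 0 ≤ C)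
    (hP : ∀ g, IsTestFunction U g → eLpNorm (fun x => w x * g x) 2 (volume.restrict U)
      ≤ ENNReal.ofReal C * eLpNorm (gradient g) 2 (volume.restrict U))
    {a : Eucl n → Eucl n} {b : Eucl n → ℝ} (ha : MemLp a 2 (volume.restrict U))
    (hb : MemLp b 2 (volume.restrict U)) :
    ∃ (Y : Eucl n → ℝ) (Z : Eucl n → Eucl n), HasSobolevGradient w U Y Z ∧
      MemSobolevClosure w U U Y ∧
      ∀ v, IsTestFunction U v → ∫ x in U, ⟪Z x, gradient v x⟫_ℝ
        = (∫ x in U, ⟪a x, gradient v x⟫_ℝ) + ∫ x in U, b x * (w x * v x) := by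
  obtain ⟨z, hcl, hz⟩ := exists_closure_inner_snd_eq (testGraph w U)
    (fun z hz => norm_fst_le_of_mem_closure_testGraph hC hP hz) (ha.toLp a) (hb.toLp b)
  have hz1 : (fun x => w x * ((w x)⁻¹ * z.fst x)) = z.fst := by
    ext x; rw [← mul_assoc, mul_inv_cancel₀ (hw0 x).ne', one_mul]
  have hsob := memSobolevClosure_of_approx (U := U) (V := U) (u := fun x => (w x)⁻¹ * z.fst x)
    (G := z.snd) hw hw0 (by rw [hz1]; exact Lp.memLp _) (Lp.memLp _) (K := 2) (by simp) fun ε hε => ?_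
  · refine ⟨_, _, hsob.1, hsob.2, fun v hv => ?_⟩
    obtain ⟨y, hy⟩ : ∃ y : WithLp 2 (Lp ℝ 2 (volume.restrict U) × Lp (Eucl n) 2
        (volume.restrict U)), y = WithLp.toLp 2 ((hv.memLp_mul hw U).toLp (fun x => w x * v x),
          (hv.memLp_gradient U).toLp (gradient v)) := ⟨_, rfl⟩
    have y1 : y.fst =ᵐ[volume.restrict U] fun x => w x * v x := by
      rw [hy]; exact (hv.memLp_mul hw U).coeFn_toLp
    have y2 : y.snd =ᵐ[volume.restrict U] gradient v := by
      rw [hy]; exact (hv.memLp_gradient U).coeFn_toLp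
    have h := hz y ⟨v, hv, y1, y2⟩
    rw [L2.inner_def, L2.inner_def, L2.inner_def] at h
    have i1 : ∫ x in U, ⟪z.snd x, y.snd x⟫_ℝ = ∫ x in U, ⟪z.snd x, gradient v x⟫_ℝ :=
      integral_congr_ae (y2.mono fun x hx => by beta_reduce; rw [hx])
    have i2 : ∫ x in U, ⟪ha.toLp a x, y.snd x⟫_ℝ = ∫ x in U, ⟪a x, gradient v x⟫_ℝ :=
      integral_congr_ae (by
        filter_upwards [y2, ha.coeFn_toLp] with x hx hx'
        rw [hx, hx'])
    have i3 : ∫ x in U, ⟪hb.toLp b x, y.fst x⟫_ℝ = ∫ x in U, b x * (w x * v x) :=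
      integral_congr_ae (by
        filter_upwards [y1, hb.coeFn_toLp] with x hx hx'
        rw [hx, hx', real_inner_comm]; simp)
    rw [i1, i2, i3] at h
    exact h
  · rcases eq_or_ne ε ⊤ with rfl | hεt
    · exact ⟨_, IsTestFunction.zero U, by simp⟩
    obtain ⟨y, ⟨g, hg, hg1, hg2⟩, hy⟩ := Metric.mem_closure_iff.1 hcl ε.toReal
      (ENNReal.toReal_pos hε.ne' hεt)
    refine ⟨g, hg, ?_⟩
    have hd : ∀ {F : Type} [NormedAddCommGroup F] (k l : Lp F 2 (volume.restrict U)),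
        ‖k - l‖ ≤ ε.toReal → eLpNorm (fun x => k x - l x) 2 (volume.restrict U) ≤ ε := by
      intro F _ k l hkl
      refine (eLpNorm_congr_ae (Lp.coeFn_sub k l)).symm.trans_le ?_
      rw [Lp.norm_def] at hkl
      exact (ENNReal.toReal_le_toReal (Lp.eLpNorm_ne_top _) hεt).1 hkl
    rw [dist_eq_norm] at hy
    have hnorm := WithLp.prod_norm_sq_eq_of_L2 (z - y)
    have n1 : ‖z.fst - y.fst‖ ≤ ε.toReal := by
      refine le_trans ?_ hy.le
      refine le_of_sq_le_sq ?_ (norm_nonneg _)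
      rw [hnorm]; exact le_add_of_nonneg_right (sq_nonneg _)
    have n2 : ‖z.snd - y.snd‖ ≤ ε.toReal := by
      refine le_trans ?_ hy.le
      refine le_of_sq_le_sq ?_ (norm_nonneg _)
      rw [hnorm]; exact le_add_of_nonneg_left (sq_nonneg _)
    rw [two_mul]
    refine add_le_add (le_trans (le_of_eq (eLpNorm_congr_ae ?_)) (hd _ _ n1))
      (le_trans (le_of_eq (eLpNorm_congr_ae ?_)) (hd _ _ n2))
    · filter_upwards [hg1] with x hx
      rw [hx, mul_sub, ← mul_assoc, mul_inv_cancel₀ (hw0 x).ne', one_mul]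
    · filter_upwards [hg2] with x hx
      rw [hx]

/-- A function of the Sobolev closure whose gradient is orthogonal to the gradients of the test
functions vanishes. -/
theorem MemSobolevClosure.ae_eq_zero {n : ℕ} {w : Eucl n → ℝ} (hw : Continuous w)
    (hw0 : ∀ x, 0 < w x) {U : Set (Eucl n)} {C : ℝ}
    (hP : ∀ g, IsTestFunction U g → eLpNorm (fun x => w x * g x) 2 (volume.restrict U)
      ≤ ENNReal.ofReal C * eLpNorm (gradient g) 2 (volume.restrict U))
    {D : Eucl n → ℝ} (hD : MemSobolevClosure w U U D) (hh : IsHarmonicIn U D) :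
    D =ᵐ[volume.restrict U] 0 := by
  obtain ⟨G, hG, hGa⟩ := hD
  have horth : ∀ v, IsTestFunction U v → ∫ x in U, ⟪G x, gradient v x⟫_ℝ = 0 := fun v hv => by
    rw [← neg_eq_zero, ← hG.integral_mul_laplacian hw hw0 hv, hh v hv]
  -- `G` is a limit of gradients of test functions, hence orthogonal to itself
  have hG0 : eLpNorm G 2 (volume.restrict U) = 0 := by
    have h1 : ‖∫ x in U, ⟪G x, G x⟫_ℝ‖ₑ = 0 := by
      refine ENNReal.eq_zero_of_forall_le_mul hG.memLp_grad.2.ne fun ε hε => ?_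
      obtain ⟨g, hg, hgε⟩ := hGa ε hε
      have e : ∫ x in U, ⟪G x, G x⟫_ℝ = ∫ x in U, ⟪G x, G x - gradient g x⟫_ℝ := by
        simp_rw [inner_sub_right]
        rw [integral_sub (integrable_inner_of_memLp hG.memLp_grad hG.memLp_grad)
          (integrable_inner_of_memLp hG.memLp_grad (hg.memLp_gradient U)), horth g hg, sub_zero]
      rw [e]
      refine (enorm_integral_inner_le hG.memLp_grad.1
        (hG.memLp_grad.sub (hg.memLp_gradient U)).1).trans ?_
      gcongr
      exact le_add_self.trans hgε.le
    rw [enorm_eq_zero, integral_eq_zero_iff_of_nonneg (fun x => real_inner_self_nonneg)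
      (integrable_inner_of_memLp hG.memLp_grad hG.memLp_grad)] at h1
    rw [eLpNorm_eq_zero_iff hG.memLp_grad.1 (by simp)]
    exact h1.mono fun x hx => inner_self_eq_zero.1 hx
  have hD0 : eLpNorm (fun x => w x * D x) 2 (volume.restrict U) = 0 := by
    refine ENNReal.eq_zero_of_forall_le_mul (M := 1 + ENNReal.ofReal C) (by finiteness) fun ε hε => ?_
    obtain ⟨g, hg, hgε⟩ := hGa ε hε
    have hwg := hg.memLp_mul hw U
    have b1 : eLpNorm (gradient g) 2 (volume.restrict U) ≤ ε := by
      have h := eLpNorm_sub_le hG.memLp_grad.1 (hG.memLp_grad.sub (hg.memLp_gradient U)).1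
        (p := 2) (by norm_num)
      rw [sub_sub_cancel, hG0, zero_add] at h
      exact h.trans (le_add_self.trans hgε.le)
    have b2 : eLpNorm (fun x => w x * D x) 2 (volume.restrict U)
        ≤ eLpNorm (fun x => w x * (D x - g x)) 2 (volume.restrict U)
          + eLpNorm (fun x => w x * g x) 2 (volume.restrict U) := by
      have i1 : MemLp (fun x => w x * (D x - g x)) 2 (volume.restrict U) := by
        simp_rw [mul_sub]; exact hG.memLp.sub hwg
      refine le_trans (le_of_eq ?_) (eLpNorm_add_le i1.1 hwg.1 (by norm_num))
      congr 1; ext x; simp only [Pi.add_apply]; ring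
    calc _ ≤ _ := b2
      _ ≤ ε + ENNReal.ofReal C * ε :=
        add_le_add (le_self_add.trans hgε.le) ((hP g hg).trans (by gcongr))
      _ = (1 + ENNReal.ofReal C) * ε := by ring
  rw [eLpNorm_eq_zero_iff hG.memLp.1 (by simp)] at hD0
  filter_upwards [hD0] with x hx
  exact (mul_eq_zero.1 hx).resolve_left (hw0 x).ne'

/-! ### Localization of Sobolev closures -/

/-- The version of `MemSobolevClosure.mul_transfer` where multiplication by `η` carries test
functions to restrictions of test functions. -/
theorem MemSobolevClosure.mul_transfer_of_eqOn {n : ℕ} {w w' : Eucl n → ℝ} (hw : Continuous w)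
    (hw0 : ∀ x, 0 < w x) (hw' : Continuous w') (hw0' : ∀ x, 0 < w' x) {U U' V V' : Set (Eucl n)}
    (hV : IsOpen V) (hV' : IsOpen V') {η : Eucl n → ℝ} (hη : ContDiff ℝ ∞ η)
    {C : ℝ} (hC : 0 ≤ C) (h1 : ∀ x ∈ V' ∩ V, w' x * |η x| ≤ C * w x)
    (h2 : ∀ x ∈ V' ∩ V, |η x| ≤ C) (h3 : ∀ x ∈ V' ∩ V, ‖gradient η x‖ ≤ C * w x)
    (h0 : ∀ x ∈ V' \ V, η x = 0 ∧ gradient η x = 0)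
    (htest : ∀ g, IsTestFunction U g → ∃ g', IsTestFunction U' g' ∧
      ∀ x ∈ V', g' x = η x * g x)
    {u : Eucl n → ℝ} (hu : MemSobolevClosure w U V u) :
    MemSobolevClosure w' U' V' (fun x => η x * u x) := by
  refine hu.mul_transfer hw hw0 hw' hw0' hV.measurableSet hV'.measurableSet hη hC h1 h2 h3 h0
    fun g hg ε _ => ?_
  obtain ⟨g', hg', he⟩ := htest g hg
  refine ⟨g', hg', ?_⟩
  have e1 : eLpNorm (fun x => w' x * (η x * g x - g' x)) 2 (volume.restrict V') = 0 := by
    refine (eLpNorm_congr_ae ?_).trans eLpNorm_zero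
    filter_upwards [ae_restrict_mem hV'.measurableSet] with x hx
    simp [he x hx]
  have e2 : eLpNorm (fun x => gradient (fun y => η y * g y) x - gradient g' x) 2
      (volume.restrict V') = 0 := by
    refine (eLpNorm_congr_ae ?_).trans eLpNorm_zero
    filter_upwards [ae_restrict_mem hV'.measurableSet] with x hx
    have : g' =ᶠ[𝓝 x] fun y => η y * g y := by
      filter_upwards [hV'.mem_nhds hx] with y hy using he y hy
    simp [this.gradient_eq]
  rw [e1, e2, add_zero]
  exact zero_le

/-- Restriction to a smaller set, with a change of test functions and of weight. -/
theorem MemSobolevClosure.transfer {n : ℕ} {w w' : Eucl n → ℝ} (hw : Continuous w)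
    (hw0 : ∀ x, 0 < w x) (hw' : Continuous w') (hw0' : ∀ x, 0 < w' x) {U U' V V' : Set (Eucl n)}
    (hV : IsOpen V) (hV' : IsOpen V') (hVV : V' ⊆ V)
    {C : ℝ} (h1 : ∀ x ∈ V', w' x ≤ C * w x)
    (htest : ∀ g, IsTestFunction U g → ∃ g', IsTestFunction U' g' ∧ ∀ x ∈ V', g' x = g x)
    {u : Eucl n → ℝ} (hu : MemSobolevClosure w U V u) : MemSobolevClosure w' U' V' u := by
  have hmax : ∀ x, C * w x ≤ max C 1 * w x := fun x =>
    mul_le_mul_of_nonneg_right (le_max_left _ _) (hw0 x).le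
  have h := hu.mul_transfer_of_eqOn hw hw0 hw' hw0' hV hV' (η := fun _ => 1) (U' := U')
    contDiff_const (C := max C 1) (by positivity)
    (fun x hx => by simpa using (h1 x hx.1).trans (hmax x)) (by simp)
    (fun x hx => by
      have := (hw0 x).le
      simp only [gradient_fun_const, norm_zero]; positivity)
    (fun x hx => (hx.2 (hVV hx.1)).elim) (by simpa using htest)
  simpa using h

theorem MemSobolevClosure.memLp_of_one {n : ℕ} {U V : Set (Eucl n)} {u : Eucl n → ℝ}
    (hu : MemSobolevClosure (fun _ => 1) U V u) : MemLp u 2 (volume.restrict V) := by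
  obtain ⟨G, hG, -⟩ := hu
  simpa using hG.memLp

theorem MemL2Loc.integrable_mul {n : ℕ} {U : Set (Eucl n)} {u k : Eucl n → ℝ}
    (hu : MemL2Loc U u) (hk : Continuous k) (hkc : HasCompactSupport k) (hkU : tsupport k ⊆ U) :
    Integrable (fun x => u x * k x) (volume.restrict U) := by
  have h1 : IntegrableOn (fun x => u x * k x) (tsupport k) :=
    (hu _ hkU hkc).integrable_mul ((hk.memLp_of_hasCompactSupport (p := 2) hkc).mono_measure
      Measure.restrict_le_self)
  have h2 : Integrable (fun x => u x * k x) :=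
    (integrableOn_iff_integrable_of_support_subset fun x hx =>
      subset_tsupport k fun h => hx (by simp [h])).1 h1
  exact h2.mono_measure Measure.restrict_le_self

theorem MemL2Loc.integrable_mul_laplacian {n : ℕ} {U : Set (Eucl n)} {u g : Eucl n → ℝ}
    (hu : MemL2Loc U u) (hg : IsTestFunction U g) :
    Integrable (fun x => u x * Laplacian.laplacian g x) (volume.restrict U) := by
  refine hu.integrable_mul (continuous_laplacian hg.smooth) hg.hasCompactSupport_laplacian
    (Subset.trans ?_ hg.support_subset)
  refine closure_minimal (fun x hx => ?_) (isClosed_tsupport _)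
  by_contra h
  exact hx (laplacian_eq_zero_of_notMem_tsupport h)

/-- A jointly continuous family of functions supported in a fixed compact set is continuous in
`L²` at a parameter where it vanishes. -/
theorem tendsto_eLpNorm_of_continuous {n : ℕ} {F : Type*} [NormedAddCommGroup F]
    {f : ℝ → Eucl n → F} (hf : Continuous (Function.uncurry f)) {t₀ : ℝ} (h0 : ∀ x, f t₀ x = 0)
    {K : Set (Eucl n)} (hK : IsCompact K) (hfK : ∀ t, ∀ x ∉ K, f t x = 0) (V : Set (Eucl n)) :
    Tendsto (fun t => eLpNorm (f t) 2 (volume.restrict V)) (𝓝 t₀) (𝓝 0) := by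
  rw [ENNReal.tendsto_nhds_zero]
  intro ε hε
  have hKt : volume K ^ (1 / (2 : ℝ≥0∞).toReal) ≠ ⊤ :=
    ENNReal.rpow_ne_top_of_nonneg (by simp) hK.measure_lt_top.ne
  obtain ⟨δ, hδ, hδε⟩ := ENNReal.exists_nnreal_pos_mul_lt hKt hε.ne'
  have hev : ∀ᶠ t in 𝓝 t₀, ∀ x ∈ K, ‖f t x‖ < δ := by
    refine hK.eventually_forall_of_forall_eventually fun x _ => ?_
    have : ContinuousAt (fun p : ℝ × Eucl n => ‖f p.1 p.2‖) (t₀, x) := hf.norm.continuousAt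
    exact this.eventually_lt continuousAt_const (by simpa [h0] using hδ)
  filter_upwards [hev] with t ht
  have hle : eLpNorm (f t) 2 volume ≤ eLpNorm (K.indicator fun _ => (δ : ℝ)) 2 volume := by
    refine eLpNorm_mono fun x => ?_
    by_cases hx : x ∈ K
    · simpa [hx] using (ht x hx).le
    · simp [hx, hfK t x hx]
  refine (eLpNorm_mono_measure _ Measure.restrict_le_self).trans (hle.trans ?_)
  rw [eLpNorm_indicator_const hK.measurableSet (by simp) (by simp)]
  simpa using hδε.le

/-- Products of a test function with the dilates `χ(t ·)` of a smooth function converge in `H¹` as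
`t → 1`. A cutoff supported in the closure of a region is in this way approximated by cutoffs
supported in the region itself. -/
theorem tendsto_dilate_mul {n : ℕ} {w χ g : Eucl n → ℝ} (hw : Continuous w) (hχ : ContDiff ℝ ∞ χ)
    {U : Set (Eucl n)} (hg : IsTestFunction U g) (V : Set (Eucl n)) :
    Tendsto (fun t : ℝ => eLpNorm (fun x => w x * (χ x * g x - χ (t • x) * g x)) 2
        (volume.restrict V)
      + eLpNorm (fun x => gradient (fun y => χ y * g y) x - gradient (fun y => χ (t • y) * g y) x) 2
        (volume.restrict V)) (𝓝 1) (𝓝 0) := by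
  have hχd := hχ.differentiable (by simp)
  have hχg := continuous_gradient hχ
  have hgc := hg.continuous
  have hgg := continuous_gradient hg.smooth
  have hχc := hχ.continuous
  have hdd : ∀ t : ℝ, Differentiable ℝ fun y => χ (t • y) := fun t =>
    hχd.comp (differentiable_id.const_smul t)
  have e : ∀ t : ℝ, (fun x => gradient (fun y => χ y * g y) x
      - gradient (fun y => χ (t • y) * g y) x) = fun x => (χ x • gradient g x + g x • gradient χ x)
        - (χ (t • x) • gradient g x + g x • (t • gradient χ (t • x))) := fun t => by
    ext1 x
    rw [gradient_mul (hχd x) (hg.differentiable x), gradient_mul (hdd t x) (hg.differentiable x),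
      gradient_comp_smul]
  simp_rw [e]
  rw [← add_zero (0 : ℝ≥0∞)]
  refine Tendsto.add ?_ ?_
  · refine tendsto_eLpNorm_of_continuous (by fun_prop) (by simp) hg.compact (fun t x hx => ?_) V
    rw [image_eq_zero_of_notMem_tsupport hx]; simp
  · refine tendsto_eLpNorm_of_continuous (by fun_prop) (by simp) hg.compact (fun t x hx => ?_) V
    rw [image_eq_zero_of_notMem_tsupport hx, gradient_eq_zero_of_notMem_tsupport hx]; simp

/-! ### Perturbed cones -/

/-- The open annulus `a < |x| < b`. -/
def openAnnulus (n : ℕ) (a b : ℝ) : Set (Eucl n) := {x | a < ‖x‖ ∧ ‖x‖ < b}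

theorem isOpen_openAnnulus {n : ℕ} (a b : ℝ) : IsOpen (openAnnulus n a b) :=
  (isOpen_lt continuous_const continuous_norm).inter (isOpen_lt continuous_norm continuous_const)

theorem isOpen_outerBall (n : ℕ) (ρ : ℝ) : IsOpen (outerBall n ρ) :=
  isOpen_lt continuous_const continuous_norm

/-- An open set `U` that coincides with the cone `Γ` in the region `V`, a neighbourhood of infinity
or of the vertex. The sets `W ρ` exhaust `U`, they stay away from the end (infinity or the vertex) of
`V`, and the weight `w` is bounded below on them. A Poincaré inequality with weight `w` holds on
`U`. By `dilation`, there are dilations arbitrarily close to the identity that move all points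
outside `V`, those of its boundary included, out of `closure V`. -/
structure IsPerturbedCone {n : ℕ} (Γ U V : Set (Eucl n)) (W : ℝ → Set (Eucl n))
    (w : Eucl n → ℝ) : Prop where
  isOpen_cone : IsOpen Γ
  cone_smul : ∀ x ∈ Γ, ∀ t : ℝ, 0 < t → t • x ∈ Γ
  isOpen_domain : IsOpen U
  isOpen_end : IsOpen V
  inter_eq : U ∩ V = Γ ∩ V
  isOpen_exhaustion : ∀ ρ, IsOpen (W ρ)
  exhausts : ∀ C ⊆ U, IsCompact C → ∃ ρ, 0 < ρ ∧ C ⊆ W ρ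
  subset_annulus : ∀ ρ, 0 < ρ → ∃ a b, 0 < a ∧ a < b ∧ W ρ ∩ closure V ⊆ openAnnulus n a b
  continuous_weight : Continuous w
  weight_pos : ∀ x, 0 < w x
  weight_le_one : ∀ x, w x ≤ 1
  weight_lower : ∀ ρ, 0 < ρ → ∃ c, 0 < c ∧ ∀ x ∈ W ρ, c ≤ w x
  dilation : ∃ᶠ t in 𝓝 (1 : ℝ), ∀ x : Eucl n, t • x ∈ closure V → x ∈ V
  poincare : ∃ C, 0 ≤ C ∧ ∀ g, IsTestFunction U g →
    eLpNorm (fun x => w x * g x) 2 (volume.restrict U)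
      ≤ ENNReal.ofReal C * eLpNorm (gradient g) 2 (volume.restrict U)

/-- A smooth function supported in `closure V` and equal to `1` in `V` outside an annulus. The
support may touch the boundary of `V`. -/
structure IsEndCutoff {n : ℕ} (V : Set (Eucl n)) (χ : Eucl n → ℝ) : Prop where
  smooth : ContDiff ℝ ∞ χ
  tsupport_subset : tsupport χ ⊆ closure V
  transition : ∃ a b, 0 < a ∧ a < b ∧ closure V ∩ tsupport (fun x => χ x - 1) ⊆ openAnnulus n a b

/-- A harmonic function on the cone with zero Dirichlet data on the lateral boundary, locally away
from the vertex and infinity. -/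
structure IsConeHarmonic {n : ℕ} (Γ : Set (Eucl n)) (h : Eucl n → ℝ) : Prop where
  dirichlet : ∀ a b, 0 < a → a < b →
    MemSobolevClosure (fun _ => 1) Γ (Γ ∩ openAnnulus n a b) h
  harmonic : IsHarmonicIn Γ h

/-- The harmonic functions on the perturbed cone `U`, with Dirichlet conditions, that are asymptotic
to `h` at the end `V`. -/
structure IsAsymptoticSolution {n : ℕ} (Γ U V : Set (Eucl n)) (W : ℝ → Set (Eucl n))
    (w h K : Eucl n → ℝ) : Prop where
  memL2Loc : MemL2Loc U K
  harmonic : IsHarmonicIn U K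
  dirichlet : ∀ ρ, 0 < ρ → MemSobolevClosure (fun _ => 1) U (U ∩ W ρ) K
  asymptotic : MemSobolevClosure w Γ (Γ ∩ V) (fun x => K x - h x)

namespace IsEndCutoff

variable {n : ℕ} {V : Set (Eucl n)} {χ : Eucl n → ℝ}

/-- The set where the cutoff varies is compact. -/
theorem isCompact_transition (hχ : IsEndCutoff V χ) :
    IsCompact (tsupport χ ∩ tsupport fun x => χ x - 1) := by
  obtain ⟨a, b, -, -, hab⟩ := hχ.transition
  refine Metric.isCompact_of_isClosed_isBounded
    ((isClosed_tsupport _).inter (isClosed_tsupport _)) ?_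
  refine (Metric.isBounded_ball (x := (0 : Eucl n)) (r := b)).subset fun x hx => ?_
  simpa using (hab ⟨hχ.tsupport_subset hx.1, hx.2⟩).2

/-- Common bound for the cutoff and its derivatives: away from the compact set where it varies, the
cutoff is locally `0` or `1`. -/
theorem exists_bound (hχ : IsEndCutoff V χ) :
    ∃ C, 1 ≤ C ∧ (∀ x, |χ x| ≤ C) ∧ (∀ x, ‖gradient χ x‖ ≤ C) ∧
      ∀ x, |Laplacian.laplacian χ x| ≤ C := by
  obtain ⟨C1, h1⟩ := hχ.isCompact_transition.exists_bound_of_continuousOn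
    hχ.smooth.continuous.continuousOn
  obtain ⟨C2, h2⟩ := hχ.isCompact_transition.exists_bound_of_continuousOn
    (continuous_gradient hχ.smooth).continuousOn
  obtain ⟨C3, h3⟩ := hχ.isCompact_transition.exists_bound_of_continuousOn
    (continuous_laplacian hχ.smooth).continuousOn
  have hle : ∀ x, x ∈ tsupport χ ∩ (tsupport fun x => χ x - 1) ∨ x ∉ tsupport χ ∨
      x ∉ tsupport fun x => χ x - 1 := fun x => by
    by_cases hx : x ∈ tsupport χ <;> by_cases hx' : x ∈ tsupport fun x => χ x - 1 <;> simp [hx, hx']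
  refine ⟨max 1 (max C1 (max C2 C3)), le_max_left _ _, fun x => ?_, fun x => ?_, fun x => ?_⟩
  · rcases hle x with hx | hx | hx
    · exact (h1 x hx).trans (by simp)
    · rw [image_eq_zero_of_notMem_tsupport hx]; simp
    · have : χ x - 1 = 0 := image_eq_zero_of_notMem_tsupport (f := fun x => χ x - 1) hx
      rw [sub_eq_zero.1 this]; simp
  · rcases hle x with hx | hx | hx
    · exact (h2 x hx).trans (by simp)
    · rw [gradient_eq_zero_of_notMem_tsupport hx]; simp
    · rw [gradient_eq_zero_of_notMem_tsupport_sub hx]; simp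
  · rcases hle x with hx | hx | hx
    · exact (h3 x hx).trans (by simp)
    · rw [laplacian_eq_zero_of_notMem_tsupport hx]; simp
    · rw [laplacian_eq_zero_of_notMem_tsupport_sub hx]; simp

end IsEndCutoff

/-! ### Harmonic functions on perturbed cones with prescribed behaviour -/

theorem isHarmonicIn_sub {n : ℕ} {U : Set (Eucl n)} {u v : Eucl n → ℝ} (hu : MemL2Loc U u)
    (hv : MemL2Loc U v) (h : LaplacianEqIn U u v) : IsHarmonicIn U (fun x => u x - v x) := by
  intro g hg
  simp_rw [sub_mul]
  rw [integral_sub (hu.integrable_mul_laplacian hg) (hv.integrable_mul_laplacian hg), h g hg,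
    sub_self]

namespace IsPerturbedCone

variable {n : ℕ} {Γ U V : Set (Eucl n)} {W : ℝ → Set (Eucl n)} {w h χ : Eucl n → ℝ}

/-- On the boundary of `V` the sets `U` and `Γ` may differ, but a boundary point of `V` that lies in
the open set `U` has dilates in `U ∩ V ⊆ Γ`. -/
theorem domain_inter_closure_subset (hU : IsPerturbedCone Γ U V W w) : U ∩ closure V ⊆ Γ := by
  rintro x ⟨hxU, hxV⟩
  have hev : ∀ᶠ t : ℝ in 𝓝 1, 0 < t ∧ t⁻¹ • x ∈ U := by
    refine (eventually_gt_nhds one_pos).and ?_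
    have hc : ContinuousAt (fun t : ℝ => t⁻¹ • x) 1 :=
      (continuousAt_inv₀ one_ne_zero).smul continuousAt_const
    exact hc.eventually_mem (hU.isOpen_domain.mem_nhds (by simpa using hxU))
  obtain ⟨t, ht, ht0, htU⟩ := (hU.dilation.and_eventually hev).exists
  have hV : t⁻¹ • x ∈ V := ht _ (by rwa [smul_smul, mul_inv_cancel₀ ht0.ne', one_smul])
  have hΓ : t⁻¹ • x ∈ Γ := (hU.inter_eq.subset ⟨htU, hV⟩).1
  simpa [smul_smul, ht0.ne'] using hU.cone_smul _ hΓ t ht0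

theorem memL2Loc_of_forall (hU : IsPerturbedCone Γ U V W w) {u : Eucl n → ℝ}
    (hu : ∀ ρ, 0 < ρ → MemSobolevClosure (fun _ => 1) U (U ∩ W ρ) u) : MemL2Loc U u := by
  intro C hCU hC
  obtain ⟨ρ, hρ, hCW⟩ := hU.exhausts C hCU hC
  exact (hu ρ hρ).memLp_of_one.mono_measure (Measure.restrict_mono (subset_inter hCU hCW) le_rfl)

theorem restrict_exhaustion (hU : IsPerturbedCone Γ U V W w) {Y : Eucl n → ℝ}
    (hY : MemSobolevClosure w U U Y) (ρ : ℝ) (hρ : 0 < ρ) :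
    MemSobolevClosure (fun _ => 1) U (U ∩ W ρ) Y := by
  obtain ⟨c, hc, hcw⟩ := hU.weight_lower ρ hρ
  refine hY.transfer hU.continuous_weight hU.weight_pos continuous_const (fun _ => one_pos)
    hU.isOpen_domain (hU.isOpen_domain.inter (hU.isOpen_exhaustion ρ)) inter_subset_left
    (C := c⁻¹) (fun x hx => ?_) fun g hg => ⟨g, hg, fun _ _ => rfl⟩
  rw [inv_mul_eq_div, le_div_iff₀ hc, one_mul]
  exact hcw x hx.2

theorem memL2Loc_of_memSobolevClosure (hU : IsPerturbedCone Γ U V W w) {Y : Eucl n → ℝ}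
    (hY : MemSobolevClosure w U U Y) : MemL2Loc U Y :=
  hU.memL2Loc_of_forall (hU.restrict_exhaustion hY)

/-- Near the end `V`, the test functions of `U` and of the cone have the same restrictions. -/
theorem restrict_end (hU : IsPerturbedCone Γ U V W w) {Y : Eucl n → ℝ}
    (hY : MemSobolevClosure w U U Y) : MemSobolevClosure w Γ (Γ ∩ V) Y := by
  refine hY.transfer hU.continuous_weight hU.weight_pos hU.continuous_weight hU.weight_pos
    hU.isOpen_domain (hU.isOpen_cone.inter hU.isOpen_end)
    (hU.inter_eq ▸ inter_subset_left) (C := 1) (by simp) fun g hg => ?_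
  have hK : IsCompact (tsupport g ∩ closure V) := hg.compact.inter_right isClosed_closure
  have hKΓ : tsupport g ∩ closure V ⊆ Γ := fun x hx =>
    hU.domain_inter_closure_subset ⟨hg.support_subset hx.1, hx.2⟩
  obtain ⟨O, hO, hKO, hOΓ, -⟩ := exists_open_between_and_isCompact_closure hK hU.isOpen_cone hKΓ
  obtain ⟨θ, hθ, -, hθO, hθ1⟩ := exists_contMDiff_support_eq_eq_one_iff
    (modelWithCornersSelf ℝ (Eucl n)) (n := ⊤) hO hK.isClosed hKO
  refine ⟨fun x => θ x * g x, hg.mul_left (contMDiff_iff_contDiff.1 hθ) ?_, fun x hx => ?_⟩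
  · refine inter_subset_left.trans (Subset.trans ?_ hOΓ)
    rw [tsupport, hθO]
  · beta_reduce
    by_cases hxg : x ∈ tsupport g
    · rw [(hθ1 x).1 ⟨hxg, subset_closure hx.2⟩, one_mul]
    · rw [image_eq_zero_of_notMem_tsupport hxg, mul_zero]

/-- `χ h` satisfies the Dirichlet conditions on `U`, away from the end of `V`. -/
theorem cutoff_mul_dirichlet (hU : IsPerturbedCone Γ U V W w) (hh : IsConeHarmonic Γ h)
    (hχ : IsEndCutoff V χ) (ρ : ℝ) (hρ : 0 < ρ) :
    MemSobolevClosure (fun _ => 1) U (U ∩ W ρ) (fun x => χ x * h x) := by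
  obtain ⟨a, b, ha, hab, hann⟩ := hU.subset_annulus ρ hρ
  obtain ⟨C, hC, hC1, hC2, -⟩ := hχ.exists_bound
  refine (hh.dirichlet a b ha hab).mul_transfer continuous_const (fun _ => one_pos)
    continuous_const (fun _ => one_pos)
    (hU.isOpen_cone.inter (isOpen_openAnnulus a b)).measurableSet
    (hU.isOpen_domain.inter (hU.isOpen_exhaustion ρ)).measurableSet hχ.smooth (C := C)
    (by linarith) (fun x _ => by simpa using hC1 x) (fun x _ => hC1 x)
    (fun x _ => by simpa using hC2 x) (fun x hx => ?_) fun g hg ε hε => ?_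
  · have hx' : x ∉ tsupport χ := fun h' => by
      have hV := hχ.tsupport_subset h'
      exact hx.2 ⟨hU.domain_inter_closure_subset ⟨hx.1.1, hV⟩, hann ⟨hx.1.2, hV⟩⟩
    exact ⟨image_eq_zero_of_notMem_tsupport hx', gradient_eq_zero_of_notMem_tsupport hx'⟩
  -- `χ g` need not be a test function of `U`, as `tsupport χ` may meet the boundary of `V`, where `U`
  -- and the cone are unrelated; the products with dilates of `χ` are supported in `V`
  · have hlim := tendsto_dilate_mul (w := fun _ => 1) continuous_const hχ.smooth hg (U ∩ W ρ)
    obtain ⟨t, ht, htε⟩ := (hU.dilation.and_eventually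
      ((ENNReal.tendsto_nhds_zero.1 hlim) ε hε)).exists
    refine ⟨fun x => χ (t • x) * g x, ?_, htε⟩
    refine hg.mul_left (hχ.smooth.comp (contDiff_const_smul t)) fun x hx => ?_
    have hx1 : t • x ∈ tsupport χ := by
      have : tsupport (fun y => χ (t • y)) ⊆ (fun y : Eucl n => t • y) ⁻¹' tsupport χ :=
        closure_minimal (fun y hy => subset_tsupport _ hy)
          ((isClosed_tsupport _).preimage (continuous_const_smul t))
      exact this hx.1
    exact (hU.inter_eq.superset ⟨hg.support_subset hx.2, ht x (hχ.tsupport_subset hx1)⟩).1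

/-- `χ h` and `h` differ by a finite-energy function near the end `V`: the difference lives in an
annulus. -/
theorem sub_one_mul_asymptotic (hU : IsPerturbedCone Γ U V W w) (hh : IsConeHarmonic Γ h)
    (hχ : IsEndCutoff V χ) : MemSobolevClosure w Γ (Γ ∩ V) (fun x => (χ x - 1) * h x) := by
  obtain ⟨a, b, ha, hab, hann⟩ := hχ.transition
  obtain ⟨C, hC, hC1, hC2, -⟩ := hχ.exists_bound
  have hs : ContDiff ℝ ∞ fun x => χ x - 1 := hχ.smooth.sub contDiff_const
  have hb : ∀ x, |χ x - 1| ≤ C + 1 := fun x => (abs_sub _ _).trans (by simpa using hC1 x)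
  refine (hh.dirichlet a b ha hab).mul_transfer_of_eqOn continuous_const (fun _ => one_pos)
    hU.continuous_weight hU.weight_pos (hU.isOpen_cone.inter (isOpen_openAnnulus a b))
    (hU.isOpen_cone.inter hU.isOpen_end) hs (C := C + 1) (by linarith) (fun x _ => ?_)
    (fun x _ => hb x) (fun x _ => ?_) (fun x hx => ?_)
    fun g hg => ⟨fun x => (χ x - 1) * g x, hg.mul_left hs
      (inter_subset_right.trans hg.support_subset), fun _ _ => rfl⟩
  · rw [mul_one]
    exact (mul_le_of_le_one_left (abs_nonneg _) (hU.weight_le_one x)).trans (hb x)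
  · rw [gradient_sub (hχ.smooth.differentiable (by simp) x) (differentiableAt_const _),
      gradient_fun_const, sub_zero]
    linarith [hC2 x]
  · have hx' : x ∉ tsupport fun x => χ x - 1 := fun h' =>
      hx.2 ⟨hx.1.1, hann ⟨subset_closure hx.1.2, h'⟩⟩
    exact ⟨image_eq_zero_of_notMem_tsupport (f := fun x => χ x - 1) hx',
      gradient_eq_zero_of_notMem_tsupport hx'⟩

/-- A function with Dirichlet conditions both in `V` and away from the end of `V` has Dirichlet
conditions on all of `U`. -/
theorem memSobolevClosure_of_local (hU : IsPerturbedCone Γ U V W w) {η : Eucl n → ℝ}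
    (hη : IsEndCutoff V η) (hηV : tsupport η ⊆ V) {ρ : ℝ}
    (hηW : (tsupport fun x => η x - 1) ⊆ W ρ) {D : Eucl n → ℝ}
    (h1 : MemSobolevClosure (fun _ => 1) U (U ∩ W ρ) D)
    (h2 : MemSobolevClosure w Γ (Γ ∩ V) D) : MemSobolevClosure w U U D := by
  obtain ⟨C, hC, hC1, hC2, -⟩ := hη.exists_bound
  have hs : ContDiff ℝ ∞ fun x => η x - 1 := hη.smooth.sub contDiff_const
  have hb : ∀ x, |η x - 1| ≤ C + 1 := fun x => (abs_sub _ _).trans (by simpa using hC1 x)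
  obtain ⟨c, hc, hcw⟩ : ∃ c, 0 < c ∧ ∀ x ∈ tsupport η ∩ tsupport fun x => η x - 1, c ≤ w x := by
    rcases (tsupport η ∩ tsupport fun x => η x - 1).eq_empty_or_nonempty with he | hne
    · exact ⟨1, one_pos, by simp [he]⟩
    · obtain ⟨x, -, hx⟩ := hη.isCompact_transition.exists_isMinOn hne
        hU.continuous_weight.continuousOn
      exact ⟨w x, hU.weight_pos x, fun y hy => hx hy⟩
  have hg : ∀ x, ‖gradient η x‖ ≤ C / c * w x := fun x => by
    by_cases hx : x ∈ tsupport η ∩ tsupport fun x => η x - 1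
    · rw [div_mul_eq_mul_div, le_div_iff₀ hc]
      exact mul_le_mul (hC2 x) (hcw x hx) hc.le (by linarith)
    · have : gradient η x = 0 := by
        by_cases hx' : x ∈ tsupport η
        · exact gradient_eq_zero_of_notMem_tsupport_sub fun h' => hx ⟨hx', h'⟩
        · exact gradient_eq_zero_of_notMem_tsupport hx'
      rw [this, norm_zero]
      have := (hU.weight_pos x).le
      positivity
  have hCc : 0 ≤ C / c := by positivity
  have k1 : MemSobolevClosure w U U (fun x => η x * D x) := by
    refine h2.mul_transfer_of_eqOn hU.continuous_weight hU.weight_pos hU.continuous_weight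
      hU.weight_pos (hU.isOpen_cone.inter hU.isOpen_end) hU.isOpen_domain hη.smooth
      (C := C + C / c) (by positivity) (fun x _ => ?_) (fun x _ => by linarith [hC1 x])
      (fun x _ => (hg x).trans ?_) (fun x hx => ?_)
      fun g hg => ⟨fun x => η x * g x, hg.mul_left hη.smooth fun x hx => ?_, fun _ _ => rfl⟩
    · rw [mul_comm]
      exact mul_le_mul_of_nonneg_right (by linarith [hC1 x]) (hU.weight_pos x).le
    · exact mul_le_mul_of_nonneg_right (by linarith) (hU.weight_pos x).le
    · have hx' : x ∉ tsupport η := fun h' => hx.2 (hU.inter_eq.subset ⟨hx.1, hηV h'⟩)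
      exact ⟨image_eq_zero_of_notMem_tsupport hx', gradient_eq_zero_of_notMem_tsupport hx'⟩
    · exact (hU.inter_eq.superset ⟨hg.support_subset hx.2, hηV hx.1⟩).1
  have k2 : MemSobolevClosure w U U (fun x => (η x - 1) * D x) := by
    refine h1.mul_transfer_of_eqOn continuous_const (fun _ => one_pos) hU.continuous_weight
      hU.weight_pos (hU.isOpen_domain.inter (hU.isOpen_exhaustion ρ)) hU.isOpen_domain hs
      (C := C + 1) (by linarith) (fun x _ => ?_)
      (fun x _ => hb x) (fun x _ => ?_) (fun x hx => ?_)
      fun g hg => ⟨fun x => (η x - 1) * g x, hg.mul_left hs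
        (inter_subset_right.trans hg.support_subset), fun _ _ => rfl⟩
    · rw [mul_one]
      exact (mul_le_of_le_one_left (abs_nonneg _) (hU.weight_le_one x)).trans (hb x)
    · rw [gradient_sub (hη.smooth.differentiable (by simp) x) (differentiableAt_const _),
        gradient_fun_const, sub_zero]
      linarith [hC2 x]
    · have hx' : x ∉ tsupport fun x => η x - 1 := fun h' => hx.2 ⟨hx.1, hηW h'⟩
      exact ⟨image_eq_zero_of_notMem_tsupport (f := fun x => η x - 1) hx',
        gradient_eq_zero_of_notMem_tsupport hx'⟩
  convert k1.sub hU.continuous_weight hU.weight_pos k2 using 2 with x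
  ring

/-- Uniqueness of the corrector. -/
theorem ae_eq_of_laplacianEqIn (hU : IsPerturbedCone Γ U V W w) {Y Y' : Eucl n → ℝ}
    (hY : MemSobolevClosure w U U Y) (hY' : MemSobolevClosure w U U Y')
    (h : LaplacianEqIn U Y' Y) : Y' =ᵐ[volume.restrict U] Y := by
  obtain ⟨C, -, hP⟩ := hU.poincare
  have hz := (hY'.sub hU.continuous_weight hU.weight_pos hY).ae_eq_zero hU.continuous_weight
    hU.weight_pos hP (isHarmonicIn_sub (hU.memL2Loc_of_memSobolevClosure hY')
      (hU.memL2Loc_of_memSobolevClosure hY) h)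
  filter_upwards [hz] with x hx using sub_eq_zero.1 hx

/-- The difference of two solutions has finite energy on all of `U`, so it vanishes. -/
theorem asymptoticSolution_unique (hU : IsPerturbedCone Γ U V W w) {η : Eucl n → ℝ}
    (hη : IsEndCutoff V η) (hηV : tsupport η ⊆ V) {ρ : ℝ} (hρ : 0 < ρ)
    (hηW : (tsupport fun x => η x - 1) ⊆ W ρ) {K K' : Eucl n → ℝ}
    (hK : IsAsymptoticSolution Γ U V W w h K) (hK' : IsAsymptoticSolution Γ U V W w h K') :
    K' =ᵐ[volume.restrict U] K := by
  obtain ⟨C, -, hP⟩ := hU.poincare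
  have h1 := (hK'.dirichlet ρ hρ).sub continuous_const (fun _ => one_pos) (hK.dirichlet ρ hρ)
  have h2 := hK'.asymptotic.sub hU.continuous_weight hU.weight_pos hK.asymptotic
  simp_rw [sub_sub_sub_cancel_right] at h2
  have hz := (hU.memSobolevClosure_of_local hη hηV hηW h1 h2).ae_eq_zero hU.continuous_weight
    hU.weight_pos hP (isHarmonicIn_sub hK'.memL2Loc hK.memL2Loc fun g hg => by
      rw [hK'.harmonic g hg, hK.harmonic g hg])
  filter_upwards [hz] with x hx using sub_eq_zero.1 hx

/-- `Δ(χ h)` only involves the derivatives of `χ`, since `h` is harmonic in the cone. -/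
theorem integral_cutoff_mul_laplacian (hU : IsPerturbedCone Γ U V W w) (hh : IsConeHarmonic Γ h)
    (hχ : IsEndCutoff V χ) {v : Eucl n → ℝ} (hv : IsTestFunction U v) :
    ∫ x in U, (χ x * h x) * Laplacian.laplacian v x
        + h x * (2 * ⟪gradient χ x, gradient v x⟫_ℝ + v x * Laplacian.laplacian χ x) = 0 := by
  have hχv : IsTestFunction Γ fun x => χ x * v x := hv.mul_left hχ.smooth fun x hx =>
    hU.domain_inter_closure_subset ⟨hv.support_subset hx.2, hχ.tsupport_subset hx.1⟩
  have e : ∀ x, (χ x * h x) * Laplacian.laplacian v x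
        + h x * (2 * ⟪gradient χ x, gradient v x⟫_ℝ + v x * Laplacian.laplacian χ x)
      = h x * Laplacian.laplacian (fun y => χ y * v y) x := fun x => by
    rw [laplacian_mul hχ.smooth hv.smooth]; ring
  simp_rw [e]
  rw [← hh.harmonic _ hχv, setIntegral_eq_integral_of_tsupport hχv.support_subset fun x hx => by
    rw [laplacian_eq_zero_of_notMem_tsupport hx, mul_zero]]
  refine setIntegral_eq_integral_of_tsupport
    ((tsupport_mul_subset_right (f := χ) (g := v)).trans hv.support_subset) fun x hx => ?_
  rw [laplacian_eq_zero_of_notMem_tsupport hx, mul_zero]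

/-- The corrector is the variational solution for the functional
`v ↦ ∫ h (2 ⟨∇χ, ∇v⟩ + v Δχ)`, which is bounded since `∇χ` and `Δχ` live in a compact annulus. -/
theorem exists_corrector (hU : IsPerturbedCone Γ U V W w) (hh : IsConeHarmonic Γ h)
    (hχ : IsEndCutoff V χ) :
    ∃ Y, MemSobolevClosure w U U Y ∧ LaplacianEqIn U Y (fun x => χ x * h x) := by
  obtain ⟨CP, hCP, hP⟩ := hU.poincare
  obtain ⟨a, b, ha, hab, hann⟩ := hχ.transition
  obtain ⟨C, hC, -, hC2, hC3⟩ := hχ.exists_bound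
  have hh2 : MemLp h 2 (volume.restrict (Γ ∩ openAnnulus n a b)) :=
    (hh.dirichlet a b ha hab).memLp_of_one
  have hmΓ := (hU.isOpen_cone.inter (isOpen_openAnnulus a b)).measurableSet
  have hmU := hU.isOpen_domain.measurableSet
  have hoff : ∀ x ∈ U \ (Γ ∩ openAnnulus n a b),
      gradient χ x = 0 ∧ Laplacian.laplacian χ x = 0 := fun x hx => by
    by_cases hx' : x ∈ tsupport χ
    · have hxs : x ∉ tsupport fun x => χ x - 1 := fun h' => by
        have hV := hχ.tsupport_subset hx'
        exact hx.2 ⟨hU.domain_inter_closure_subset ⟨hx.1, hV⟩, hann ⟨hV, h'⟩⟩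
      exact ⟨gradient_eq_zero_of_notMem_tsupport_sub hxs,
        laplacian_eq_zero_of_notMem_tsupport_sub hxs⟩
    · exact ⟨gradient_eq_zero_of_notMem_tsupport hx', laplacian_eq_zero_of_notMem_tsupport hx'⟩
  have hwi : Continuous fun x => (w x)⁻¹ :=
    hU.continuous_weight.inv₀ fun x => (hU.weight_pos x).ne'
  have hLc := continuous_laplacian hχ.smooth
  -- the zeroth order part of the functional is written as a pairing with `w v`
  obtain ⟨c, hc, hcw⟩ : ∃ c, 0 ≤ c ∧ ∀ x, |(w x)⁻¹ * Laplacian.laplacian χ x| ≤ c := by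
    obtain ⟨c, hc⟩ := hχ.isCompact_transition.exists_bound_of_continuousOn
      (hwi.mul hLc).continuousOn
    refine ⟨max c 0, le_max_right _ _, fun x => ?_⟩
    by_cases hx : x ∈ tsupport χ ∩ tsupport fun x => χ x - 1
    · exact (hc x hx).trans (le_max_left _ _)
    · have : Laplacian.laplacian χ x = 0 := by
        by_cases hx' : x ∈ tsupport χ
        · exact laplacian_eq_zero_of_notMem_tsupport_sub fun h' => hx ⟨hx', h'⟩
        · exact laplacian_eq_zero_of_notMem_tsupport hx'
      simp [this]
  have hA : MemLp (fun x => (2 * h x) • gradient χ x) 2 (volume.restrict U) := by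
    refine ⟨aestronglyMeasurable_restrict_of_eq_zero hmΓ hmU
      ((hh2.1.const_mul 2).smul (continuous_gradient hχ.smooth).aestronglyMeasurable)
      fun x hx => by simp [(hoff x hx).1], (eLpNorm_restrict_le_of_le hmΓ hmU (C := 2 * C)
        (by positivity) (g := h) (fun x _ => ?_) fun x hx => by simp [(hoff x hx).1]).trans_lt
        (ENNReal.mul_lt_top ENNReal.ofReal_lt_top hh2.2)⟩
    rw [norm_smul, norm_mul, Real.norm_ofNat, mul_right_comm]
    exact mul_le_mul_of_nonneg_right (mul_le_mul_of_nonneg_left (hC2 x) (by norm_num))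
      (norm_nonneg _)
  have hB : MemLp (fun x => ((w x)⁻¹ * Laplacian.laplacian χ x) * h x) 2 (volume.restrict U) := by
    refine ⟨aestronglyMeasurable_restrict_of_eq_zero hmΓ hmU
      ((hwi.mul hLc).aestronglyMeasurable.mul hh2.1)
      fun x hx => by simp [(hoff x hx).2], (eLpNorm_restrict_le_of_le hmΓ hmU (C := c)
        hc (g := h) (fun x _ => ?_) fun x hx => by simp [(hoff x hx).2]).trans_lt
        (ENNReal.mul_lt_top ENNReal.ofReal_lt_top hh2.2)⟩
    rw [norm_mul]
    exact mul_le_mul_of_nonneg_right (hcw x) (norm_nonneg _)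
  obtain ⟨Y, Z, hYZ, hY, hv⟩ := exists_dirichlet_solution hU.continuous_weight hU.weight_pos hCP hP
    hA hB
  refine ⟨Y, hY, fun v hvt => ?_⟩
  have hloc := hU.memL2Loc_of_forall (hU.cutoff_mul_dirichlet hh hχ)
  have key := hU.integral_cutoff_mul_laplacian hh hχ hvt
  have i1 := integrable_inner_of_memLp hA (hvt.memLp_gradient U)
  have i2 : Integrable (fun x => (w x)⁻¹ * Laplacian.laplacian χ x * h x * (w x * v x))
      (volume.restrict U) := hB.integrable_mul (hvt.memLp_mul hU.continuous_weight U)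
  have i12 : Integrable (fun x => ⟪(2 * h x) • gradient χ x, gradient v x⟫_ℝ
      + (w x)⁻¹ * Laplacian.laplacian χ x * h x * (w x * v x)) (volume.restrict U) := i1.add i2
  have e : ∀ x, h x * (2 * ⟪gradient χ x, gradient v x⟫_ℝ + v x * Laplacian.laplacian χ x)
      = ⟪(2 * h x) • gradient χ x, gradient v x⟫_ℝ
        + ((w x)⁻¹ * Laplacian.laplacian χ x) * h x * (w x * v x) := fun x => by
    have := (hU.weight_pos x).ne'
    rw [inner_smul_left, conj_trivial]
    field_simp
  simp_rw [e] at key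
  rw [integral_add (hloc.integrable_mul_laplacian hvt) i12, integral_add i1 i2,
    ← hv v hvt] at key
  rw [hYZ.integral_mul_laplacian hU.continuous_weight hU.weight_pos hvt]
  linarith

/-- Subtracting a corrector from `χ h` gives a harmonic function asymptotic to `h`. -/
theorem isAsymptoticSolution_cutoff_sub (hU : IsPerturbedCone Γ U V W w)
    (hh : IsConeHarmonic Γ h) (hχ : IsEndCutoff V χ) {Y : Eucl n → ℝ}
    (hY : MemSobolevClosure w U U Y) (hYΔ : LaplacianEqIn U Y (fun x => χ x * h x)) :
    IsAsymptoticSolution Γ U V W w h (fun x => χ x * h x - Y x) := by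
  have hd : ∀ ρ, 0 < ρ → MemSobolevClosure (fun _ => 1) U (U ∩ W ρ)
      (fun x => χ x * h x - Y x) := fun ρ hρ =>
    (hU.cutoff_mul_dirichlet hh hχ ρ hρ).sub continuous_const (fun _ => one_pos)
      (hU.restrict_exhaustion hY ρ hρ)
  refine ⟨hU.memL2Loc_of_forall hd, isHarmonicIn_sub
    (hU.memL2Loc_of_forall (hU.cutoff_mul_dirichlet hh hχ)) (hU.memL2Loc_of_memSobolevClosure hY)
    fun g hg => (hYΔ g hg).symm, hd, ?_⟩
  convert (hU.sub_one_mul_asymptotic hh hχ).sub hU.continuous_weight hU.weight_pos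
    (hU.restrict_end hY) using 2 with x
  ring

/-- Existence and uniqueness of the harmonic function asymptotic to `h`, and its representation
`χ h - Y` for every cutoff `χ`. The auxiliary cutoff `η`, supported in the open set `V`, serves to
glue the local conditions in the proof of uniqueness. -/
theorem exists_unique_asymptoticSolution (hU : IsPerturbedCone Γ U V W w)
    (hh : IsConeHarmonic Γ h) {η : Eucl n → ℝ}
    (hη : IsEndCutoff V η) (hηV : tsupport η ⊆ V) {ρ : ℝ} (hρ : 0 < ρ)
    (hηW : (tsupport fun x => η x - 1) ⊆ W ρ) :
    ∃ K, IsAsymptoticSolution Γ U V W w h K ∧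
      (∀ K', IsAsymptoticSolution Γ U V W w h K' → K' =ᵐ[volume.restrict U] K) ∧
      ∀ χ, IsEndCutoff V χ → ∃ Y,
        (MemSobolevClosure w U U Y ∧ LaplacianEqIn U Y (fun x => χ x * h x)) ∧
        (∀ Y', (MemSobolevClosure w U U Y' ∧ LaplacianEqIn U Y' (fun x => χ x * h x)) →
          Y' =ᵐ[volume.restrict U] Y) ∧
        K =ᵐ[volume.restrict U] fun x => χ x * h x - Y x := by
  obtain ⟨Y₀, hY₀, hYΔ₀⟩ := hU.exists_corrector hh hη
  have hK := hU.isAsymptoticSolution_cutoff_sub hh hη hY₀ hYΔ₀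
  refine ⟨_, hK, fun K' hK' => hU.asymptoticSolution_unique hη hηV hρ hηW hK hK',
    fun χ hχ => ?_⟩
  obtain ⟨Y, hY, hYΔ⟩ := hU.exists_corrector hh hχ
  exact ⟨Y, ⟨hY, hYΔ⟩,
    fun Y' hY' => hU.ae_eq_of_laplacianEqIn hY hY'.1 fun g hg => by rw [hY'.2 g hg, hYΔ g hg],
    hU.asymptoticSolution_unique hη hηV hρ hηW
      (hU.isAsymptoticSolution_cutoff_sub hh hχ hY hYΔ) hK⟩

end IsPerturbedCone

/-! ### Polar coordinates -/

instance instIsFiniteMeasureSurfaceMeasure (n : ℕ) : IsFiniteMeasure (surfaceMeasure n) := by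
  unfold surfaceMeasure; infer_instance

theorem polar_eq {n : ℕ} : (fun z : USphere n × Ioi (0 : ℝ) => (z.2 : ℝ) • (z.1 : Eucl n))
    = Subtype.val ∘ (homeomorphUnitSphereProd (Eucl n)).symm := by
  ext1 z
  simp

theorem measurableEmbedding_polar (n : ℕ) :
    MeasurableEmbedding (fun z : USphere n × Ioi (0 : ℝ) => (z.2 : ℝ) • (z.1 : Eucl n)) := by
  rw [polar_eq]
  exact (MeasurableEmbedding.subtype_coe (measurableSet_singleton _).compl).comp
    (Homeomorph.measurableEmbedding _)

theorem nontrivial_eucl {n : ℕ} (hn : 2 ≤ n) : Nontrivial (Eucl n) := by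
  have : Nonempty (Fin n) := ⟨⟨0, by omega⟩⟩
  infer_instance

theorem measurePreserving_polar {n : ℕ} (hn : 2 ≤ n) :
    MeasurePreserving (fun z : USphere n × Ioi (0 : ℝ) => (z.2 : ℝ) • (z.1 : Eucl n))
      ((surfaceMeasure n).prod (Measure.volumeIoiPow (n - 1))) volume := by
  have := nontrivial_eucl hn
  rw [polar_eq]
  have h1 := (volume : Measure (Eucl n)).measurePreserving_homeomorphUnitSphereProd
  rw [finrank_euclideanSpace_fin] at h1
  have h2 : MeasurePreserving (homeomorphUnitSphereProd (Eucl n)).symm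
      ((surfaceMeasure n).prod (Measure.volumeIoiPow (n - 1)))
      (volume.comap (Subtype.val : ({0}ᶜ : Set (Eucl n)) → Eucl n)) :=
    MeasurePreserving.symm (homeomorphUnitSphereProd (Eucl n)).toMeasurableEquiv h1
  have h3 : MeasurePreserving (Subtype.val : ({0}ᶜ : Set (Eucl n)) → Eucl n)
      (volume.comap (Subtype.val : ({0}ᶜ : Set (Eucl n)) → Eucl n)) volume := by
    refine ⟨measurable_subtype_coe, ?_⟩
    rw [map_comap_subtype_coe (measurableSet_singleton _).compl, restrict_compl_singleton]
  exact h3.comp h2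

theorem lintegral_volumeIoiPow (m : ℕ) {F : ℝ → ℝ≥0∞} (hF : Measurable F) :
    ∫⁻ r : Ioi (0 : ℝ), F r ∂(Measure.volumeIoiPow m)
      = ∫⁻ r in Ioi (0 : ℝ), ENNReal.ofReal (r ^ m) * F r := by
  rw [Measure.volumeIoiPow, lintegral_withDensity_eq_lintegral_mul _ (by fun_prop) (by fun_prop),
    ← lintegral_subtype_comap measurableSet_Ioi]
  rfl

theorem integral_volumeIoiPow (m : ℕ) (F : ℝ → ℝ) :
    ∫ r : Ioi (0 : ℝ), F r ∂(Measure.volumeIoiPow m) = ∫ r in Ioi (0 : ℝ), r ^ m * F r := by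
  simp only [Measure.volumeIoiPow, ENNReal.ofReal]
  rw [integral_withDensity_eq_integral_smul (measurable_subtype_coe.pow_const _).real_toNNReal,
    integral_subtype_comap measurableSet_Ioi fun a ↦ Real.toNNReal (a ^ m) • F a]
  refine setIntegral_congr_fun measurableSet_Ioi fun x hx => ?_
  rw [NNReal.smul_def, Real.coe_toNNReal _ (pow_nonneg hx.out.le _), smul_eq_mul]

/-- Integration in polar coordinates, for nonnegative functions. -/
theorem lintegral_polar {n : ℕ} (hn : 2 ≤ n) {f : Eucl n → ℝ≥0∞} (hf : Measurable f) :
    ∫⁻ x, f x = ∫⁻ r in Ioi (0 : ℝ), ENNReal.ofReal (r ^ (n - 1)) *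
      ∫⁻ θ : USphere n, f (r • (θ : Eucl n)) ∂(surfaceMeasure n) := by
  rw [← (measurePreserving_polar hn).lintegral_comp_emb (measurableEmbedding_polar n),
    lintegral_prod_symm (fun z : USphere n × Ioi (0 : ℝ) => f ((z.2 : ℝ) • (z.1 : Eucl n)))
      (hf.comp (measurableEmbedding_polar n).measurable).aemeasurable]
  refine lintegral_volumeIoiPow (n - 1)
    (F := fun r => ∫⁻ θ : USphere n, f (r • (θ : Eucl n)) ∂(surfaceMeasure n)) ?_
  refine Measurable.lintegral_prod_right' (f := fun p : ℝ × USphere n => f (p.1 • (p.2 : Eucl n))) ?_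
  fun_prop

/-- The direction `x / |x|` of a vector, with an arbitrary value `e` at the origin. -/
noncomputable def direction {n : ℕ} (e : USphere n) (x : Eucl n) : USphere n :=
  if hx : x = 0 then e else ⟨‖x‖⁻¹ • x, by simp [norm_smul, hx]⟩

theorem coe_direction {n : ℕ} (e : USphere n) {x : Eucl n} (hx : x ≠ 0) :
    (direction e x : Eucl n) = ‖x‖⁻¹ • x := by
  rw [direction, dif_neg hx]

theorem direction_smul {n : ℕ} (e : USphere n) (θ : USphere n) {r : ℝ} (hr : 0 < r) :
    direction e (r • (θ : Eucl n)) = θ := by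
  have hθ : ‖(θ : Eucl n)‖ = 1 := by simp
  have h0 : r • (θ : Eucl n) ≠ 0 := by
    rw [← norm_ne_zero_iff, norm_smul, hθ, mul_one]; simpa using hr.ne'
  ext1
  rw [coe_direction e h0, norm_smul, hθ, mul_one, Real.norm_of_nonneg hr.le, smul_smul,
    inv_mul_cancel₀ hr.ne', one_smul]

theorem measurable_direction {n : ℕ} (e : USphere n) : Measurable (direction e) := by
  refine Measurable.dite (s := {x : Eucl n | x = 0}) (f := fun _ => e)
    (g := fun x => ⟨‖(x : Eucl n)‖⁻¹ • (x : Eucl n), by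
      simp [norm_smul, show (x : Eucl n) ≠ 0 from x.2]⟩)
    measurable_const ?_ (measurableSet_singleton 0)
  refine Measurable.subtype_mk ?_
  fun_prop

theorem nonempty_usphere {n : ℕ} (hn : 2 ≤ n) : Nonempty (USphere n) := by
  have := nontrivial_eucl hn
  exact (NormedSpace.sphere_nonempty.2 zero_le_one).to_subtype

/-- The image of a radial measure under `x ↦ x / |x|` is a multiple of the surface measure. -/
theorem map_direction_withDensity {n : ℕ} (hn : 2 ≤ n) (e : USphere n) {ρ : ℝ → ℝ≥0∞}
    (hρ : Measurable ρ) :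
    (volume.withDensity fun x : Eucl n => ρ ‖x‖).map (direction e)
      = (∫⁻ r in Ioi (0 : ℝ), ENNReal.ofReal (r ^ (n - 1)) * ρ r) • surfaceMeasure n := by
  ext s hs
  have hm := measurable_direction e hs
  rw [Measure.map_apply (measurable_direction e) hs, withDensity_apply _ hm,
    ← lintegral_indicator hm, lintegral_polar hn (f := (direction e ⁻¹' s).indicator fun x => ρ ‖x‖)
      ((hρ.comp measurable_norm).indicator hm),
    Measure.smul_apply, smul_eq_mul, ← lintegral_mul_const _ (by fun_prop)]
  refine setLIntegral_congr_fun measurableSet_Ioi fun r hr => ?_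
  have hr0 : 0 < r := hr
  have h : ∀ θ : USphere n, (direction e ⁻¹' s).indicator (fun x => ρ ‖x‖) (r • (θ : Eucl n))
      = s.indicator (fun _ => ρ r) θ := fun θ => by
    have hθ : ‖(θ : Eucl n)‖ = 1 := by simp
    have hmem : r • (θ : Eucl n) ∈ direction e ⁻¹' s ↔ θ ∈ s := by
      rw [mem_preimage, direction_smul e θ hr0]
    by_cases hθs : θ ∈ s
    · rw [indicator_of_mem (hmem.2 hθs), indicator_of_mem hθs, norm_smul, hθ, mul_one,
        Real.norm_of_nonneg hr0.le]
    · rw [indicator_of_notMem fun h' => hθs (hmem.1 h'), indicator_of_notMem hθs]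
  simp_rw [h]
  rw [lintegral_indicator hs, lintegral_const, Measure.restrict_apply_univ, mul_assoc]

section Cone

variable {n : ℕ} {Γ : Set (Eucl n)}

theorem isOpen_sphericalSection (hΓ : IsOpen Γ) : IsOpen (sphericalSection Γ) :=
  hΓ.preimage continuous_subtype_val

theorem direction_mem_iff (hc : ∀ x ∈ Γ, ∀ t : ℝ, 0 < t → t • x ∈ Γ) (e : USphere n) {x : Eucl n}
    (hx : x ≠ 0) : direction e x ∈ sphericalSection Γ ↔ x ∈ Γ := by
  have h : 0 < ‖x‖ := norm_pos_iff.2 hx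
  change (direction e x : Eucl n) ∈ Γ ↔ _
  rw [coe_direction e hx]
  refine ⟨fun h' => ?_, fun h' => hc x h' _ (inv_pos.2 h)⟩
  simpa [smul_smul, h.ne'] using hc _ h' _ h

/-- The special case of Lebesgue measure on a cone, restricted to an annulus. -/
theorem map_direction_annulus (hn : 2 ≤ n) (hΓ : IsOpen Γ)
    (hc : ∀ x ∈ Γ, ∀ t : ℝ, 0 < t → t • x ∈ Γ) (e : USphere n) {a b : ℝ} (ha : 0 < a) :
    ∃ c : ℝ≥0∞, c ≠ ⊤ ∧ (volume.restrict (Γ ∩ openAnnulus n a b)).map (direction e)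
      = c • (surfaceMeasure n).restrict (sphericalSection Γ) := by
  refine ⟨∫⁻ r in Ioi (0 : ℝ), ENNReal.ofReal (r ^ (n - 1)) * (Ioo a b).indicator 1 r, ?_, ?_⟩
  · have hle : ∫⁻ r in Ioi (0 : ℝ), ENNReal.ofReal (r ^ (n - 1)) * (Ioo a b).indicator 1 r
        ≤ ∫⁻ r, (Ioo a b).indicator (fun _ => ENNReal.ofReal (b ^ (n - 1))) r := by
      refine (lintegral_mono' Measure.restrict_le_self fun r => ?_)
      by_cases hr : r ∈ Ioo a b
      · simp only [indicator_of_mem hr, Pi.one_apply, mul_one]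
        exact ENNReal.ofReal_le_ofReal (pow_le_pow_left₀ (ha.le.trans hr.1.le) hr.2.le _)
      · simp [hr]
    refine (hle.trans_lt ?_).ne
    rw [lintegral_indicator measurableSet_Ioo, lintegral_const, Measure.restrict_apply_univ,
      Real.volume_Ioo]
    exact ENNReal.mul_lt_top ENNReal.ofReal_lt_top ENNReal.ofReal_lt_top
  · have hs := (isOpen_sphericalSection hΓ).measurableSet
    rw [← Measure.restrict_smul, ← map_direction_withDensity hn e
      (measurable_one.indicator measurableSet_Ioo), Measure.restrict_map (measurable_direction e) hs]
    congr 1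
    have hann : MeasurableSet (openAnnulus n a b) := (isOpen_openAnnulus a b).measurableSet
    have : (fun x : Eucl n => (Ioo a b).indicator (1 : ℝ → ℝ≥0∞) ‖x‖)
        = (openAnnulus n a b).indicator 1 := by
      ext x; rfl
    rw [this, withDensity_indicator_one hann, Measure.restrict_restrict
      (measurable_direction e hs)]
    congr 1
    ext x
    refine and_congr_left fun hx => (direction_mem_iff hc e ?_).symm
    rintro rfl
    have := hx.1
    simp at this
    linarith

/-- Functions of the direction: `L²` norms over an annulus are controlled by those on the sphere. -/
theorem memLp_comp_direction {F : Type*} [NormedAddCommGroup F] (hn : 2 ≤ n) (hΓ : IsOpen Γ)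
    (hc : ∀ x ∈ Γ, ∀ t : ℝ, 0 < t → t • x ∈ Γ) (e : USphere n) {a b : ℝ} (ha : 0 < a) :
    ∃ C : ℝ≥0∞, C ≠ ⊤ ∧ ∀ f : USphere n → F,
      MemLp f 2 ((surfaceMeasure n).restrict (sphericalSection Γ)) →
      MemLp (fun x => f (direction e x)) 2 (volume.restrict (Γ ∩ openAnnulus n a b)) ∧
      eLpNorm (fun x => f (direction e x)) 2 (volume.restrict (Γ ∩ openAnnulus n a b))
        ≤ C * eLpNorm f 2 ((surfaceMeasure n).restrict (sphericalSection Γ)) := by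
  obtain ⟨c, hct, hmap⟩ := map_direction_annulus hn hΓ hc e (b := b) ha
  refine ⟨c ^ (1 / (2 : ℝ≥0∞)).toReal, ENNReal.rpow_ne_top_of_nonneg (by simp) hct, fun f hf => ?_⟩
  have hf' : AEStronglyMeasurable f
      ((volume.restrict (Γ ∩ openAnnulus n a b)).map (direction e)) := by
    rw [hmap]; exact hf.1.smul_measure c
  have h1 : eLpNorm (fun x => f (direction e x)) 2 (volume.restrict (Γ ∩ openAnnulus n a b))
      = c ^ (1 / (2 : ℝ≥0∞)).toReal *
        eLpNorm f 2 ((surfaceMeasure n).restrict (sphericalSection Γ)) := by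
    have := eLpNorm_map_measure (p := 2) hf' (measurable_direction e).aemeasurable
    rw [hmap, eLpNorm_smul_measure_of_ne_top (by simp), smul_eq_mul] at this
    exact this.symm
  refine ⟨⟨hf'.comp_measurable (measurable_direction e), ?_⟩, h1.le⟩
  rw [h1]
  exact ENNReal.mul_lt_top (ENNReal.rpow_lt_top_of_nonneg (by simp) hct) hf.2

end Cone

/-! ### Homogeneous functions -/

theorem hasFDerivAt_norm_of_ne_zero {n : ℕ} {x : Eucl n} (hx : x ≠ 0) :
    HasFDerivAt (fun y : Eucl n => ‖y‖) (‖x‖⁻¹ • innerSL ℝ x) x := by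
  have h0 : ‖x‖ ≠ 0 := norm_ne_zero_iff.2 hx
  have h := (hasStrictFDerivAt_norm_sq x).hasFDerivAt.sqrt (pow_ne_zero 2 h0)
  simp only [Real.sqrt_sq (norm_nonneg _)] at h
  refine h.congr_fderiv ?_
  ext1 v
  simp only [smul_apply, innerSL_apply_apply, smul_eq_mul, nsmul_eq_mul, Nat.cast_ofNat]
  field_simp

theorem homogeneousExtension_eq {n : ℕ} (e : USphere n) (a : ℝ) (ψ : USphere n → ℝ) {x : Eucl n}
    (hx : x ≠ 0) : homogeneousExtension a ψ x = ‖x‖ ^ a * ψ (direction e x) := by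
  simp [homogeneousExtension, direction, hx]

/-- The gradient `|x|^{a-1} (a ψ(θ) θ + G(θ))`, with `θ = x / |x|`, of `|x|^a ψ(θ)` when `G` is the
tangential gradient of `ψ`. -/
noncomputable def homogeneousGradient {n : ℕ} (e : USphere n) (a : ℝ) (ψ : USphere n → ℝ)
    (G : USphere n → Eucl n) (x : Eucl n) : Eucl n :=
  ‖x‖ ^ (a - 1) • ((a * ψ (direction e x)) • (direction e x : Eucl n) + G (direction e x))

theorem hasFDerivAt_normalize {n : ℕ} {x : Eucl n} (hx : x ≠ 0) :
    HasFDerivAt (fun y : Eucl n => ‖y‖⁻¹ • y)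
      (‖x‖⁻¹ • (ContinuousLinearMap.id ℝ (Eucl n)
        - (innerSL ℝ (‖x‖⁻¹ • x)).smulRight (‖x‖⁻¹ • x))) x := by
  have h0 : ‖x‖ ≠ 0 := norm_ne_zero_iff.2 hx
  have h := ((hasDerivAt_inv h0).comp_hasFDerivAt x
    (hasFDerivAt_norm_of_ne_zero hx)).smul (hasFDerivAt_id x)
  refine h.congr_fderiv ?_
  ext1 v
  simp only [add_apply, smul_apply, sub_apply, ContinuousLinearMap.smulRight_apply,
    innerSL_apply_apply, ContinuousLinearMap.id_apply, inner_smul_left, smul_eq_mul, conj_trivial,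
    id, smul_sub, smul_smul]
  rw [sub_eq_add_neg, ← neg_smul]
  congr 2
  field_simp

/-- The gradient of `|x|^a g(x / |x|)`, in terms of the tangential gradient of `g`. -/
theorem gradient_homogeneous {n : ℕ} (e : USphere n) (a : ℝ) {g : Eucl n → ℝ}
    (hg : Differentiable ℝ g) {x : Eucl n} (hx : x ≠ 0) :
    gradient (fun y => ‖y‖ ^ a * g (‖y‖⁻¹ • y)) x
      = homogeneousGradient e a (fun θ => g θ) (tangentialGradient g) x := by
  have h0 : ‖x‖ ≠ 0 := norm_ne_zero_iff.2 hx
  have h1 := (hasFDerivAt_norm_of_ne_zero hx).rpow_const (p := a) (Or.inl h0)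
  have h2 := HasFDerivAt.comp (g := g) (f := fun y => ‖y‖⁻¹ • y) x
    (hg (‖x‖⁻¹ • x)).hasFDerivAt (hasFDerivAt_normalize hx)
  have h3 := h1.fun_mul h2
  refine ext_inner_right ℝ fun v => ?_
  rw [inner_gradient_left]
  have h4 : fderiv ℝ (fun y => ‖y‖ ^ a * g (‖y‖⁻¹ • y)) x = _ := h3.fderiv
  rw [h4, homogeneousGradient, tangentialGradient, coe_direction e hx]
  have h5 : fderiv ℝ g (‖x‖⁻¹ • x) (‖x‖⁻¹ • v) = ‖x‖⁻¹ * ⟪gradient g (‖x‖⁻¹ • x), v⟫_ℝ := by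
    rw [map_smul, inner_gradient_left, smul_eq_mul]
  have h6 : fderiv ℝ g (‖x‖⁻¹ • x) (‖x‖⁻¹ • x) = ⟪‖x‖⁻¹ • x, gradient g (‖x‖⁻¹ • x)⟫_ℝ := by
    rw [inner_gradient_right, conj_trivial]
  have h7 : ‖x‖ ^ a = ‖x‖ ^ (a - 1) * ‖x‖ := by
    rw [Real.rpow_sub_one h0]; field_simp
  simp only [add_apply, smul_apply, ContinuousLinearMap.comp_apply, sub_apply,
    ContinuousLinearMap.smulRight_apply, innerSL_apply_apply, ContinuousLinearMap.id_apply,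
    smul_eq_mul, smul_sub, map_sub, h5, inner_add_left, inner_sub_left, inner_smul_left,
    conj_trivial, Function.comp_apply]
  rw [map_smul, map_smul, h6]
  simp only [smul_eq_mul, inner_smul_left, conj_trivial]
  rw [h7]
  field_simp
  ring

theorem continuous_tangentialGradient {n : ℕ} {g : Eucl n → ℝ} (hg : ContDiff ℝ ∞ g) :
    Continuous (tangentialGradient g) := by
  have h : Continuous fun θ : USphere n => gradient g (θ : Eucl n) :=
    (continuous_gradient hg).comp continuous_subtype_val
  have hi : Continuous fun θ : USphere n => ⟪(θ : Eucl n), gradient g (θ : Eucl n)⟫_ℝ :=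
    Continuous.inner continuous_subtype_val h
  exact h.sub (hi.smul continuous_subtype_val)

/-- A smooth function of the direction supported in the cone, cut off to an annulus, is a test
function of the cone. -/
theorem exists_isTestFunction_homogeneous {n : ℕ} {Γ : Set (Eucl n)}
    (hc : ∀ x ∈ Γ, ∀ t : ℝ, 0 < t → t • x ∈ Γ) (l : ℝ) {g : Eucl n → ℝ}
    (hg : IsTestFunction Γ g) {a b : ℝ} (ha : 0 < a) :
    ∃ k, IsTestFunction Γ k ∧ ∀ x ∈ openAnnulus n a b, k x = ‖x‖ ^ l * g (‖x‖⁻¹ • x) := by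
  have hK : IsClosed {x : Eucl n | a ≤ ‖x‖ ∧ ‖x‖ ≤ b} :=
    (isClosed_le continuous_const continuous_norm).inter
      (isClosed_le continuous_norm continuous_const)
  obtain ⟨η, hη, -, hηO, hη1⟩ := exists_contMDiff_support_eq_eq_one_iff
    (modelWithCornersSelf ℝ (Eucl n)) (n := ⊤) (isOpen_openAnnulus (n := n) (a / 2) (b + 1)) hK
    (fun x hx => ⟨by linarith [hx.1], by linarith [hx.2]⟩)
  have hηs := contMDiff_iff_contDiff.1 hη
  have hηt : tsupport η ⊆ {x : Eucl n | a / 2 ≤ ‖x‖ ∧ ‖x‖ ≤ b + 1} := by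
    rw [tsupport, hηO]
    exact closure_minimal (fun x hx => ⟨hx.1.le, hx.2.le⟩)
      ((isClosed_le continuous_const continuous_norm).inter
        (isClosed_le continuous_norm continuous_const))
  have hη0 : ∀ x ∈ tsupport η, x ≠ 0 := by
    rintro x hx rfl
    have := (hηt hx).1
    rw [norm_zero] at this
    linarith
  have hηc : IsCompact (tsupport η) := by
    refine Metric.isCompact_of_isClosed_isBounded (isClosed_tsupport _) ?_
    refine (Metric.isBounded_closedBall (x := (0 : Eucl n)) (r := b + 1)).subset fun x hx => ?_
    simpa using (hηt hx).2
  have hsmooth : ∀ x : Eucl n, x ≠ 0 →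
      ContDiffAt ℝ ∞ (fun y : Eucl n => ‖y‖ ^ l * g (‖y‖⁻¹ • y)) x := fun x hx => by
    have hn : ContDiffAt ℝ ∞ (fun y : Eucl n => ‖y‖) x := contDiffAt_norm ℝ hx
    have h0 : ‖x‖ ≠ 0 := norm_ne_zero_iff.2 hx
    refine (hn.rpow_const_of_ne h0).mul ?_
    exact hg.smooth.contDiffAt.comp x ((hn.inv h0).smul contDiffAt_id)
  refine ⟨fun x => η x * (‖x‖ ^ l * g (‖x‖⁻¹ • x)), ⟨?_, ?_, ?_⟩, fun x hx => ?_⟩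
  · refine contDiff_iff_contDiffAt.2 fun x => ?_
    by_cases hx : x ∈ tsupport fun x => η x * (‖x‖ ^ l * g (‖x‖⁻¹ • x))
    swap
    · exact contDiffAt_const.congr_of_eventuallyEq (notMem_tsupport_iff_eventuallyEq.1 hx)
    exact hηs.contDiffAt.mul (hsmooth x (hη0 x (tsupport_mul_subset_left hx)))
  · exact HasCompactSupport.mul_right (f := η) hηc
  · have hcl : IsClosed (tsupport η ∩ (fun x : Eucl n => ‖x‖⁻¹ • x) ⁻¹' tsupport g) := by
      refine ContinuousOn.preimage_isClosed_of_isClosed (fun x hx => ?_) (isClosed_tsupport _)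
        (isClosed_tsupport _)
      exact (hasFDerivAt_normalize (hη0 x hx)).continuousAt.continuousWithinAt
    have hsub : tsupport (fun x => η x * (‖x‖ ^ l * g (‖x‖⁻¹ • x)))
        ⊆ tsupport η ∩ (fun x : Eucl n => ‖x‖⁻¹ • x) ⁻¹' tsupport g := by
      refine closure_minimal (fun x hx => ⟨subset_tsupport _ (left_ne_zero_of_mul hx),
        subset_tsupport _ (right_ne_zero_of_mul (right_ne_zero_of_mul hx))⟩) hcl
    intro x hx
    obtain ⟨hx1, hx2⟩ := hsub hx
    have h0 := norm_pos_iff.2 (hη0 x hx1)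
    simpa [smul_smul, h0.ne'] using hc _ (hg.support_subset hx2) _ h0
  · have : η x = 1 := (hη1 x).1 ⟨hx.1.le, hx.2.le⟩
    simp only [this, one_mul]

theorem rpow_norm_le_of_mem_annulus {n : ℕ} {a b : ℝ} (ha : 0 < a) (l : ℝ) :
    ∃ M, 0 ≤ M ∧ ∀ x ∈ openAnnulus n a b, ‖x‖ ^ l ≤ M := by
  refine ⟨max (a ^ l) (b ^ l), (Real.rpow_nonneg ha.le _).trans (le_max_left _ _),
    fun x hx => ?_⟩
  have hx0 : 0 < ‖x‖ := ha.trans hx.1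
  rcases le_total 0 l with h | h
  · exact (Real.rpow_le_rpow hx0.le hx.2.le h).trans (le_max_right _ _)
  · exact (Real.rpow_le_rpow_of_nonpos ha hx.1.le h).trans (le_max_left _ _)

/-- Homogeneous extensions of functions of `H¹₀` of the section satisfy Dirichlet conditions on the
cone, locally away from the vertex and infinity. -/
theorem HasSphereH10Gradient.homogeneous {n : ℕ} (hn : 2 ≤ n) {Γ : Set (Eucl n)} (hΓ : IsOpen Γ)
    (hc : ∀ x ∈ Γ, ∀ t : ℝ, 0 < t → t • x ∈ Γ) (e : USphere n) {ψ : USphere n → ℝ}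
    {G : USphere n → Eucl n} (hψ : HasSphereH10Gradient Γ ψ G) (l : ℝ) {a b : ℝ} (ha : 0 < a) :
    HasSobolevGradient (fun _ => 1) (Γ ∩ openAnnulus n a b) (homogeneousExtension l ψ)
        (homogeneousGradient e l ψ G) ∧
      MemSobolevClosure (fun _ => 1) Γ (Γ ∩ openAnnulus n a b) (homogeneousExtension l ψ) := by
  obtain ⟨M, hM, hMl⟩ := rpow_norm_le_of_mem_annulus (n := n) (b := b) ha l
  obtain ⟨M', hM', hMl'⟩ := rpow_norm_le_of_mem_annulus (n := n) (b := b) ha (l - 1)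
  obtain ⟨C, hC, hCf⟩ := memLp_comp_direction (F := ℝ) hn hΓ hc e (b := b) ha
  obtain ⟨C', hC', hCf'⟩ := memLp_comp_direction (F := Eucl n) hn hΓ hc e (b := b) ha
  have hVo : IsOpen (Γ ∩ openAnnulus n a b) := hΓ.inter (isOpen_openAnnulus a b)
  have hV := hVo.measurableSet
  set σ := (surfaceMeasure n).restrict (sphericalSection Γ) with hσ
  have hne : ∀ x ∈ Γ ∩ openAnnulus n a b, x ≠ 0 := by
    rintro x hx rfl
    have := hx.2.1
    rw [norm_zero] at this
    linarith
  have hd := measurable_direction e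
  have hdv : Measurable fun x => (direction e x : Eucl n) := measurable_subtype_coe.comp hd
  have hnd : ∀ x, ‖(direction e x : Eucl n)‖ = 1 := fun x => by simp
  -- bounds valid for all functions on the sphere
  have key1 : ∀ φ : USphere n → ℝ, MemLp φ 2 σ →
      MemLp (fun x => ‖x‖ ^ l * φ (direction e x)) 2 (volume.restrict (Γ ∩ openAnnulus n a b)) ∧
      eLpNorm (fun x => ‖x‖ ^ l * φ (direction e x)) 2 (volume.restrict (Γ ∩ openAnnulus n a b))
        ≤ ENNReal.ofReal M * C * eLpNorm φ 2 σ := fun φ hφ => by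
    obtain ⟨h1, h2⟩ := hCf φ hφ
    have h3 : eLpNorm (fun x => ‖x‖ ^ l * φ (direction e x)) 2
        (volume.restrict (Γ ∩ openAnnulus n a b)) ≤ ENNReal.ofReal M *
        eLpNorm (fun x => φ (direction e x)) 2 (volume.restrict (Γ ∩ openAnnulus n a b)) := by
      refine eLpNorm_restrict_le_of_le hV hV hM (fun x hx => ?_) (by simp)
      rw [norm_mul, Real.norm_of_nonneg (Real.rpow_nonneg (norm_nonneg _) _)]
      exact mul_le_mul_of_nonneg_right (hMl x hx.1.2) (norm_nonneg _)
    refine ⟨⟨(Measurable.aestronglyMeasurable (by fun_prop)).mul h1.1,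
      h3.trans_lt (ENNReal.mul_lt_top ENNReal.ofReal_lt_top h1.2)⟩, h3.trans ?_⟩
    rw [mul_assoc]
    gcongr
  have key2 : ∀ (φ : USphere n → ℝ) (H : USphere n → Eucl n), MemLp φ 2 σ → MemLp H 2 σ →
      MemLp (homogeneousGradient e l φ H) 2 (volume.restrict (Γ ∩ openAnnulus n a b)) ∧
      eLpNorm (homogeneousGradient e l φ H) 2 (volume.restrict (Γ ∩ openAnnulus n a b))
        ≤ ENNReal.ofReal M' * (ENNReal.ofReal |l| * C * eLpNorm φ 2 σ + C' * eLpNorm H 2 σ) := by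
    intro φ H hφ hH
    obtain ⟨h1, h2⟩ := hCf φ hφ
    obtain ⟨h1', h2'⟩ := hCf' H hH
    have m1 : AEStronglyMeasurable (fun x => (l * φ (direction e x)) • (direction e x : Eucl n))
        (volume.restrict (Γ ∩ openAnnulus n a b)) :=
      (h1.1.const_mul l).smul hdv.aestronglyMeasurable
    have h3 : eLpNorm (homogeneousGradient e l φ H) 2 (volume.restrict (Γ ∩ openAnnulus n a b))
        ≤ ENNReal.ofReal M' * eLpNorm (fun x => (l * φ (direction e x)) • (direction e x : Eucl n)
          + H (direction e x)) 2 (volume.restrict (Γ ∩ openAnnulus n a b)) := by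
      refine eLpNorm_restrict_le_of_le hV hV hM' (fun x hx => ?_) (by simp)
      rw [homogeneousGradient, norm_smul,
        Real.norm_of_nonneg (Real.rpow_nonneg (norm_nonneg _) _)]
      exact mul_le_mul_of_nonneg_right (hMl' x hx.1.2) (norm_nonneg _)
    have h4 : eLpNorm (fun x => (l * φ (direction e x)) • (direction e x : Eucl n)) 2
        (volume.restrict (Γ ∩ openAnnulus n a b)) ≤ ENNReal.ofReal |l| *
        eLpNorm (fun x => φ (direction e x)) 2 (volume.restrict (Γ ∩ openAnnulus n a b)) := by
      refine eLpNorm_restrict_le_of_le hV hV (abs_nonneg l) (fun x hx => ?_) (by simp)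
      rw [norm_smul, hnd, norm_mul, mul_one, Real.norm_eq_abs]
    have h5 : eLpNorm (homogeneousGradient e l φ H) 2 (volume.restrict (Γ ∩ openAnnulus n a b))
        ≤ ENNReal.ofReal M' * (ENNReal.ofReal |l| * C * eLpNorm φ 2 σ + C' * eLpNorm H 2 σ) := by
      refine h3.trans (mul_le_mul_right ((eLpNorm_add_le m1 h1'.1 (by norm_num)).trans
        (add_le_add (h4.trans ?_) h2')) _)
      rw [mul_assoc]
      gcongr
    refine ⟨⟨AEStronglyMeasurable.smul (f := fun x : Eucl n => ‖x‖ ^ (l - 1))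
      (Measurable.aestronglyMeasurable (by fun_prop)) (m1.add h1'.1), h5.trans_lt ?_⟩, h5⟩
    have := hφ.2
    have := hH.2
    finiteness
  have hu : (homogeneousExtension l ψ) =ᵐ[volume.restrict (Γ ∩ openAnnulus n a b)]
      fun x => ‖x‖ ^ l * ψ (direction e x) := by
    filter_upwards [ae_restrict_mem hV] with x hx using homogeneousExtension_eq e l ψ (hne x hx)
  refine memSobolevClosure_of_approx continuous_const (fun _ => one_pos) ?_
    (key2 ψ G hψ.memLp hψ.memLp_grad).1
    (K := ENNReal.ofReal M * C + ENNReal.ofReal M' * (ENNReal.ofReal |l| * C + C'))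
    (by finiteness) fun ε hε => ?_
  · simp only [one_mul]
    exact (memLp_congr_ae hu).2 (key1 ψ hψ.memLp).1
  obtain ⟨g, hg, hgε⟩ := hψ.approx ε hε
  obtain ⟨k, hk, hkg⟩ := exists_isTestFunction_homogeneous hc l hg (b := b) ha
  refine ⟨k, hk, ?_⟩
  have hgc : Continuous fun θ : USphere n => g θ := hg.continuous.comp continuous_subtype_val
  have hgtc : Continuous (tangentialGradient g) := continuous_tangentialGradient hg.smooth
  have hgL : MemLp (fun θ : USphere n => g θ) 2 σ := by
    exact hgc.memLp_of_hasCompactSupport (HasCompactSupport.of_compactSpace _)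
  have hgtL : MemLp (tangentialGradient g) 2 σ := by
    exact hgtc.memLp_of_hasCompactSupport (HasCompactSupport.of_compactSpace _)
  have e1 : (fun x => 1 * (homogeneousExtension l ψ x - k x))
      =ᵐ[volume.restrict (Γ ∩ openAnnulus n a b)]
      fun x => ‖x‖ ^ l * (ψ (direction e x) - g (direction e x)) := by
    filter_upwards [ae_restrict_mem hV] with x hx
    rw [one_mul, homogeneousExtension_eq e l ψ (hne x hx), hkg x hx.2, coe_direction e (hne x hx),
      mul_sub]
  have e2 : (fun x => homogeneousGradient e l ψ G x - gradient k x)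
      =ᵐ[volume.restrict (Γ ∩ openAnnulus n a b)]
      homogeneousGradient e l (fun θ => ψ θ - g θ) (fun θ => G θ - tangentialGradient g θ) := by
    filter_upwards [ae_restrict_mem hV] with x hx
    have hkx : k =ᶠ[𝓝 x] fun x => ‖x‖ ^ l * g (‖x‖⁻¹ • x) := by
      filter_upwards [hVo.mem_nhds hx] with y hy using hkg y hy.2
    rw [hkx.gradient_eq, gradient_homogeneous e l hg.differentiable (hne x hx)]
    simp only [homogeneousGradient]
    rw [← smul_sub, mul_sub, sub_smul]
    congr 1
    abel
  rw [eLpNorm_congr_ae e1, eLpNorm_congr_ae e2]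
  set d1 := eLpNorm (fun θ : USphere n => ψ θ - g θ) 2 σ
  set d2 := eLpNorm (fun θ : USphere n => G θ - tangentialGradient g θ) 2 σ
  have hd1 : d1 ≤ ε := le_self_add.trans hgε.le
  have hd2 : d2 ≤ ε := le_add_self.trans hgε.le
  calc _ ≤ ENNReal.ofReal M * C * d1
        + ENNReal.ofReal M' * (ENNReal.ofReal |l| * C * d1 + C' * d2) :=
        add_le_add (key1 _ (hψ.memLp.sub hgL)).2
          (key2 _ _ (hψ.memLp.sub hgL) (hψ.memLp_grad.sub hgtL)).2
    _ ≤ ENNReal.ofReal M * C * ε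
        + ENNReal.ofReal M' * (ENNReal.ofReal |l| * C * ε + C' * ε) := by gcongr
    _ = _ := by ring

/-! ### Homogeneous harmonic functions -/

theorem inner_tangentialGradient {n : ℕ} (g : Eucl n → ℝ) (θ : USphere n) :
    ⟪(θ : Eucl n), tangentialGradient g θ⟫_ℝ = 0 := by
  have hθ : ‖(θ : Eucl n)‖ = 1 := by simp
  rw [tangentialGradient, inner_sub_right, inner_smul_right, real_inner_self_eq_norm_sq, hθ]
  ring

theorem IsTestFunction.hasSphereH10Gradient {n : ℕ} {Γ : Set (Eucl n)} {g : Eucl n → ℝ}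
    (hg : IsTestFunction Γ g) :
    HasSphereH10Gradient Γ (fun θ => g θ) (tangentialGradient g) := by
  have hgc : Continuous fun θ : USphere n => g θ := hg.continuous.comp continuous_subtype_val
  refine ⟨hgc.memLp_of_hasCompactSupport (HasCompactSupport.of_compactSpace _),
    (continuous_tangentialGradient hg.smooth).memLp_of_hasCompactSupport
      (HasCompactSupport.of_compactSpace _), fun ε hε => ⟨g, hg, ?_⟩⟩
  simpa using hε

/-- The gradient of a function of `H¹₀` of the section is tangent to the sphere, as a limit of
tangential gradients. -/
theorem HasSphereH10Gradient.ae_inner_eq_zero {n : ℕ} {Γ : Set (Eucl n)} {ψ : USphere n → ℝ}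
    {G : USphere n → Eucl n} (hψ : HasSphereH10Gradient Γ ψ G) :
    ∀ᵐ (θ : USphere n) ∂(surfaceMeasure n).restrict (sphericalSection Γ),
      ⟪(θ : Eucl n), G θ⟫_ℝ = 0 := by
  have hm : AEStronglyMeasurable (fun θ : USphere n => ⟪(θ : Eucl n), G θ⟫_ℝ)
      ((surfaceMeasure n).restrict (sphericalSection Γ)) :=
    (measurable_subtype_coe.aestronglyMeasurable).inner hψ.memLp_grad.1
  have h0 : eLpNorm (fun θ : USphere n => ⟪(θ : Eucl n), G θ⟫_ℝ) 2
      ((surfaceMeasure n).restrict (sphericalSection Γ)) = 0 := by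
    refine ENNReal.eq_zero_of_forall_le_mul (M := 1) (by simp) fun ε hε => ?_
    obtain ⟨g, -, hgε⟩ := hψ.approx ε hε
    rw [one_mul]
    refine le_trans (eLpNorm_mono fun θ => ?_) (le_add_self.trans hgε.le)
    have hθ : ‖(θ : Eucl n)‖ = 1 := by simp
    have h := norm_inner_le_norm (𝕜 := ℝ) (θ : Eucl n) (G θ - tangentialGradient g θ)
    rwa [inner_sub_right, inner_tangentialGradient, sub_zero, hθ, one_mul] at h
  rw [eLpNorm_eq_zero_iff hm (by simp)] at h0
  exact h0

theorem exists_subset_openAnnulus {n : ℕ} {K : Set (Eucl n)} (hK : IsCompact K)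
    (h0 : (0 : Eucl n) ∉ K) : ∃ a b, 0 < a ∧ a < b ∧ K ⊆ openAnnulus n a b := by
  obtain ⟨b, hb⟩ := hK.isBounded.exists_norm_le
  obtain ⟨a, ha, hab⟩ := Metric.isOpen_iff.1 hK.isClosed.isOpen_compl 0 h0
  refine ⟨a / 2, max a b + 1, by linarith, ?_, fun x hx => ⟨?_, ?_⟩⟩
  · have := le_max_left a b
    linarith
  · by_contra! h
    exact hab (by simpa using h.trans_lt (half_lt_self ha)) hx
  · have := le_max_right a b
    have := hb x hx
    linarith

theorem IsTestFunction.comp_smul {n : ℕ} {Γ : Set (Eucl n)}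
    (hc : ∀ x ∈ Γ, ∀ t : ℝ, 0 < t → t • x ∈ Γ) {v : Eucl n → ℝ} (hv : IsTestFunction Γ v) {r : ℝ}
    (hr : 0 < r) : IsTestFunction Γ fun x => v (r • x) := by
  have hs : tsupport (fun x => v (r • x)) ⊆ (fun x : Eucl n => r • x) ⁻¹' tsupport v :=
    closure_minimal (fun y hy => subset_tsupport _ hy)
      ((isClosed_tsupport _).preimage (continuous_const_smul r))
  refine ⟨hv.smooth.comp (contDiff_const_smul r), ?_, fun x hx => ?_⟩
  · exact hv.compact.comp_homeomorph (Homeomorph.smulOfNeZero r hr.ne')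
  · simpa [smul_smul, hr.ne'] using hc _ (hv.support_subset (hs hx)) _ (inv_pos.2 hr)

/-- The radial integration by parts that makes `r^l ψ` harmonic when `l (l + n - 2) = μ`. -/
theorem integral_radial_eq_zero {n : ℕ} (hn : 2 ≤ n) {l μ : ℝ} (hl : l * (l + n - 2) = μ)
    {v : Eucl n → ℝ} (hv : ContDiff ℝ ∞ v) (hvc : HasCompactSupport v)
    (h0 : (0 : Eucl n) ∉ tsupport v) (θ : USphere n) :
    ∫ r in Ioi (0 : ℝ), r ^ (n - 1) * (l * r ^ (l - 1) * ⟪(θ : Eucl n), gradient v (r • (θ : Eucl n))⟫_ℝ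
      + μ * r ^ (l - 2) * v (r • (θ : Eucl n))) = 0 := by
  have hvd : Differentiable ℝ v := hv.differentiable (by simp)
  have hθ : ‖(θ : Eucl n)‖ = 1 := by simp
  obtain ⟨a, b, ha, hab, hsub⟩ := exists_subset_openAnnulus hvc h0
  have hz : ∀ r : ℝ, 0 ≤ r → r ∉ Ioo a b → r • (θ : Eucl n) ∉ tsupport v := fun r hr hr' h => by
    have := hsub h
    simp only [openAnnulus, mem_ofPred_eq, norm_smul, hθ, mul_one, Real.norm_of_nonneg hr] at this
    exact hr' this
  have hpow : ∀ r : ℝ, 0 < r → r ^ (n - 1) = r ^ ((n : ℝ) - 1) := fun r hr => by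
    rw [← Real.rpow_natCast, Nat.cast_sub (by omega), Nat.cast_one]
  set f : ℝ → ℝ := fun r => l * r ^ (l + n - 2) * v (r • (θ : Eucl n)) with hf
  set f' : ℝ → ℝ := fun r => r ^ (n - 1) * (l * r ^ (l - 1) *
    ⟪(θ : Eucl n), gradient v (r • (θ : Eucl n))⟫_ℝ + μ * r ^ (l - 2) * v (r • (θ : Eucl n))) with hf'
  have hderiv : ∀ r ∈ Ioi (0 : ℝ), HasDerivAt f (f' r) r := fun r hr => by
    have hr0 : (0 : ℝ) < r := hr
    have d1 : HasDerivAt (fun r : ℝ => l * r ^ (l + n - 2)) (l * ((l + n - 2) * r ^ (l + n - 2 - 1))) r :=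
      (Real.hasDerivAt_rpow_const (Or.inl hr0.ne')).const_mul l
    have d2 : HasDerivAt (fun r : ℝ => v (r • (θ : Eucl n)))
        ⟪(θ : Eucl n), gradient v (r • (θ : Eucl n))⟫_ℝ r := by
      have h : HasDerivAt (fun r : ℝ => v (r • (θ : Eucl n))) _ r :=
        (hvd (r • (θ : Eucl n))).hasFDerivAt.comp_hasDerivAt r
          ((hasDerivAt_id r).smul_const (θ : Eucl n))
      rw [inner_gradient_right, conj_trivial]
      exact h.congr_deriv (by simp)
    refine (d1.mul d2).congr_deriv ?_
    rw [hf']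
    simp only
    rw [hpow r hr0, mul_add]
    have e1 : r ^ (l + n - 2) = r ^ ((n : ℝ) - 1) * r ^ (l - 1) := by
      rw [← Real.rpow_add hr0]; congr 1; ring
    have e2 : r ^ (l + n - 2 - 1) = r ^ ((n : ℝ) - 1) * r ^ (l - 2) := by
      rw [← Real.rpow_add hr0]; congr 1; ring
    rw [e1, e2, ← hl]
    ring
  have hfz : ∀ r : ℝ, 0 ≤ r → r ∉ Ioo a b → f r = 0 := fun r hr hr' => by
    simp only [hf, image_eq_zero_of_notMem_tsupport (hz r hr hr'), mul_zero]
  have hf'z : ∀ r : ℝ, 0 ≤ r → r ∉ Ioo a b → f' r = 0 := fun r hr hr' => by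
    simp only [hf', image_eq_zero_of_notMem_tsupport (hz r hr hr'),
      gradient_eq_zero_of_notMem_tsupport (hz r hr hr'), inner_zero_right, mul_zero, add_zero]
  have hcont : ContinuousWithinAt f (Ici 0) 0 := by
    refine (continuousWithinAt_const (b := (0 : ℝ))).congr_of_eventuallyEq ?_ ?_
    · filter_upwards [self_mem_nhdsWithin, mem_nhdsWithin_of_mem_nhds (Iio_mem_nhds ha)] with r hr hra
      exact hfz r hr fun h => lt_asymm h.1 hra
    · exact hfz 0 le_rfl fun h => lt_asymm h.1 ha
  have hint : IntegrableOn f' (Ioi 0) := by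
    have hc : ContinuousOn f' (Icc a b) := by
      have hne : ∀ r ∈ Icc a b, r ≠ 0 := fun r hr => (ha.trans_le hr.1).ne'
      have c1 : Continuous fun r : ℝ => v (r • (θ : Eucl n)) := by
        have := hv.continuous; fun_prop
      have c2 : Continuous fun r : ℝ => ⟪(θ : Eucl n), gradient v (r • (θ : Eucl n))⟫_ℝ := by
        have := continuous_gradient hv; fun_prop
      have c3 : ∀ s : ℝ, ContinuousOn (fun r : ℝ => r ^ s) (Icc a b) := fun s =>
        continuousOn_id.rpow_const fun r hr => Or.inl (hne r hr)
      exact (continuousOn_id.pow _).mul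
        (((continuousOn_const.mul (c3 _)).mul c2.continuousOn).add
          ((continuousOn_const.mul (c3 _)).mul c1.continuousOn))
    refine (hc.integrableOn_Icc.of_forall_sdiff_eq_zero measurableSet_Ioi fun r hr => ?_)
    exact hf'z r hr.1.out.le fun h => hr.2 ⟨h.1.le, h.2.le⟩
  have hlim : Tendsto f atTop (𝓝 0) := by
    refine tendsto_const_nhds.congr' ?_
    filter_upwards [eventually_gt_atTop (max b 0)] with r hr
    exact (hfz r ((le_max_right _ _).trans hr.le) fun h =>
      lt_asymm h.2 ((le_max_left _ _).trans_lt hr)).symm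
  rw [integral_Ioi_of_hasDerivAt_of_tendsto hcont hderiv hint hlim,
    hfz 0 le_rfl fun h => lt_asymm h.1 ha, sub_zero]

/-- In polar coordinates, `⟨∇(r^l ψ), ∇v⟩` is the sum of the tangential part
`r^(l-1) ⟨G, ∇v⟩`, whose integral over a sphere is that of `μ r^(l-2) ψ v` by the eigenvalue
equation, and of a radial part, whose integral along each ray is the opposite. Harmonicity is thus
verified without regularity of `ψ`. -/
theorem isHarmonicIn_homogeneousExtension {n : ℕ} (hn : 2 ≤ n) {Γ : Set (Eucl n)} (hΓ : IsOpen Γ)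
    (hc : ∀ x ∈ Γ, ∀ t : ℝ, 0 < t → t • x ∈ Γ) (h0 : (0 : Eucl n) ∉ Γ) {μ : ℝ} {ψ : USphere n → ℝ}
    (hψ : IsDirichletEigenfunction Γ μ ψ) {l : ℝ} (hl : l * (l + n - 2) = μ) :
    IsHarmonicIn Γ (homogeneousExtension l ψ) := by
  intro v hv
  obtain ⟨-, G, hG, heig⟩ := hψ
  obtain ⟨e⟩ := nonempty_usphere hn
  have hv0 : (0 : Eucl n) ∉ tsupport v := fun h => h0 (hv.support_subset h)
  obtain ⟨a, b, ha, hab, hsub⟩ := exists_subset_openAnnulus hv.compact hv0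
  set V := Γ ∩ openAnnulus n a b with hVdef
  have hvV : IsTestFunction V v := ⟨hv.smooth, hv.compact, subset_inter hv.support_subset hsub⟩
  have hVm : MeasurableSet V := (hΓ.inter (isOpen_openAnnulus a b)).measurableSet
  obtain ⟨hS, -⟩ := hG.homogeneous hn hΓ hc e l (b := b) ha
  have hS0 := (hG.homogeneous hn hΓ hc e 0 (b := b) ha).1
  have hS2 := (hG.homogeneous hn hΓ hc e (l - 2) (b := b) ha).1
  have hgz : ∀ x, x ∉ tsupport v → gradient v x = 0 := fun x hx =>
    gradient_eq_zero_of_notMem_tsupport hx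
  have hvz : ∀ x, x ∉ tsupport v → v x = 0 := fun x hx => image_eq_zero_of_notMem_tsupport hx
  rw [setIntegral_eq_integral_of_tsupport hv.support_subset fun x hx => by
      rw [laplacian_eq_zero_of_notMem_tsupport hx, mul_zero],
    ← setIntegral_eq_integral_of_tsupport hvV.support_subset fun x hx => by
      rw [laplacian_eq_zero_of_notMem_tsupport hx, mul_zero],
    hS.integral_mul_laplacian continuous_const (fun _ => one_pos) hvV, neg_eq_zero,
    setIntegral_eq_integral_of_tsupport hvV.support_subset fun x hx => by
      rw [hgz x hx, inner_zero_right]]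
  -- functions on `V` that vanish off the support of `v` are integrable on the whole space
  have hext : ∀ k : Eucl n → ℝ, Integrable k (volume.restrict V) → (∀ x, x ∉ tsupport v → k x = 0) →
      Integrable k := fun k hk hkz => (integrableOn_iff_integrable_of_support_subset
    fun x hx => hvV.support_subset (by by_contra h; exact hx (hkz x h))).1 hk
  obtain ⟨M, hM, hMl⟩ := rpow_norm_le_of_mem_annulus (n := n) (b := b) ha l
  -- the form, its tangential part, and what the eigenvalue equation turns the latter into
  set H := fun x => ⟪homogeneousGradient e l ψ G x, gradient v x⟫_ℝ with hH
  set B := fun x => ‖x‖ ^ (l - 1) * ⟪G (direction e x), gradient v x⟫_ℝ with hB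
  set D := fun x => μ * (homogeneousExtension (l - 2) ψ x * v x) with hD
  have iH : Integrable H := hext _ (integrable_inner_of_memLp hS.memLp_grad (hv.memLp_gradient V))
    fun x hx => by simp only [hH, hgz x hx, inner_zero_right]
  have iB : Integrable B := by
    refine hext _ ?_ fun x hx => by simp only [hB, hgz x hx, inner_zero_right, mul_zero]
    have hk : MemLp (fun x => ‖x‖ ^ l • gradient v x) 2 (volume.restrict V) := by
      refine ⟨AEStronglyMeasurable.smul (f := fun x : Eucl n => ‖x‖ ^ l)
        (Measurable.aestronglyMeasurable (by fun_prop)) (hv.memLp_gradient V).1,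
        (eLpNorm_restrict_le_of_le hVm hVm hM (fun x hx => ?_) (by simp)).trans_lt
          (ENNReal.mul_lt_top ENNReal.ofReal_lt_top (hv.memLp_gradient V).2)⟩
      rw [norm_smul, Real.norm_of_nonneg (Real.rpow_nonneg (norm_nonneg _) _)]
      exact mul_le_mul_of_nonneg_right (hMl x hx.1.2) (norm_nonneg _)
    refine (integrable_inner_of_memLp hS0.memLp_grad hk).congr ?_
    filter_upwards [ae_restrict_mem hVm] with x hx
    have hx0 : 0 < ‖x‖ := ha.trans hx.2.1
    simp only [hB, homogeneousGradient, inner_smul_left, inner_smul_right, inner_add_left, zero_mul,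
      conj_trivial, zero_add]
    rw [← mul_assoc, ← Real.rpow_add hx0]
    congr 2
    ring
  have iD : Integrable D := by
    refine (hext _ ?_ fun x hx => by simp only [hvz x hx, mul_zero]).const_mul μ
    have hvL : MemLp v 2 (volume.restrict V) := by
      simpa using hv.memLp_mul (w := fun _ => 1) continuous_const V
    exact MemLp.integrable_mul (by simpa using hS2.memLp) hvL
  set σ := surfaceMeasure n
  set ν := Measure.volumeIoiPow (n - 1)
  have hpol := measurePreserving_polar hn
  have hemb := measurableEmbedding_polar n
  have polar_int : ∀ k : Eucl n → ℝ, Integrable k →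
      Integrable (fun z : USphere n × Ioi (0 : ℝ) => k ((z.2 : ℝ) • (z.1 : Eucl n))) (σ.prod ν) :=
    fun k hk => (hpol.integrable_comp_emb hemb).2 hk
  have polar_eq : ∀ k : Eucl n → ℝ, ∫ x, k x
      = ∫ z : USphere n × Ioi (0 : ℝ), k ((z.2 : ℝ) • (z.1 : Eucl n)) ∂(σ.prod ν) :=
    fun k => (hpol.integral_comp hemb k).symm
  have hθ1 : ∀ θ : USphere n, ‖(θ : Eucl n)‖ = 1 := fun θ => by simp
  have hnorm : ∀ (r : ℝ) (θ : USphere n), 0 < r → ‖r • (θ : Eucl n)‖ = r := fun r θ hr => by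
    rw [norm_smul, hθ1, mul_one, Real.norm_of_nonneg hr.le]
  have hne : ∀ (r : ℝ) (θ : USphere n), 0 < r → r • (θ : Eucl n) ≠ 0 := fun r θ hr => by
    rw [← norm_ne_zero_iff, hnorm r θ hr]; exact hr.ne'
  have Dpol : ∀ (r : ℝ) (θ : USphere n), 0 < r →
      D (r • (θ : Eucl n)) = μ * r ^ (l - 2) * ψ θ * v (r • (θ : Eucl n)) := fun r θ hr => by
    simp only [hD]
    rw [homogeneousExtension_eq e _ _ (hne r θ hr), direction_smul e θ hr, hnorm r θ hr]
    ring
  -- the eigenvalue equation on each sphere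
  have hBD : ∫ x, B x = ∫ x, D x := by
    rw [polar_eq B, polar_eq D, integral_prod_symm _ (polar_int B iB),
      integral_prod_symm _ (polar_int D iD)]
    refine integral_congr_ae (ae_of_all _ fun r => ?_)
    obtain ⟨r, hr⟩ := r
    have hr0 : (0 : ℝ) < r := hr
    have hvr := hv.comp_smul hc hr0
    have hout : ∀ θ : USphere n, θ ∉ sphericalSection Γ → r • (θ : Eucl n) ∉ tsupport v :=
      fun θ hθ h => hθ (by
        have := hc _ (hv.support_subset h) r⁻¹ (inv_pos.2 hr0)
        rwa [smul_smul, inv_mul_cancel₀ hr0.ne', one_smul] at this)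
    have l1 : ∫ θ : USphere n, B (r • (θ : Eucl n)) ∂σ
        = ∫ θ in sphericalSection Γ, B (r • (θ : Eucl n)) ∂σ :=
      (setIntegral_eq_integral_of_forall_compl_eq_zero fun θ hθ => by
        simp only [hB, hgz _ (hout θ hθ), inner_zero_right, mul_zero]).symm
    have l2 : ∫ θ : USphere n, D (r • (θ : Eucl n)) ∂σ
        = ∫ θ in sphericalSection Γ, D (r • (θ : Eucl n)) ∂σ :=
      (setIntegral_eq_integral_of_forall_compl_eq_zero fun θ hθ => by
        simp only [hD, hvz _ (hout θ hθ), mul_zero]).symm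
    change ∫ θ : USphere n, B (r • (θ : Eucl n)) ∂σ = ∫ θ : USphere n, D (r • (θ : Eucl n)) ∂σ
    have l3 : ∫ θ in sphericalSection Γ, B (r • (θ : Eucl n)) ∂σ
        = r ^ (l - 2) * ∫ θ in sphericalSection Γ,
          ⟪G θ, tangentialGradient (fun x => v (r • x)) θ⟫_ℝ ∂σ := by
      rw [← integral_const_mul]
      refine integral_congr_ae ?_
      filter_upwards [hG.ae_inner_eq_zero] with θ hθ
      simp only [hB]
      rw [direction_smul e θ hr0, hnorm r θ hr0, tangentialGradient, gradient_comp_smul,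
        inner_sub_right, inner_smul_right, inner_smul_right, real_inner_comm (θ : Eucl n) (G θ), hθ, mul_zero,
        sub_zero, ← mul_assoc, ← Real.rpow_add_one hr0.ne']
      congr 2
      ring
    have l4 : ∫ θ in sphericalSection Γ, D (r • (θ : Eucl n)) ∂σ
        = r ^ (l - 2) * (μ * ∫ θ in sphericalSection Γ, ψ θ * v (r • (θ : Eucl n)) ∂σ) := by
      rw [← integral_const_mul, ← integral_const_mul]
      refine integral_congr_ae (ae_of_all _ fun θ => ?_)
      simp only [Dpol r θ hr0]
      ring
    rw [l1, l2, l3, l4, heig _ _ hvr.hasSphereH10Gradient]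
  have iHB : Integrable fun x => H x - B x := iH.sub iB
  have iT : Integrable fun x => H x - B x + D x := iHB.add iD
  -- the integration by parts along each ray
  have hsum : ∫ x, (H x - B x + D x) = 0 := by
    rw [polar_eq fun x => H x - B x + D x,
      integral_prod _ (polar_int (fun x => H x - B x + D x) iT)]
    refine integral_eq_zero_of_ae (ae_of_all _ fun θ => ?_)
    have hpt : ∀ r : Ioi (0 : ℝ), H ((r : ℝ) • (θ : Eucl n)) - B ((r : ℝ) • (θ : Eucl n))
        + D ((r : ℝ) • (θ : Eucl n)) = ψ θ * (l * (r : ℝ) ^ (l - 1) *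
          ⟪(θ : Eucl n), gradient v ((r : ℝ) • (θ : Eucl n))⟫_ℝ
          + μ * (r : ℝ) ^ (l - 2) * v ((r : ℝ) • (θ : Eucl n))) := fun r => by
      have hr0 : (0 : ℝ) < r := r.2
      rw [Dpol r θ hr0]
      simp only [hH, hB, homogeneousGradient]
      rw [direction_smul e θ hr0, hnorm r θ hr0, inner_smul_left, inner_add_left, inner_smul_left]
      simp only [conj_trivial]
      ring
    simp only [hpt]
    rw [integral_const_mul, integral_volumeIoiPow (n - 1) (fun r => l * r ^ (l - 1) *
      ⟪(θ : Eucl n), gradient v (r • (θ : Eucl n))⟫_ℝ + μ * r ^ (l - 2) * v (r • (θ : Eucl n))),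
      integral_radial_eq_zero hn hl hv.smooth hv.compact hv0 θ, mul_zero, Pi.zero_apply]
  have hfin : ∫ x, (H x - B x + D x) = (∫ x, H x) - (∫ x, B x) + ∫ x, D x := by
    rw [integral_add iHB iD, integral_sub iH iB]
  rw [hsum, hBD] at hfin
  linarith

theorem IsDirichletEigenfunction.eigenvalue_nonneg {n : ℕ} {Γ : Set (Eucl n)} {μ : ℝ}
    {ψ : USphere n → ℝ} (hψ : IsDirichletEigenfunction Γ μ ψ) : 0 ≤ μ := by
  obtain ⟨hnorm, G, hG, heig⟩ := hψ
  have h := heig ψ G hG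
  simp_rw [← sq] at h
  rw [hnorm, mul_one] at h
  rw [← h]
  exact integral_nonneg fun θ => real_inner_self_nonneg

theorem isConeHarmonic_homogeneousExtension {n : ℕ} (hn : 2 ≤ n) {Γ : Set (Eucl n)} (hΓ : IsOpen Γ)
    (hc : ∀ x ∈ Γ, ∀ t : ℝ, 0 < t → t • x ∈ Γ) (h0 : (0 : Eucl n) ∉ Γ) {μ : ℝ} {ψ : USphere n → ℝ}
    (hψ : IsDirichletEigenfunction Γ μ ψ) {l : ℝ} (hl : l * (l + n - 2) = μ) :
    IsConeHarmonic Γ (homogeneousExtension l ψ) := by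
  refine ⟨fun a b ha _ => ?_, isHarmonicIn_homogeneousExtension hn hΓ hc h0 hψ hl⟩
  obtain ⟨e⟩ := nonempty_usphere hn
  obtain ⟨-, G, hG, -⟩ := hψ
  exact (hG.homogeneous hn hΓ hc e l ha).2

theorem lambdaPlus_mul (n : ℕ) {μ : ℝ} (hμ : 0 ≤ μ) :
    lambdaPlus n μ * (lambdaPlus n μ + n - 2) = μ := by
  have h := Real.sq_sqrt (show 0 ≤ (1 - (n : ℝ) / 2) ^ 2 + μ by positivity)
  rw [lambdaPlus]
  linear_combination h

theorem lambdaMinus_mul (n : ℕ) {μ : ℝ} (hμ : 0 ≤ μ) :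
    lambdaMinus n μ * (lambdaMinus n μ + n - 2) = μ := by
  have h := Real.sq_sqrt (show 0 ≤ (1 - (n : ℝ) / 2) ^ 2 + μ by positivity)
  rw [lambdaMinus]
  linear_combination h

/-! ### The Poincaré inequality on the sphere -/

/-- The Gram determinant `|x|²|y|² - ⟨x, y⟩²`, the squared area of the parallelogram spanned by `x`
and `y`. -/
noncomputable def gramDet {n : ℕ} (x y : Eucl n) : ℝ := ‖x‖ ^ 2 * ‖y‖ ^ 2 - ⟪x, y⟫_ℝ ^ 2

theorem gramDet_nonneg {n : ℕ} (x y : Eucl n) : 0 ≤ gramDet x y := by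
  have h := abs_real_inner_le_norm x y
  have h2 := pow_le_pow_left₀ (abs_nonneg _) h 2
  rw [sq_abs, mul_pow] at h2
  exact sub_nonneg.2 h2

theorem gramDet_comm {n : ℕ} (x y : Eucl n) : gramDet x y = gramDet y x := by
  rw [gramDet, gramDet, real_inner_comm, mul_comm]

theorem gramDet_le {n : ℕ} (x y : Eucl n) : gramDet x y ≤ ‖x‖ ^ 2 * ‖y‖ ^ 2 :=
  sub_le_self _ (sq_nonneg _)

theorem ne_zero_of_gramDet_ne_zero {n : ℕ} {x y : Eucl n} (h : gramDet x y ≠ 0) : x ≠ 0 := by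
  rintro rfl
  simp [gramDet] at h

theorem gramDet_smul {n : ℕ} (a b : ℝ) (x y : Eucl n) :
    gramDet (a • x) (b • y) = a ^ 2 * b ^ 2 * gramDet x y := by
  simp only [gramDet, norm_smul, inner_smul_left, inner_smul_right, conj_trivial, mul_pow,
    Real.norm_eq_abs, sq_abs]
  ring

theorem continuous_gramDet {n : ℕ} : Continuous fun z : Eucl n × Eucl n => gramDet z.1 z.2 := by
  unfold gramDet; fun_prop

/-- The rotation of `ℝⁿ × ℝⁿ` by the angle `t`. -/
noncomputable def rotatePair {n : ℕ} (t : ℝ) (z : Eucl n × Eucl n) : Eucl n × Eucl n :=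
  (Real.cos t • z.1 + Real.sin t • z.2, -Real.sin t • z.1 + Real.cos t • z.2)

theorem norm_sq_rotatePair {n : ℕ} (t : ℝ) (z : Eucl n × Eucl n) :
    ‖(rotatePair t z).1‖ ^ 2 + ‖(rotatePair t z).2‖ ^ 2 = ‖z.1‖ ^ 2 + ‖z.2‖ ^ 2 := by
  simp only [rotatePair, norm_add_sq_real, norm_smul, inner_smul_left, inner_smul_right,
    conj_trivial, mul_pow, Real.norm_eq_abs, sq_abs, neg_sq]
  linear_combination (‖z.1‖ ^ 2 + ‖z.2‖ ^ 2) * Real.sin_sq_add_cos_sq t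

theorem gramDet_rotatePair {n : ℕ} (t : ℝ) (z : Eucl n × Eucl n) :
    gramDet (rotatePair t z).1 (rotatePair t z).2 = gramDet z.1 z.2 := by
  simp only [gramDet, rotatePair, norm_add_sq_real, norm_smul, inner_smul_left, inner_smul_right,
    inner_add_left, inner_add_right, conj_trivial, mul_pow, Real.norm_eq_abs, sq_abs,
    real_inner_self_eq_norm_sq, real_inner_comm z.1 z.2]
  have h := Real.sin_sq_add_cos_sq t
  have h2 : Real.sin t ^ 2 = 1 - Real.cos t ^ 2 := by linarith
  ring_nf
  have h4 : Real.sin t ^ 4 = (1 - Real.cos t ^ 2) ^ 2 := by rw [← h2]; ring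
  simp only [h2, h4]
  ring

theorem measurePreserving_rotatePair {n : ℕ} (t : ℝ) :
    MeasurePreserving (rotatePair (n := n) t) := by
  let L : WithLp 2 (Eucl n × Eucl n) →ₗ[ℝ] WithLp 2 (Eucl n × Eucl n) :=
    { toFun := fun z => WithLp.toLp 2 (rotatePair t (WithLp.ofLp z))
      map_add' := fun x y => congrArg (WithLp.toLp 2)
        ((ContinuousLinearMap.rotation t).map_add (WithLp.ofLp x) (WithLp.ofLp y))
      map_smul' := fun c x => congrArg (WithLp.toLp 2)
        ((ContinuousLinearMap.rotation t).map_smul c (WithLp.ofLp x)) }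
  have hL : ∀ z, ‖L z‖ = ‖z‖ := fun z => by
    rw [← sq_eq_sq₀ (norm_nonneg _) (norm_nonneg _), WithLp.prod_norm_sq_eq_of_L2,
      WithLp.prod_norm_sq_eq_of_L2]
    exact norm_sq_rotatePair t _
  have h := ((LinearIsometry.toLinearIsometryEquiv ⟨L, hL⟩ rfl).measurePreserving).comp
    (WithLp.volume_preserving_toLp (Eucl n) (Eucl n))
  exact (WithLp.volume_preserving_ofLp (Eucl n) (Eucl n)).comp h

theorem hasDerivAt_rotatePair_fst {n : ℕ} (z : Eucl n × Eucl n) (t : ℝ) :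
    HasDerivAt (fun t => (rotatePair t z).1) (rotatePair t z).2 t :=
  ((Real.hasDerivAt_cos t).smul_const z.1).add ((Real.hasDerivAt_sin t).smul_const z.2)

/-- The Cauchy–Schwarz inequality on an interval. -/
theorem sq_integral_le {f : ℝ → ℝ} {b : ℝ} (hb : 0 ≤ b) (hf : ContinuousOn f (Icc 0 b)) :
    ENNReal.ofReal ((∫ t in 0..b, f t) ^ 2)
      ≤ ENNReal.ofReal b * ∫⁻ t in Ioc 0 b, ENNReal.ofReal (f t ^ 2) := by
  have hf2 : IntegrableOn (fun t => f t ^ 2) (Ioc 0 b) :=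
    ((hf.pow 2).integrableOn_Icc).mono_set Ioc_subset_Icc_self
  have hf1 : IntegrableOn f (Ioc 0 b) := hf.integrableOn_Icc.mono_set Ioc_subset_Icc_self
  rw [← ofReal_integral_eq_lintegral_ofReal hf2 (ae_of_all _ fun t => sq_nonneg _),
    ← ENNReal.ofReal_mul hb]
  refine ENNReal.ofReal_le_ofReal ?_
  rw [intervalIntegral.integral_of_le hb]
  set I := ∫ t in Ioc 0 b, f t with hI
  set J := ∫ t in Ioc 0 b, f t ^ 2 with hJ
  rcases hb.eq_or_lt with rfl | hb0
  · simp [hI]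
  -- integrate `0 ≤ (f - I / b)²`
  have h : 0 ≤ ∫ t in Ioc 0 b, (f t - I / b) ^ 2 := integral_nonneg fun t => sq_nonneg _
  have h2 : ∫ t in Ioc 0 b, (f t - I / b) ^ 2 = J - 2 * (I / b) * I + b * (I / b) ^ 2 := by
    have e : ∀ t, (f t - I / b) ^ 2 = f t ^ 2 - 2 * (I / b) * f t + (I / b) ^ 2 := fun t => by ring
    simp only [e]
    have hi : IntegrableOn (fun t => f t ^ 2 - 2 * (I / b) * f t) (Ioc 0 b) :=
      hf2.sub (hf1.const_mul _)
    rw [integral_add hi (integrable_const _),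
      integral_sub hf2 (hf1.const_mul _), integral_const_mul, integral_const, smul_eq_mul]
    simp [hb, hI, hJ]
  rw [h2] at h
  have h3 : J - 2 * (I / b) * I + b * (I / b) ^ 2 = (b * J - I ^ 2) / b := by field_simp; ring
  rw [h3] at h
  have := (div_nonneg_iff.1 h).resolve_right (fun h' => absurd h'.2 (not_le.2 hb0))
  linarith [this.1]

/-- For the homogeneous function `u` of degree zero that extends `g`, the derivative of `u` at `x` in
the direction `y` is `⟨∇_T g, y⟩ / |x|`. Multiplication by the Gram determinant compensates for the
singularity at `x = 0`. -/
theorem gramDet_mul_sq_deriv_le {n : ℕ} (e : USphere n) {g : Eucl n → ℝ} (hg : Differentiable ℝ g)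
    {x : Eucl n} (y : Eucl n) (hx : x ≠ 0) :
    HasFDerivAt (fun y => g (‖y‖⁻¹ • y)) (fderiv ℝ (fun y => g (‖y‖⁻¹ • y)) x) x ∧
    gramDet x y * fderiv ℝ (fun y => g (‖y‖⁻¹ • y)) x y ^ 2
      ≤ ‖tangentialGradient g (direction e x)‖ ^ 2 * ‖y‖ ^ 4 := by
  have h0 : 0 < ‖x‖ := norm_pos_iff.2 hx
  have hd : DifferentiableAt ℝ (fun y => g (‖y‖⁻¹ • y)) x :=
    (hg _).comp x (hasFDerivAt_normalize hx).differentiableAt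
  refine ⟨hd.hasFDerivAt, ?_⟩
  have h1 := gradient_homogeneous e 0 hg hx
  simp only [Real.rpow_zero, one_mul, homogeneousGradient, zero_mul, zero_smul, zero_add, zero_sub,
    Real.rpow_neg_one] at h1
  rw [← inner_gradient_left, h1]
  set T := tangentialGradient g (direction e x) with hT
  have hort : ⟪x, T⟫_ℝ = 0 := by
    have := inner_tangentialGradient g (direction e x)
    rw [coe_direction e hx, inner_smul_left, conj_trivial] at this
    exact (mul_eq_zero.1 this).resolve_left (inv_ne_zero h0.ne')
  -- only the component of `y` orthogonal to `x` contributes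
  set c := ⟪x, y⟫_ℝ / ‖x‖ ^ 2 with hc
  have hTy : ⟪T, y⟫_ℝ = ⟪T, y - c • x⟫_ℝ := by
    rw [inner_sub_right, inner_smul_right, real_inner_comm x T, hort, mul_zero, sub_zero]
  have hn : ‖x‖ ^ 2 * ‖y - c • x‖ ^ 2 = gramDet x y := by
    rw [norm_sub_sq_real, inner_smul_right, norm_smul, real_inner_comm, mul_pow, Real.norm_eq_abs,
      sq_abs, gramDet, hc]
    field_simp
    ring
  have hcs : ⟪T, y - c • x⟫_ℝ ^ 2 ≤ ‖T‖ ^ 2 * ‖y - c • x‖ ^ 2 := by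
    rw [← mul_pow, ← sq_abs]
    exact pow_le_pow_left₀ (abs_nonneg _) (abs_real_inner_le_norm _ _) 2
  rw [inner_smul_left, conj_trivial, hTy, mul_pow]
  have hq := gramDet_le x y
  have hq0 := gramDet_nonneg x y
  calc gramDet x y * (‖x‖⁻¹ ^ 2 * ⟪T, y - c • x⟫_ℝ ^ 2)
      ≤ gramDet x y * (‖x‖⁻¹ ^ 2 * (‖T‖ ^ 2 * ‖y - c • x‖ ^ 2)) := by gcongr
    _ = ‖T‖ ^ 2 * (gramDet x y * ‖x‖⁻¹ ^ 2) ^ 2 := by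
        rw [← hn]; field_simp
    _ ≤ ‖T‖ ^ 2 * ((‖x‖ ^ 2 * ‖y‖ ^ 2) * ‖x‖⁻¹ ^ 2) ^ 2 := by gcongr
    _ = ‖T‖ ^ 2 * ‖y‖ ^ 4 := by field_simp

/-- The fundamental theorem of calculus along the quarter turn that takes `x` to `y`. -/
theorem gramDet_mul_sq_sub_le {n : ℕ} (e : USphere n) {g : Eucl n → ℝ} (hg : ContDiff ℝ ∞ g)
    (z : Eucl n × Eucl n) :
    ENNReal.ofReal (gramDet z.1 z.2 * (g (direction e z.1) - g (direction e z.2)) ^ 2)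
      ≤ ENNReal.ofReal (Real.pi / 2) * ∫⁻ t in Ioc 0 (Real.pi / 2),
        ENNReal.ofReal (‖tangentialGradient g (direction e (rotatePair t z).1)‖ ^ 2 *
          ‖(rotatePair t z).2‖ ^ 4) := by
  rcases eq_or_ne (gramDet z.1 z.2) 0 with h0 | h0
  · simp [h0]
  have hq0 := gramDet_nonneg z.1 z.2
  have hgd : Differentiable ℝ g := hg.differentiable (by simp)
  have hne : ∀ t, (rotatePair t z).1 ≠ 0 := fun t =>
    ne_zero_of_gramDet_ne_zero (y := (rotatePair t z).2) (by rwa [gramDet_rotatePair])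
  have hx : z.1 ≠ 0 := ne_zero_of_gramDet_ne_zero h0
  have hy : z.2 ≠ 0 := ne_zero_of_gramDet_ne_zero (y := z.1) (by rwa [gramDet_comm])
  set u : Eucl n → ℝ := fun y => g (‖y‖⁻¹ • y) with hu
  set f : ℝ → ℝ := fun t => fderiv ℝ u (rotatePair t z).1 (rotatePair t z).2 with hf
  have hder : ∀ t, HasDerivAt (fun t => u (rotatePair t z).1) (f t) t := fun t =>
    HasFDerivAt.comp_hasDerivAt (l := u) t (gramDet_mul_sq_deriv_le e hgd 0 (hne t)).1
      (hasDerivAt_rotatePair_fst z t)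
  have hfc : Continuous f := by
    have hform : f = fun t => ‖(rotatePair t z).1‖⁻¹ *
        ⟪tangentialGradient g ⟨‖(rotatePair t z).1‖⁻¹ • (rotatePair t z).1, by
          simp [norm_smul, hne t]⟩, (rotatePair t z).2⟫_ℝ := by
      ext t
      have h1 := gradient_homogeneous e 0 hgd (hne t)
      simp only [Real.rpow_zero, one_mul, homogeneousGradient, zero_mul, zero_smul, zero_add,
        zero_sub, Real.rpow_neg_one] at h1
      rw [hf]
      simp only
      rw [← inner_gradient_left, h1, inner_smul_left, conj_trivial, direction, dif_neg (hne t)]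
    have hr : Continuous fun t => rotatePair t z := by unfold rotatePair; fun_prop
    have hni : Continuous fun t => ‖(rotatePair t z).1‖⁻¹ :=
      (hr.fst.norm).inv₀ fun t => norm_ne_zero_iff.2 (hne t)
    rw [hform]
    exact hni.mul (Continuous.inner ((continuous_tangentialGradient hg).comp
      ((hni.smul hr.fst).subtype_mk _)) hr.snd)
  have hint : ∫ t in 0..(Real.pi / 2), f t = u z.2 - u z.1 := by
    rw [intervalIntegral.integral_eq_sub_of_hasDerivAt (fun t _ => hder t)
      (hfc.intervalIntegrable _ _)]
    simp [rotatePair]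
  have hdir : g (direction e z.1) - g (direction e z.2) = u z.1 - u z.2 := by
    rw [coe_direction e hx, coe_direction e hy]
  have hpi : 0 ≤ Real.pi / 2 := by positivity
  rw [hdir, ← neg_sub, neg_sq, ← hint, ENNReal.ofReal_mul hq0]
  refine (mul_le_mul_right (sq_integral_le hpi hfc.continuousOn) _).trans ?_
  rw [mul_left_comm, ← lintegral_const_mul _ (by fun_prop)]
  refine mul_le_mul_right (lintegral_mono fun t => ?_) _
  rw [← ENNReal.ofReal_mul hq0, ← gramDet_rotatePair t z]
  exact ENNReal.ofReal_le_ofReal (gramDet_mul_sq_deriv_le e hgd _ (hne t)).2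

/-- Integration of the product of a radial function and a function of the direction. -/
theorem lintegral_radial_mul {n : ℕ} (hn : 2 ≤ n) (e : USphere n) {ρ : ℝ → ℝ≥0∞}
    (hρ : Measurable ρ) {f : USphere n → ℝ≥0∞} (hf : Measurable f) :
    ∫⁻ x : Eucl n, ρ ‖x‖ * f (direction e x)
      = (∫⁻ r in Ioi (0 : ℝ), ENNReal.ofReal (r ^ (n - 1)) * ρ r) * ∫⁻ θ, f θ ∂(surfaceMeasure n) := by
  rw [← smul_eq_mul, ← lintegral_smul_measure, ← map_direction_withDensity hn e hρ,
    lintegral_map hf (measurable_direction e)]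
  exact (lintegral_withDensity_eq_lintegral_mul _ (hρ.comp measurable_norm)
    (hf.comp (measurable_direction e))).symm

/-- The Gaussian moment `∫₀^∞ r^{n-1} r^k e^{-r²} dr`. -/
noncomputable def gaussianMoment (n k : ℕ) : ℝ≥0∞ :=
  ∫⁻ r in Ioi (0 : ℝ), ENNReal.ofReal (r ^ (n - 1)) * ENNReal.ofReal (r ^ k * Real.exp (-r ^ 2))

theorem gaussianMoment_ne_top (n k : ℕ) : gaussianMoment n k ≠ ⊤ := by
  have h := integrableOn_rpow_mul_exp_neg_mul_sq one_pos (s := ((n - 1 + k : ℕ) : ℝ))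
    (lt_of_lt_of_le (by norm_num) (Nat.cast_nonneg _))
  have h2 : gaussianMoment n k
      = ∫⁻ r in Ioi (0 : ℝ), ENNReal.ofReal (r ^ ((n - 1 + k : ℕ) : ℝ) * Real.exp (-1 * r ^ 2)) :=
    setLIntegral_congr_fun measurableSet_Ioi fun r hr => by
      have hr0 : (0 : ℝ) < r := hr
      rw [← ENNReal.ofReal_mul (by positivity), Real.rpow_natCast, pow_add, neg_one_mul, mul_assoc]
  rw [h2]
  exact h.lintegral_lt_top.ne

theorem gaussianMoment_ne_zero (n k : ℕ) : gaussianMoment n k ≠ 0 := by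
  rw [gaussianMoment, ← pos_iff_ne_zero, setLIntegral_pos_iff (by fun_prop)]
  have : Ioi (0 : ℝ) ⊆ (Function.support fun r : ℝ => ENNReal.ofReal (r ^ (n - 1)) *
      ENNReal.ofReal (r ^ k * Real.exp (-r ^ 2))) ∩ Ioi 0 := fun r hr => by
    have hr0 : (0 : ℝ) < r := hr
    refine ⟨?_, hr⟩
    rw [Function.mem_support]
    refine mul_ne_zero ?_ ?_ <;> rw [← pos_iff_ne_zero, ENNReal.ofReal_pos] <;> positivity
  exact lt_of_lt_of_le (by simp) (measure_mono this)

theorem lintegral_gaussian_mul {n : ℕ} (hn : 2 ≤ n) (e : USphere n) (k : ℕ)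
    {f : USphere n → ℝ≥0∞} (hf : Measurable f) :
    ∫⁻ x : Eucl n, ENNReal.ofReal (‖x‖ ^ k * Real.exp (-‖x‖ ^ 2)) * f (direction e x)
      = gaussianMoment n k * ∫⁻ θ, f θ ∂(surfaceMeasure n) :=
  lintegral_radial_mul hn e (ρ := fun r => ENNReal.ofReal (r ^ k * Real.exp (-r ^ 2)))
    ((measurable_id.pow_const k).mul (measurable_id.pow_const 2).neg.exp).ennreal_ofReal hf

theorem measurable_gramDet_mul_sq_sub {n : ℕ} {g : USphere n → ℝ} (hg : Measurable g) :
    Measurable fun z : USphere n × USphere n =>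
      ENNReal.ofReal (gramDet (z.1 : Eucl n) z.2 * (g z.1 - g z.2) ^ 2) := by
  unfold gramDet
  fun_prop

/-- The Gaussian density on `ℝⁿ × ℝⁿ`, up to normalization. -/
noncomputable def gaussianPair {n : ℕ} (z : Eucl n × Eucl n) : ℝ≥0∞ :=
  ENNReal.ofReal (Real.exp (-(‖z.1‖ ^ 2 + ‖z.2‖ ^ 2)))

theorem measurable_gaussianPair {n : ℕ} : Measurable (gaussianPair (n := n)) := by
  unfold gaussianPair; fun_prop

theorem measurable_gramDet_mul_sq_sub_direction {n : ℕ} (e : USphere n) {g : USphere n → ℝ}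
    (hg : Measurable g) : Measurable fun z : Eucl n × Eucl n =>
      ENNReal.ofReal (gramDet z.1 z.2 * (g (direction e z.1) - g (direction e z.2)) ^ 2) := by
  have h1 : Measurable fun z : Eucl n × Eucl n => g (direction e z.1) :=
    hg.comp ((measurable_direction e).comp measurable_fst)
  have h2 : Measurable fun z : Eucl n × Eucl n => g (direction e z.2) :=
    hg.comp ((measurable_direction e).comp measurable_snd)
  exact (continuous_gramDet.measurable.mul ((h1.sub h2).pow_const 2)).ennreal_ofReal

/-- Radial integration turns the Gaussian double integral into one over pairs of directions. -/
theorem lintegral_gaussianPair_mul_gramDet {n : ℕ} (hn : 2 ≤ n) (e : USphere n) {g : USphere n → ℝ}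
    (hg : Measurable g) :
    ∫⁻ z : Eucl n × Eucl n, gaussianPair z *
        ENNReal.ofReal (gramDet z.1 z.2 * (g (direction e z.1) - g (direction e z.2)) ^ 2)
      = gaussianMoment n 2 * gaussianMoment n 2 * ∫⁻ θ : USphere n, ∫⁻ η : USphere n,
        ENNReal.ofReal (gramDet (θ : Eucl n) η * (g θ - g η) ^ 2)
          ∂(surfaceMeasure n) ∂(surfaceMeasure n) := by
  have hm := measurable_gramDet_mul_sq_sub hg
  have hγA : Measurable fun z : Eucl n × Eucl n => gaussianPair z *
      ENNReal.ofReal (gramDet z.1 z.2 * (g (direction e z.1) - g (direction e z.2)) ^ 2) :=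
    measurable_gaussianPair.mul (measurable_gramDet_mul_sq_sub_direction e hg)
  have h1 : ∀ x y : Eucl n, gaussianPair (x, y) *
      ENNReal.ofReal (gramDet x y * (g (direction e x) - g (direction e y)) ^ 2)
      = ENNReal.ofReal (‖x‖ ^ 2 * Real.exp (-‖x‖ ^ 2)) *
        (ENNReal.ofReal (‖y‖ ^ 2 * Real.exp (-‖y‖ ^ 2)) *
          ENNReal.ofReal (gramDet (direction e x : Eucl n) (direction e y) *
            (g (direction e x) - g (direction e y)) ^ 2)) := fun x y => by
    rw [gaussianPair, ← ENNReal.ofReal_mul (by positivity), ← ENNReal.ofReal_mul (by positivity),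
      ← ENNReal.ofReal_mul (by positivity)]
    congr 1
    rcases eq_or_ne x 0 with rfl | hx
    · simp [gramDet]
    rcases eq_or_ne y 0 with rfl | hy
    · simp [gramDet]
    have hx0 : ‖x‖ ≠ 0 := norm_ne_zero_iff.2 hx
    have hy0 : ‖y‖ ≠ 0 := norm_ne_zero_iff.2 hy
    have hq : gramDet x y = ‖x‖ ^ 2 * ‖y‖ ^ 2 * gramDet (‖x‖⁻¹ • x) (‖y‖⁻¹ • y) := by
      rw [gramDet_smul]; field_simp
    rw [coe_direction e hx, coe_direction e hy, hq, neg_add, Real.exp_add]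
    ring
  have h2 : ∀ x : Eucl n, ∫⁻ y : Eucl n, gaussianPair (x, y) *
      ENNReal.ofReal (gramDet x y * (g (direction e x) - g (direction e y)) ^ 2)
      = ENNReal.ofReal (‖x‖ ^ 2 * Real.exp (-‖x‖ ^ 2)) * (gaussianMoment n 2 *
        ∫⁻ η : USphere n, ENNReal.ofReal (gramDet (direction e x : Eucl n) η *
          (g (direction e x) - g η) ^ 2) ∂(surfaceMeasure n)) := fun x => by
    have hx : Measurable fun η : USphere n => ENNReal.ofReal
        (gramDet (direction e x : Eucl n) η * (g (direction e x) - g η) ^ 2) :=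
      by unfold gramDet; fun_prop
    simp_rw [h1]
    rw [lintegral_const_mul' _ _ ENNReal.ofReal_ne_top,
      lintegral_gaussian_mul hn e 2 (f := fun η => ENNReal.ofReal (gramDet (direction e x : Eucl n) η *
          (g (direction e x) - g η) ^ 2)) hx]
  rw [Measure.volume_eq_prod, lintegral_prod _ hγA.aemeasurable]
  simp_rw [h2]
  rw [lintegral_gaussian_mul hn e 2 (f := fun θ => gaussianMoment n 2 *
        ∫⁻ η : USphere n, ENNReal.ofReal (gramDet (θ : Eucl n) η *
          (g θ - g η) ^ 2) ∂(surfaceMeasure n)) (hm.lintegral_prod_right'.const_mul _),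
    lintegral_const_mul _ hm.lintegral_prod_right', ← mul_assoc]

theorem lintegral_gaussianPair_mul_pow {n : ℕ} (hn : 2 ≤ n) (e : USphere n) {T : USphere n → ℝ}
    (hT : Measurable T) (hT0 : ∀ θ, 0 ≤ T θ) :
    ∫⁻ z : Eucl n × Eucl n, gaussianPair z * ENNReal.ofReal (T (direction e z.1) * ‖z.2‖ ^ 4)
      = gaussianMoment n 0 * (gaussianMoment n 4 * surfaceMeasure n univ) *
        ∫⁻ θ : USphere n, ENNReal.ofReal (T θ) ∂(surfaceMeasure n) := by
  rw [Measure.volume_eq_prod]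
  have h1 : ∀ z : Eucl n × Eucl n, gaussianPair z *
      ENNReal.ofReal (T (direction e z.1) * ‖z.2‖ ^ 4)
      = (ENNReal.ofReal (‖z.1‖ ^ 0 * Real.exp (-‖z.1‖ ^ 2)) * ENNReal.ofReal (T (direction e z.1))) *
        (ENNReal.ofReal (‖z.2‖ ^ 4 * Real.exp (-‖z.2‖ ^ 2)) * 1) := fun z => by
    have := hT0 (direction e z.1)
    rw [gaussianPair, mul_one, ← ENNReal.ofReal_mul (by positivity),
      ← ENNReal.ofReal_mul (by positivity), ← ENNReal.ofReal_mul (by positivity), neg_add,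
      Real.exp_add]
    congr 1
    ring
  simp_rw [h1]
  have m2 : Measurable fun x : Eucl n =>
      ENNReal.ofReal (‖x‖ ^ 0 * Real.exp (-‖x‖ ^ 2)) * ENNReal.ofReal (T (direction e x)) :=
    Measurable.mul (by fun_prop) (hT.comp (measurable_direction e)).ennreal_ofReal
  have m3 : Measurable fun x : Eucl n =>
      ENNReal.ofReal (‖x‖ ^ 4 * Real.exp (-‖x‖ ^ 2)) * (1 : ℝ≥0∞) := by fun_prop
  rw [lintegral_prod_mul m2.aemeasurable m3.aemeasurable,
    lintegral_gaussian_mul hn e 0 (f := fun θ => ENNReal.ofReal (T θ)) hT.ennreal_ofReal,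
    lintegral_gaussian_mul hn e 4 (f := fun _ => 1) measurable_const, lintegral_one]
  ring

theorem lintegral_gaussianPair_mul_rotatePair {n : ℕ} (t : ℝ) {B : Eucl n × Eucl n → ℝ≥0∞}
    (hB : Measurable B) :
    ∫⁻ z, gaussianPair z * B (rotatePair t z) = ∫⁻ z, gaussianPair z * B z := by
  have h : Measurable fun z => gaussianPair z * B z := measurable_gaussianPair.mul hB
  rw [← (measurePreserving_rotatePair t).lintegral_comp h]
  refine lintegral_congr fun z => ?_
  simp only [gaussianPair, norm_sq_rotatePair]

/-- A pointwise bound by an average over rotations becomes, after integration, a bound without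
rotations, since the Gaussian measure is invariant. -/
theorem lintegral_gaussianPair_mul_le {n : ℕ} {A B : Eucl n × Eucl n → ℝ≥0∞} (hB : Measurable B)
    {p : ℝ≥0∞} (hp : p ≠ ⊤) {b : ℝ}
    (hAB : ∀ z, A z ≤ p * ∫⁻ t in Ioc 0 b, B (rotatePair t z)) :
    ∫⁻ z, gaussianPair z * A z ≤ p * (ENNReal.ofReal b * ∫⁻ z, gaussianPair z * B z) := by
  have hBt : Measurable fun q : (Eucl n × Eucl n) × ℝ => gaussianPair q.1 * B (rotatePair q.2 q.1) :=
    have hr : Measurable fun q : (Eucl n × Eucl n) × ℝ => rotatePair q.2 q.1 := by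
      unfold rotatePair; fun_prop
    (measurable_gaussianPair.comp measurable_fst).mul (hB.comp hr)
  have h1 : ∫⁻ z, gaussianPair z * A z
      ≤ ∫⁻ z, p * ∫⁻ t in Ioc 0 b, gaussianPair z * B (rotatePair t z) := by
    refine lintegral_mono fun z => ?_
    have h2 : ∫⁻ t in Ioc 0 b, gaussianPair z * B (rotatePair t z)
        = gaussianPair z * ∫⁻ t in Ioc 0 b, B (rotatePair t z) :=
      lintegral_const_mul' _ _ ENNReal.ofReal_ne_top
    change gaussianPair z * A z ≤ p * ∫⁻ t in Ioc 0 b, gaussianPair z * B (rotatePair t z)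
    rw [h2, mul_left_comm]
    exact mul_le_mul_right (hAB z) _
  have h3 : ∫⁻ z, ∫⁻ t in Ioc 0 b, gaussianPair z * B (rotatePair t z)
      = ∫⁻ t in Ioc 0 b, ∫⁻ z, gaussianPair z * B (rotatePair t z) :=
    lintegral_lintegral_swap hBt.aemeasurable
  rw [lintegral_const_mul' _ _ hp, h3] at h1
  simp_rw [lintegral_gaussianPair_mul_rotatePair _ hB] at h1
  rwa [lintegral_const, Measure.restrict_apply_univ, Real.volume_Ioc, sub_zero,
    mul_comm (∫⁻ z, gaussianPair z * B z)] at h1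

/-- A Poincaré inequality on the sphere, weighted by the squared sine of the angle. The rotation
`(x, y) ↦ (x cos t + y sin t, y cos t - x sin t)` moves `x` to `y`, and leaves the Gram determinant
and the Gaussian measure of `ℝⁿ × ℝⁿ` invariant. -/
theorem exists_lintegral_gramDet_mul_sq_sub_le {n : ℕ} (hn : 2 ≤ n) :
    ∃ C : ℝ≥0∞, C ≠ ⊤ ∧ ∀ g : Eucl n → ℝ, ContDiff ℝ ∞ g →
      ∫⁻ θ : USphere n, ∫⁻ η : USphere n, ENNReal.ofReal (gramDet (θ : Eucl n) η * (g θ - g η) ^ 2)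
        ∂(surfaceMeasure n) ∂(surfaceMeasure n)
      ≤ C * ∫⁻ θ : USphere n, ENNReal.ofReal (‖tangentialGradient g θ‖ ^ 2) ∂(surfaceMeasure n) := by
  obtain ⟨e⟩ := nonempty_usphere hn
  set p := ENNReal.ofReal (Real.pi / 2) with hp
  set c := gaussianMoment n with hc
  have hct : ∀ k, c k ≠ ⊤ := gaussianMoment_ne_top n
  have hcc : c 2 * c 2 ≠ 0 := mul_ne_zero (gaussianMoment_ne_zero n 2) (gaussianMoment_ne_zero n 2)
  have hcct : c 2 * c 2 ≠ ⊤ := ENNReal.mul_ne_top (hct 2) (hct 2)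
  refine ⟨(c 2 * c 2)⁻¹ * (p * (p * (c 0 * (c 4 * surfaceMeasure n univ)))), ?_, fun g hg => ?_⟩
  · exact ENNReal.mul_ne_top (ENNReal.inv_ne_top.2 hcc)
      (ENNReal.mul_ne_top ENNReal.ofReal_ne_top (ENNReal.mul_ne_top ENNReal.ofReal_ne_top
        (ENNReal.mul_ne_top (hct 0) (ENNReal.mul_ne_top (hct 4) (measure_ne_top _ _)))))
  have hgm : Measurable fun θ : USphere n => g θ :=
    (hg.continuous.comp continuous_subtype_val).measurable
  have hTm : Measurable fun θ : USphere n => ‖tangentialGradient g θ‖ ^ 2 :=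
    (continuous_tangentialGradient hg).measurable.norm.pow_const 2
  have hBm : Measurable fun z : Eucl n × Eucl n =>
      ENNReal.ofReal (‖tangentialGradient g (direction e z.1)‖ ^ 2 * ‖z.2‖ ^ 4) := by
    have h1 : Measurable fun z : Eucl n × Eucl n => ‖tangentialGradient g (direction e z.1)‖ ^ 2 :=
      hTm.comp ((measurable_direction e).comp measurable_fst)
    exact (h1.mul (measurable_snd.norm.pow_const 4)).ennreal_ofReal
  have hmain := lintegral_gaussianPair_mul_le hBm ENNReal.ofReal_ne_top (gramDet_mul_sq_sub_le e hg)
  rw [lintegral_gaussianPair_mul_gramDet hn e (g := fun θ => g θ) hgm,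
    lintegral_gaussianPair_mul_pow hn e hTm fun θ => sq_nonneg _] at hmain
  set S := ∫⁻ θ : USphere n, ∫⁻ η : USphere n, ENNReal.ofReal (gramDet (θ : Eucl n) η *
    (g θ - g η) ^ 2) ∂(surfaceMeasure n) ∂(surfaceMeasure n) with hS
  calc S = (c 2 * c 2)⁻¹ * (c 2 * c 2 * S) := by
        rw [← mul_assoc, ENNReal.inv_mul_cancel hcc hcct, one_mul]
    _ ≤ (c 2 * c 2)⁻¹ * (p * (p * (c 0 * (c 4 * surfaceMeasure n univ) *
        ∫⁻ θ : USphere n, ENNReal.ofReal (‖tangentialGradient g θ‖ ^ 2) ∂(surfaceMeasure n)))) :=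
      mul_le_mul_right hmain _
    _ = _ := by ring

/-- Unit vectors with zero Gram determinant are collinear. -/
theorem coe_mem_span_of_gramDet_eq_zero {n : ℕ} {θ η : USphere n}
    (h : gramDet (θ : Eucl n) η = 0) : (η : Eucl n) ∈ Submodule.span ℝ {(θ : Eucl n)} := by
  have hθ : ‖(θ : Eucl n)‖ = 1 := by simp
  have hη : ‖(η : Eucl n)‖ = 1 := by simp
  rw [gramDet, hθ, hη] at h
  rw [Submodule.mem_span_singleton]
  refine ⟨⟪(θ : Eucl n), η⟫_ℝ, ?_⟩
  rw [← sub_eq_zero, ← norm_eq_zero, ← sq_eq_zero_iff, norm_sub_sq_real, norm_smul, mul_pow,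
    inner_smul_left, conj_trivial, Real.norm_eq_abs, sq_abs, hθ, hη]
  linarith

/-- Any two points of the sphere see a third one at angles whose sines are bounded below in mean. -/
theorem exists_le_lintegral_gramDet {n : ℕ} (hn : 2 ≤ n) :
    ∃ c : ℝ≥0∞, c ≠ 0 ∧ c ≠ ⊤ ∧ ∀ θ η : USphere n, c ≤ ∫⁻ ζ : USphere n,
      ENNReal.ofReal (gramDet (θ : Eucl n) ζ * gramDet (ζ : Eucl n) η) ∂(surfaceMeasure n) := by
  obtain ⟨e⟩ := nonempty_usphere hn
  have := nontrivial_eucl hn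
  have hop : (surfaceMeasure n).IsOpenPosMeasure := by unfold surfaceMeasure; infer_instance
  set F : USphere n × USphere n → ℝ := fun p => ∫ ζ : USphere n,
    gramDet (p.1 : Eucl n) ζ * gramDet (ζ : Eucl n) p.2 ∂(surfaceMeasure n) with hF
  have hk : Continuous fun q : (USphere n × USphere n) × USphere n =>
      gramDet (q.1.1 : Eucl n) q.2 * gramDet (q.2 : Eucl n) q.1.2 := by
    unfold gramDet; fun_prop
  have hFc : Continuous F := by
    have h := continuous_parametric_integral_of_continuous (μ := surfaceMeasure n)
      (f := fun (p : USphere n × USphere n) (ζ : USphere n) =>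
        gramDet (p.1 : Eucl n) ζ * gramDet (ζ : Eucl n) p.2) hk isCompact_univ
    simpa only [Measure.restrict_univ] using h
  have hkp : ∀ p : USphere n × USphere n, Continuous fun ζ : USphere n =>
      gramDet (p.1 : Eucl n) ζ * gramDet (ζ : Eucl n) p.2 := fun p => by
    unfold gramDet; fun_prop
  have hk0 : ∀ (p : USphere n × USphere n) (ζ : USphere n),
      0 ≤ gramDet (p.1 : Eucl n) ζ * gramDet (ζ : Eucl n) p.2 := fun p ζ =>
    mul_nonneg (gramDet_nonneg _ _) (gramDet_nonneg _ _)
  have hki : ∀ p : USphere n × USphere n, Integrable (fun ζ : USphere n =>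
      gramDet (p.1 : Eucl n) ζ * gramDet (ζ : Eucl n) p.2) (surfaceMeasure n) := fun p =>
    (hkp p).integrable_of_hasCompactSupport (HasCompactSupport.of_compactSpace _)
  have hpos : ∀ p, 0 < F p := fun p => by
    rw [hF]
    refine (integral_nonneg (hk0 p)).lt_of_ne' fun h => ?_
    rw [integral_eq_zero_iff_of_nonneg (hk0 p) (hki p)] at h
    have h0 := (hkp p).ae_eq_iff_eq (surfaceMeasure n) continuous_zero |>.1 h
    -- every direction would lie on one of two lines
    have hlines : (univ : Set (Eucl n)) ⊆ Submodule.span ℝ {(p.1 : Eucl n)} ∪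
        Submodule.span ℝ {(p.2 : Eucl n)} := fun x _ => by
      rcases eq_or_ne x 0 with rfl | hx
      · exact Or.inl (Submodule.zero_mem _)
      have hx' : x = ‖x‖ • (direction e x : Eucl n) := by
        rw [coe_direction e hx, smul_smul, mul_inv_cancel₀ (norm_ne_zero_iff.2 hx), one_smul]
      rcases mul_eq_zero.1 (congrFun h0 (direction e x)) with h1 | h1
      · left
        rw [hx']
        exact Submodule.smul_mem _ _ (coe_mem_span_of_gramDet_eq_zero h1)
      · right
        rw [gramDet_comm] at h1
        rw [hx']
        exact Submodule.smul_mem _ _ (coe_mem_span_of_gramDet_eq_zero h1)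
    have hnull : ∀ v : Eucl n, volume (Submodule.span ℝ {v} : Set (Eucl n)) = 0 := fun v => by
      refine Measure.addHaar_submodule _ _ fun htop => ?_
      have h2 := finrank_span_le_card (R := ℝ) ({v} : Set (Eucl n))
      rw [htop, finrank_top, finrank_euclideanSpace_fin] at h2
      simp at h2
      omega
    have := measure_mono_null hlines (measure_union_null (hnull p.1) (hnull p.2))
    simp at this
  obtain ⟨p, -, hp⟩ := isCompact_univ.exists_isMinOn ⟨(e, e), mem_univ _⟩ hFc.continuousOn
  refine ⟨ENNReal.ofReal (F p), (ENNReal.ofReal_pos.2 (hpos p)).ne', ENNReal.ofReal_ne_top,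
    fun θ η => ?_⟩
  rw [← ofReal_integral_eq_lintegral_ofReal (hki (θ, η)) (ae_of_all _ (hk0 (θ, η)))]
  exact ENNReal.ofReal_le_ofReal (hp (mem_univ (θ, η)))

theorem gramDet_sphere_le_one {n : ℕ} (θ η : USphere n) : gramDet (θ : Eucl n) η ≤ 1 := by
  refine (gramDet_le _ _).trans ?_
  simp

theorem ENNReal.ofReal_mul_sq_add_le {a b : ℝ} (x y : ℝ) (ha : 0 ≤ a) (ha1 : a ≤ 1) (hb : 0 ≤ b)
    (hb1 : b ≤ 1) : ENNReal.ofReal (a * b * (x + y) ^ 2)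
      ≤ 2 * ENNReal.ofReal (a * x ^ 2) + 2 * ENNReal.ofReal (b * y ^ 2) := by
  have e2 : (2 : ℝ≥0∞) = ENNReal.ofReal 2 := by simp
  rw [e2, ← ENNReal.ofReal_mul (by norm_num), ← ENNReal.ofReal_mul (by norm_num),
    ← ENNReal.ofReal_add (by positivity) (by positivity)]
  refine ENNReal.ofReal_le_ofReal ?_
  have h1 : (x + y) ^ 2 ≤ 2 * x ^ 2 + 2 * y ^ 2 := by nlinarith [sq_nonneg (x - y)]
  have h2 : a * b ≤ a := mul_le_of_le_one_right ha hb1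
  have h3 : a * b ≤ b := mul_le_of_le_one_left hb ha1
  nlinarith [mul_le_mul_of_nonneg_left h1 (mul_nonneg ha hb),
    mul_le_mul_of_nonneg_right h2 (sq_nonneg x), mul_le_mul_of_nonneg_right h3 (sq_nonneg y)]

/-- If, for each pair `(x, y)`, the comparison of `D x y` with `W x z + W z y` holds up to a weight
of `z` with mean at least `c`, then the double integral of `D` is controlled by that of `W`. -/
theorem lintegral_lintegral_le_of_third_point {α : Type*} [MeasurableSpace α] {σ : Measure α}
    [SFinite σ] {k : α → α → α → ℝ≥0∞} {D W : α → α → ℝ≥0∞} {c : ℝ≥0∞} (hct : c ≠ ⊤)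
    (hD : ∀ x y, D x y ≠ ⊤) (hW : Measurable fun z : α × α => W z.1 z.2)
    (hc : ∀ x y, c ≤ ∫⁻ z, k x z y ∂σ)
    (h : ∀ x y z, k x z y * D x y ≤ 2 * W x z + 2 * W z y) :
    c * ∫⁻ x, ∫⁻ y, D x y ∂σ ∂σ ≤ 4 * σ univ * ∫⁻ x, ∫⁻ y, W x y ∂σ ∂σ := by
  have hstep : ∀ x y, c * D x y ≤ 2 * ∫⁻ z, W x z ∂σ + 2 * ∫⁻ z, W z y ∂σ := fun x y => by
    have m1 : Measurable fun z => W x z := hW.comp measurable_prodMk_left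
    have m2 : Measurable fun z => W z y := hW.comp measurable_prodMk_right
    refine (mul_le_mul_left (hc x y) _).trans ?_
    rw [← lintegral_mul_const' _ _ (hD x y)]
    refine (lintegral_mono fun z => h x y z).trans_eq ?_
    rw [lintegral_add_left (m1.const_mul 2), lintegral_const_mul _ m1, lintegral_const_mul _ m2]
  have m1 : Measurable fun x => ∫⁻ z, W x z ∂σ := hW.lintegral_prod_right'
  have m2 : Measurable fun y => ∫⁻ z, W z y ∂σ := hW.lintegral_prod_left'
  rw [← lintegral_const_mul' _ _ hct]
  simp_rw [← lintegral_const_mul' _ _ hct]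
  refine (lintegral_mono fun x => lintegral_mono fun y => hstep x y).trans_eq ?_
  have hi : ∀ x, ∫⁻ y, (2 * ∫⁻ z, W x z ∂σ + 2 * ∫⁻ z, W z y ∂σ) ∂σ
      = 2 * (∫⁻ z, W x z ∂σ) * σ univ + 2 * ∫⁻ x, ∫⁻ y, W x y ∂σ ∂σ := fun x => by
    rw [lintegral_add_left measurable_const, lintegral_const, lintegral_const_mul _ m2,
      lintegral_lintegral_swap (f := fun y z => W z y) (hW.comp measurable_swap).aemeasurable]
  simp_rw [hi]
  rw [lintegral_add_right _ measurable_const, lintegral_const,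
    lintegral_mul_const _ (m1.const_mul 2), lintegral_const_mul _ m1]
  ring

/-- The weight in the Poincaré inequality is removed by passing through a third point. -/
theorem exists_lintegral_sq_sub_le {n : ℕ} (hn : 2 ≤ n) :
    ∃ C : ℝ≥0∞, C ≠ ⊤ ∧ ∀ g : USphere n → ℝ, Measurable g →
      ∫⁻ θ : USphere n, ∫⁻ η : USphere n, ENNReal.ofReal ((g θ - g η) ^ 2)
        ∂(surfaceMeasure n) ∂(surfaceMeasure n)
      ≤ C * ∫⁻ θ : USphere n, ∫⁻ η : USphere n,
        ENNReal.ofReal (gramDet (θ : Eucl n) η * (g θ - g η) ^ 2)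
          ∂(surfaceMeasure n) ∂(surfaceMeasure n) := by
  obtain ⟨c, hc0, hct, hc⟩ := exists_le_lintegral_gramDet hn
  refine ⟨c⁻¹ * (4 * surfaceMeasure n univ), ENNReal.mul_ne_top (ENNReal.inv_ne_top.2 hc0)
    (ENNReal.mul_ne_top (by simp) (measure_ne_top _ _)), fun g hg => ?_⟩
  have h := lintegral_lintegral_le_of_third_point hct
    (D := fun θ η => ENNReal.ofReal ((g θ - g η) ^ 2)) (fun _ _ => ENNReal.ofReal_ne_top)
    (measurable_gramDet_mul_sq_sub hg) hc fun θ η ζ => by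
      have h := ENNReal.ofReal_mul_sq_add_le (g θ - g ζ) (g ζ - g η) (gramDet_nonneg (θ : Eucl n) ζ)
        (gramDet_sphere_le_one θ ζ) (gramDet_nonneg (ζ : Eucl n) η) (gramDet_sphere_le_one ζ η)
      rwa [sub_add_sub_cancel, ENNReal.ofReal_mul
        (mul_nonneg (gramDet_nonneg _ _) (gramDet_nonneg _ _))] at h
  rw [mul_assoc]
  refine le_trans ?_ (mul_le_mul_right h c⁻¹)
  rw [← mul_assoc, ENNReal.inv_mul_cancel hc0 hct, one_mul]

/-- The Poincaré inequality on the sphere: a smooth function is close to one of its values. -/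
theorem exists_lintegral_sq_sub_const_le {n : ℕ} (hn : 2 ≤ n) :
    ∃ C : ℝ≥0∞, C ≠ ⊤ ∧ ∀ g : Eucl n → ℝ, ContDiff ℝ ∞ g → ∃ m : ℝ,
      ∫⁻ θ : USphere n, ENNReal.ofReal ((g θ - m) ^ 2) ∂(surfaceMeasure n)
      ≤ C * ∫⁻ θ : USphere n, ENNReal.ofReal (‖tangentialGradient g θ‖ ^ 2) ∂(surfaceMeasure n) := by
  obtain ⟨C₁, hC₁, h₁⟩ := exists_lintegral_gramDet_mul_sq_sub_le hn
  obtain ⟨C₂, hC₂, h₂⟩ := exists_lintegral_sq_sub_le hn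
  have := nontrivial_eucl hn
  have hσ : surfaceMeasure n ≠ 0 := Measure.toSphere_ne_zero _
  refine ⟨(surfaceMeasure n univ)⁻¹ * (C₂ * C₁), ENNReal.mul_ne_top (ENNReal.inv_ne_top.2
    (by simpa using hσ)) (ENNReal.mul_ne_top hC₂ hC₁), fun g hg => ?_⟩
  have hgm : Measurable fun θ : USphere n => g θ :=
    (hg.continuous.comp continuous_subtype_val).measurable
  have hm : Measurable fun z : USphere n × USphere n => ENNReal.ofReal ((g z.1 - g z.2) ^ 2) :=
    (((hgm.comp measurable_fst).sub (hgm.comp measurable_snd)).pow_const 2).ennreal_ofReal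
  obtain ⟨η, hη⟩ := exists_le_laverage hσ (f := fun η : USphere n => ∫⁻ θ : USphere n,
    ENNReal.ofReal ((g θ - g η) ^ 2) ∂(surfaceMeasure n)) hm.lintegral_prod_left'.aemeasurable
  refine ⟨g η, hη.trans ?_⟩
  rw [laverage_eq, ENNReal.div_eq_inv_mul, mul_assoc, mul_assoc]
  refine mul_le_mul_right ?_ _
  rw [lintegral_lintegral_swap (f := fun η θ : USphere n => ENNReal.ofReal ((g θ - g η) ^ 2))
    (hm.comp measurable_swap).aemeasurable]
  exact (h₂ (fun θ => g θ) hgm).trans (mul_le_mul_right (h₁ g hg) _)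

/-! ### Functions vanishing on a set of positive capacity -/

theorem tangentialGradient_one_sub {n : ℕ} {g : Eucl n → ℝ} (hg : ContDiff ℝ ∞ g) (a : ℝ)
    (θ : USphere n) :
    tangentialGradient (fun x => 1 - a * g x) θ = -(a • tangentialGradient g θ) := by
  have h : gradient (fun x => 1 - a * g x) (θ : Eucl n) = -(a • gradient g (θ : Eucl n)) := by
    have hd : DifferentiableAt ℝ g (θ : Eucl n) := (hg.differentiable (by simp)) _
    simp only [gradient]
    rw [fderiv_const_sub, fderiv_const_mul hd]
    simp
  rw [tangentialGradient, tangentialGradient, h, inner_neg_right, inner_smul_right, neg_smul,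
    smul_sub, smul_smul]
  abel

theorem sphereCapacity_ne_top {n : ℕ} (A : Set (USphere n)) : sphereCapacity A ≠ ⊤ := by
  have h : sphereCapacity A ≤ ∫⁻ θ : USphere n, ENNReal.ofReal ((1 - 0 * (0 : ℝ)) ^ 2 +
      ‖tangentialGradient (fun _ : Eucl n => 1 - 0 * (0 : ℝ)) θ‖ ^ 2) ∂(surfaceMeasure n) :=
    iInf_le_of_le (fun _ => 1 - 0 * 0)
      (iInf_le_of_le contDiff_const (iInf_le_of_le (Eventually.of_forall fun _ => by simp) le_rfl))
  have h2 : ∀ θ : USphere n, tangentialGradient (fun _ : Eucl n => 1 - 0 * (0 : ℝ)) θ = 0 :=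
    fun θ =>
    (tangentialGradient_one_sub (g := fun _ => 0) contDiff_const 0 θ).trans (by simp)
  simp_rw [h2] at h
  refine (h.trans_lt ?_).ne
  simp [measure_lt_top]

/-- The Friedrichs inequality on the sphere, for functions vanishing near a set of positive
capacity. If `g` is close to the constant `m`, then `1 - g / m` is a competitor for the capacity, so
that `m` is small as well. -/
theorem exists_lintegral_sq_le_of_capacity_pos {n : ℕ} (hn : 2 ≤ n) {A : Set (USphere n)}
    (hA : 0 < sphereCapacity A) :
    ∃ C : ℝ≥0∞, C ≠ ⊤ ∧ ∀ g : Eucl n → ℝ, ContDiff ℝ ∞ g → (∀ᶠ θ : USphere n in 𝓝ˢ A, g θ = 0) →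
      ∫⁻ θ : USphere n, ENNReal.ofReal (g θ ^ 2) ∂(surfaceMeasure n)
      ≤ C * ∫⁻ θ : USphere n, ENNReal.ofReal (‖tangentialGradient g θ‖ ^ 2) ∂(surfaceMeasure n) := by
  obtain ⟨C, hC, h⟩ := exists_lintegral_sq_sub_const_le hn
  set σ := surfaceMeasure n
  set κ := sphereCapacity A with hκ
  refine ⟨2 * C + 2 * σ univ * (κ⁻¹ * (C + 1)), ?_, fun g hg hgA => ?_⟩
  · exact ENNReal.add_ne_top.2 ⟨ENNReal.mul_ne_top (by simp) hC,
      ENNReal.mul_ne_top (ENNReal.mul_ne_top (by simp) (measure_ne_top _ _))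
        (ENNReal.mul_ne_top (ENNReal.inv_ne_top.2 hA.ne') (by simp [hC]))⟩
  obtain ⟨m, hm⟩ := h g hg
  have hgm : Measurable fun θ : USphere n => g θ :=
    (hg.continuous.comp continuous_subtype_val).measurable
  have hTm : Measurable fun θ : USphere n => ‖tangentialGradient g θ‖ ^ 2 :=
    (continuous_tangentialGradient hg).measurable.norm.pow_const 2
  set T := ∫⁻ θ : USphere n, ENNReal.ofReal (‖tangentialGradient g θ‖ ^ 2) ∂σ with hT
  have hcap : κ * ENNReal.ofReal (m ^ 2) ≤ (C + 1) * T := by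
    rcases eq_or_ne m 0 with rfl | hm0
    · simp
    have hu : κ ≤ ∫⁻ θ : USphere n, ENNReal.ofReal ((1 - m⁻¹ * g θ) ^ 2 +
        ‖tangentialGradient (fun x => 1 - m⁻¹ * g x) θ‖ ^ 2) ∂σ := by
      refine iInf_le_of_le (fun x => 1 - m⁻¹ * g x) (iInf_le_of_le ?_ (iInf_le_of_le ?_ le_rfl))
      · exact contDiff_const.sub (contDiff_const.mul hg)
      · filter_upwards [hgA] with θ hθ
        rw [hθ, mul_zero, sub_zero]
    refine (mul_le_mul_left hu _).trans ?_
    rw [← lintegral_mul_const' _ _ ENNReal.ofReal_ne_top]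
    have hpt : ∀ θ : USphere n, ENNReal.ofReal ((1 - m⁻¹ * g θ) ^ 2 +
        ‖tangentialGradient (fun x => 1 - m⁻¹ * g x) θ‖ ^ 2) * ENNReal.ofReal (m ^ 2)
        = ENNReal.ofReal ((g θ - m) ^ 2) + ENNReal.ofReal (‖tangentialGradient g θ‖ ^ 2) := fun θ => by
      rw [← ENNReal.ofReal_mul (by positivity), ← ENNReal.ofReal_add (by positivity) (by positivity),
        tangentialGradient_one_sub hg, norm_neg, norm_smul, mul_pow, Real.norm_eq_abs, sq_abs]
      congr 1
      field_simp
      ring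
    simp_rw [hpt]
    rw [lintegral_add_right _ hTm.ennreal_ofReal, add_mul, one_mul]
    exact add_le_add_left hm _
  have hm2 : ENNReal.ofReal (m ^ 2) ≤ κ⁻¹ * ((C + 1) * T) := by
    calc ENNReal.ofReal (m ^ 2) = κ⁻¹ * (κ * ENNReal.ofReal (m ^ 2)) := by
          rw [← mul_assoc, ENNReal.inv_mul_cancel hA.ne' (sphereCapacity_ne_top A), one_mul]
      _ ≤ _ := mul_le_mul_right hcap _
  calc ∫⁻ θ : USphere n, ENNReal.ofReal (g θ ^ 2) ∂σ
      ≤ ∫⁻ θ : USphere n, (2 * ENNReal.ofReal ((g θ - m) ^ 2) + 2 * ENNReal.ofReal (m ^ 2)) ∂σ := by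
        refine lintegral_mono fun θ => ?_
        simpa using ENNReal.ofReal_mul_sq_add_le (g θ - m) m zero_le_one le_rfl zero_le_one le_rfl
    _ = 2 * ∫⁻ θ : USphere n, ENNReal.ofReal ((g θ - m) ^ 2) ∂σ
        + 2 * ENNReal.ofReal (m ^ 2) * σ univ := by
        rw [lintegral_add_right _ measurable_const, lintegral_const, lintegral_const_mul _
          ((hgm.sub_const m).pow_const 2).ennreal_ofReal]
    _ ≤ 2 * (C * T) + 2 * (κ⁻¹ * ((C + 1) * T)) * σ univ := by gcongr
    _ = _ := by ring

/-! ### Hardy and Friedrichs inequalities -/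

theorem norm_tangentialGradient_comp_smul_sq_le {n : ℕ} (g : Eucl n → ℝ) (r : ℝ) (θ : USphere n) :
    ‖tangentialGradient (fun x => g (r • x)) θ‖ ^ 2
      ≤ r ^ 2 * ‖gradient g (r • (θ : Eucl n))‖ ^ 2 := by
  have hθ : ‖(θ : Eucl n)‖ = 1 := by simp
  have h : ∀ v : Eucl n, ‖v - ⟪(θ : Eucl n), v⟫_ℝ • (θ : Eucl n)‖ ^ 2 ≤ ‖v‖ ^ 2 := fun v => by
    rw [norm_sub_sq_real, inner_smul_right, norm_smul, hθ, real_inner_comm (θ : Eucl n) v, mul_one,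
      Real.norm_eq_abs, sq_abs]
    nlinarith [sq_nonneg ⟪(θ : Eucl n), v⟫_ℝ]
  rw [tangentialGradient, gradient_comp_smul]
  refine (h _).trans_eq ?_
  rw [norm_smul, mul_pow, Real.norm_eq_abs, sq_abs]

/-- A Hardy inequality outside of a ball, for functions vanishing outside of a cone whose section
has a complement of positive capacity: the Friedrichs inequality on each sphere. -/
theorem exists_lintegral_outerBall_le {n : ℕ} (hn : 2 ≤ n) {Γ : Set (Eucl n)}
    (hc : ∀ x ∈ Γ, ∀ t : ℝ, 0 < t → t • x ∈ Γ) (hΓ : 0 < sphereCapacity (sphericalSection Γ)ᶜ) :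
    ∃ C : ℝ≥0∞, C ≠ ⊤ ∧ ∀ R : ℝ, 0 < R → ∀ g : Eucl n → ℝ, ContDiff ℝ ∞ g →
      tsupport g ∩ outerBall n R ⊆ Γ →
      ∫⁻ x in outerBall n R, ENNReal.ofReal ((‖x‖⁻¹ * g x) ^ 2)
        ≤ C * ∫⁻ x, ENNReal.ofReal (‖gradient g x‖ ^ 2) := by
  obtain ⟨C, hC, h⟩ := exists_lintegral_sq_le_of_capacity_pos hn hΓ
  refine ⟨C, hC, fun R hR g hg hgΓ => ?_⟩
  have hm : MeasurableSet (outerBall n R) := (isOpen_outerBall n R).measurableSet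
  have hgm : Measurable g := hg.continuous.measurable
  have hGm : Measurable (gradient g) := (continuous_gradient hg).measurable
  rw [← lintegral_indicator hm, lintegral_polar hn (Measurable.indicator (by fun_prop) hm),
    lintegral_polar hn (by fun_prop), ← lintegral_const_mul' _ _ hC]
  refine setLIntegral_mono' measurableSet_Ioi fun r hr => ?_
  have hr0 : 0 < r := hr
  rw [mul_left_comm]
  refine mul_le_mul_right ?_ _
  have hnorm : ∀ θ : USphere n, ‖r • (θ : Eucl n)‖ = r := fun θ => by
    have hθ : ‖(θ : Eucl n)‖ = 1 := by simp
    rw [norm_smul, hθ, mul_one, Real.norm_of_nonneg hr0.le]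
  rcases le_or_gt r R with hrR | hrR
  · have hz : ∀ θ : USphere n, (outerBall n R).indicator
        (fun x => ENNReal.ofReal ((‖x‖⁻¹ * g x) ^ 2)) (r • (θ : Eucl n)) = 0 := fun θ =>
      indicator_of_notMem (fun hx => absurd hx.out (by rw [hnorm]; exact not_lt.2 hrR)) _
    simp [hz]
  have hmem : ∀ θ : USphere n, r • (θ : Eucl n) ∈ outerBall n R := fun θ => by
    change R < _
    rwa [hnorm]
  have hslice := h (fun x => g (r • x)) (hg.comp (contDiff_const_smul r)) (by
    rw [eventually_nhdsSet_iff_forall]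
    intro θ hθ
    have h1 : r • (θ : Eucl n) ∉ tsupport g := fun hs => hθ (by
      have := hc _ (hgΓ ⟨hs, hmem θ⟩) r⁻¹ (inv_pos.2 hr0)
      rwa [smul_smul, inv_mul_cancel₀ hr0.ne', one_smul] at this)
    have h2 : ∀ᶠ x in 𝓝 (r • (θ : Eucl n)), g x = 0 := by
      rw [notMem_tsupport_iff_eventuallyEq] at h1
      exact h1
    have h3 : Continuous fun θ : USphere n => r • (θ : Eucl n) := by fun_prop
    exact h3.continuousAt.eventually h2)
  have h1 : ∀ θ : USphere n, (outerBall n R).indicator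
      (fun x => ENNReal.ofReal ((‖x‖⁻¹ * g x) ^ 2)) (r • (θ : Eucl n))
      = ENNReal.ofReal (r⁻¹ ^ 2) * ENNReal.ofReal (g (r • (θ : Eucl n)) ^ 2) := fun θ => by
    rw [indicator_of_mem (hmem θ), hnorm, mul_pow, ENNReal.ofReal_mul (by positivity)]
  simp_rw [h1]
  rw [lintegral_const_mul' _ _ ENNReal.ofReal_ne_top]
  refine (mul_le_mul_right hslice _).trans ?_
  rw [mul_left_comm, ← lintegral_const_mul' _ _ ENNReal.ofReal_ne_top]
  refine mul_le_mul_right (lintegral_mono fun θ => ?_) _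
  rw [← ENNReal.ofReal_mul (by positivity)]
  refine ENNReal.ofReal_le_ofReal ?_
  calc r⁻¹ ^ 2 * ‖tangentialGradient (fun x => g (r • x)) θ‖ ^ 2
      ≤ r⁻¹ ^ 2 * (r ^ 2 * ‖gradient g (r • (θ : Eucl n))‖ ^ 2) := by
        gcongr
        exact norm_tangentialGradient_comp_smul_sq_le g r θ
    _ = _ := by field_simp

theorem IsTestFunction.integrable_sq {n : ℕ} {U : Set (Eucl n)} {f : Eucl n → ℝ}
    (hf : IsTestFunction U f) : Integrable fun x => f x ^ 2 := by
  have h : HasCompactSupport fun x => f x ^ 2 :=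
    hf.compact.comp_left (g := fun t => t ^ 2) (by simp)
  exact (hf.continuous.pow 2).integrable_of_hasCompactSupport h

theorem IsTestFunction.integrable_norm_gradient_sq {n : ℕ} {U : Set (Eucl n)} {f : Eucl n → ℝ}
    (hf : IsTestFunction U f) : Integrable fun x => ‖gradient f x‖ ^ 2 := by
  have h : HasCompactSupport fun x => ‖gradient f x‖ ^ 2 :=
    hf.hasCompactSupport_gradient.comp_left (g := fun v => ‖v‖ ^ 2) (by simp)
  exact ((continuous_gradient hf.smooth).norm.pow 2).integrable_of_hasCompactSupport h

/-- Integration by parts of `f² = f² ∂ₑ⟨e, x⟩`. -/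
theorem integral_sq_eq_neg_two_mul {n : ℕ} {U : Set (Eucl n)} {f : Eucl n → ℝ}
    (hf : IsTestFunction U f) {e : Eucl n} (he : ‖e‖ = 1) :
    ∫ x, f x ^ 2 = -2 * ∫ x, ⟪e, x⟫_ℝ * f x * fderiv ℝ f x e := by
  have hfd : Differentiable ℝ f := hf.differentiable
  have hfc : Continuous f := hf.continuous
  have hDc : Continuous fun x => fderiv ℝ f x e :=
    (hf.smooth.continuous_fderiv (by simp)).clm_apply continuous_const
  have hlc : Continuous fun x : Eucl n => ⟪e, x⟫_ℝ := by fun_prop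
  have hl : ∀ x, HasFDerivAt (fun x : Eucl n => ⟪e, x⟫_ℝ) (innerSL ℝ e) x :=
    fun x => (innerSL ℝ e).hasFDerivAt
  have hprod : ∀ x, fderiv ℝ (fun x => ⟪e, x⟫_ℝ * f x) x e
      = ⟪e, x⟫_ℝ * fderiv ℝ f x e + f x := fun x => by
    rw [((hl x).fun_mul (hfd x).hasFDerivAt).fderiv]
    simp only [add_apply, smul_apply, innerSL_apply_apply, smul_eq_mul, real_inner_self_eq_norm_sq,
      he]
    ring
  have i1 := hf.integrable_sq
  have s3 : HasCompactSupport fun x => ⟪e, x⟫_ℝ * f x * fderiv ℝ f x e :=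
    hf.compact.mul_left.mul_right
  have i3 : Integrable fun x => ⟪e, x⟫_ℝ * f x * fderiv ℝ f x e :=
    ((hlc.mul hfc).mul hDc).integrable_of_hasCompactSupport s3
  have s4 : HasCompactSupport fun x => (⟪e, x⟫_ℝ * fderiv ℝ f x e + f x) * f x := hf.compact.mul_left
  have s5 : HasCompactSupport fun x => ⟪e, x⟫_ℝ * f x * f x := hf.compact.mul_left
  have i4 : Integrable fun x => (⟪e, x⟫_ℝ * fderiv ℝ f x e + f x) * f x :=
    (((hlc.mul hDc).add hfc).mul hfc).integrable_of_hasCompactSupport s4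
  have i5 : Integrable fun x => ⟪e, x⟫_ℝ * f x * f x :=
    ((hlc.mul hfc).mul hfc).integrable_of_hasCompactSupport s5
  have hparts := integral_mul_fderiv_eq_neg_fderiv_mul_of_integrable (μ := volume)
    (f := fun x => ⟪e, x⟫_ℝ * f x) (g := f) (v := e)
    (by simpa only [hprod] using i4) i3 i5
    (fun x _ => ((hl x).fun_mul (hfd x).hasFDerivAt).differentiableAt) fun x _ => hfd x
  simp only [hprod] at hparts
  have hexp : ∀ x, (⟪e, x⟫_ℝ * fderiv ℝ f x e + f x) * f x
      = ⟪e, x⟫_ℝ * f x * fderiv ℝ f x e + f x ^ 2 := fun x => by ring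
  simp only [hexp] at hparts
  rw [integral_add i3 i1] at hparts
  linarith

theorem neg_two_mul_le_of_norm_le {n : ℕ} {f : Eucl n → ℝ} {e x : Eucl n} (he : ‖e‖ = 1) {ρ : ℝ}
    (hx : ‖x‖ ≤ ρ) : -2 * (⟪e, x⟫_ℝ * f x * fderiv ℝ f x e)
      ≤ 1 / 2 * f x ^ 2 + 2 * ρ ^ 2 * ‖gradient f x‖ ^ 2 := by
  have h1 : |⟪e, x⟫_ℝ| ≤ ρ := (abs_real_inner_le_norm _ _).trans (by rwa [he, one_mul])
  have h2 : |fderiv ℝ f x e| ≤ ‖gradient f x‖ := by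
    rw [← inner_gradient_left]
    exact (abs_real_inner_le_norm _ _).trans (by rw [he, mul_one])
  have h3 : |⟪e, x⟫_ℝ * fderiv ℝ f x e| ≤ ρ * ‖gradient f x‖ := by
    rw [abs_mul]
    exact mul_le_mul h1 h2 (abs_nonneg _) ((norm_nonneg _).trans hx)
  have h4 := pow_le_pow_left₀ (abs_nonneg _) h3 2
  rw [sq_abs] at h4
  nlinarith [sq_nonneg (f x + 2 * (⟪e, x⟫_ℝ * fderiv ℝ f x e))]

/-- The Friedrichs inequality in a ball, from `∫ f² = -2 ∫ ⟨e, x⟩ f ∂ₑf`. -/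
theorem lintegral_sq_le_of_tsupport_subset_ball {n : ℕ} (hn : 2 ≤ n) {ρ : ℝ}
    {f : Eucl n → ℝ} (hf : IsTestFunction (ball 0 ρ) f) :
    ∫⁻ x, ENNReal.ofReal (f x ^ 2)
      ≤ ENNReal.ofReal (4 * ρ ^ 2) * ∫⁻ x, ENNReal.ofReal (‖gradient f x‖ ^ 2) := by
  obtain ⟨e⟩ := nonempty_usphere hn
  have he : ‖(e : Eucl n)‖ = 1 := by simp
  have hDc : Continuous fun x => fderiv ℝ f x (e : Eucl n) :=
    (hf.smooth.continuous_fderiv (by simp)).clm_apply continuous_const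
  have hlc : Continuous fun x : Eucl n => ⟪(e : Eucl n), x⟫_ℝ := by fun_prop
  have i1 := hf.integrable_sq
  have i2 := hf.integrable_norm_gradient_sq
  have s3 : HasCompactSupport fun x => ⟪(e : Eucl n), x⟫_ℝ * f x * fderiv ℝ f x (e : Eucl n) :=
    hf.compact.mul_left.mul_right
  have i3 : Integrable fun x => ⟪(e : Eucl n), x⟫_ℝ * f x * fderiv ℝ f x (e : Eucl n) :=
    ((hlc.mul hf.continuous).mul hDc).integrable_of_hasCompactSupport s3
  have hpt : ∀ x, -2 * (⟪(e : Eucl n), x⟫_ℝ * f x * fderiv ℝ f x (e : Eucl n))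
      ≤ 1 / 2 * f x ^ 2 + 2 * ρ ^ 2 * ‖gradient f x‖ ^ 2 := fun x => by
    by_cases hx : x ∈ tsupport f
    · exact neg_two_mul_le_of_norm_le he (by simpa using (hf.support_subset hx).out.le)
    · rw [image_eq_zero_of_notMem_tsupport hx, gradient_eq_zero_of_notMem_tsupport hx]
      simp
  have hle : ∫ x, -2 * (⟪(e : Eucl n), x⟫_ℝ * f x * fderiv ℝ f x (e : Eucl n))
      ≤ ∫ x, (1 / 2 * f x ^ 2 + 2 * ρ ^ 2 * ‖gradient f x‖ ^ 2) :=
    integral_mono (i3.const_mul (-2)) ((i1.const_mul (1 / 2)).add (i2.const_mul (2 * ρ ^ 2))) hpt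
  rw [integral_const_mul, ← integral_sq_eq_neg_two_mul hf he,
    integral_add (i1.const_mul _) (i2.const_mul _), integral_const_mul, integral_const_mul] at hle
  rw [← ofReal_integral_eq_lintegral_ofReal i1 (ae_of_all _ fun x => sq_nonneg _),
    ← ofReal_integral_eq_lintegral_ofReal i2 (ae_of_all _ fun x => sq_nonneg _),
    ← ENNReal.ofReal_mul (by positivity)]
  refine ENNReal.ofReal_le_ofReal ?_
  linarith

theorem eLpNorm_two_le_of_lintegral_sq_le {n : ℕ} {F : Type*} [NormedAddCommGroup F]
    {f : Eucl n → ℝ} {G : Eucl n → F} {C : ℝ≥0∞} (hC : C ≠ ⊤)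
    (h : ∫⁻ x, ENNReal.ofReal (f x ^ 2) ≤ C * ∫⁻ x, ENNReal.ofReal (‖G x‖ ^ 2)) :
    eLpNorm f 2 volume ≤ ENNReal.ofReal (√C.toReal) * eLpNorm G 2 volume := by
  have e1 : ∀ x, ‖f x‖ₑ ^ (2 : ℝ≥0∞).toReal = ENNReal.ofReal (f x ^ 2) := fun x => by
    rw [ENNReal.toReal_ofNat, ENNReal.rpow_ofNat, ← ofReal_norm, ← ENNReal.ofReal_pow (norm_nonneg _),
      Real.norm_eq_abs, sq_abs]
  have e2 : ∀ x, ‖G x‖ₑ ^ (2 : ℝ≥0∞).toReal = ENNReal.ofReal (‖G x‖ ^ 2) := fun x => by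
    rw [ENNReal.toReal_ofNat, ENNReal.rpow_ofNat, ← ofReal_norm, ← ENNReal.ofReal_pow (norm_nonneg _)]
  rw [eLpNorm_eq_lintegral_rpow_enorm_toReal (by simp) (by simp),
    eLpNorm_eq_lintegral_rpow_enorm_toReal (by simp) (by simp)]
  simp_rw [e1, e2]
  refine (ENNReal.rpow_le_rpow h (by simp)).trans_eq ?_
  rw [ENNReal.mul_rpow_of_nonneg _ _ (by simp)]
  congr 1
  rw [Real.sqrt_eq_rpow, ENNReal.toReal_ofNat,
    ← ENNReal.ofReal_rpow_of_nonneg ENNReal.toReal_nonneg (by norm_num), ENNReal.ofReal_toReal hC]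

theorem IsTestFunction.eLpNorm_le {n : ℕ} {U : Set (Eucl n)} {g w : Eucl n → ℝ}
    (hg : IsTestFunction U g) {C : ℝ≥0∞} (hC : C ≠ ⊤)
    (h : ∫⁻ x, ENNReal.ofReal ((w x * g x) ^ 2) ≤ C * ∫⁻ x, ENNReal.ofReal (‖gradient g x‖ ^ 2)) :
    eLpNorm (fun x => w x * g x) 2 (volume.restrict U)
      ≤ ENNReal.ofReal (√C.toReal) * eLpNorm (gradient g) 2 (volume.restrict U) := by
  rw [eLpNorm_restrict_eq_of_support_subset, eLpNorm_restrict_eq_of_support_subset]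
  · exact eLpNorm_two_le_of_lintegral_sq_le hC h
  · exact fun x hx => hg.support_subset (by
      by_contra hx'
      exact hx (gradient_eq_zero_of_notMem_tsupport hx'))
  · exact fun x hx => hg.support_subset (by
      by_contra hx'
      exact hx (by simp only [image_eq_zero_of_notMem_tsupport hx', mul_zero]))

/-- The Friedrichs inequality on a bounded set. -/
theorem exists_friedrichs {n : ℕ} (hn : 2 ≤ n) {Ω : Set (Eucl n)} (hΩ : Bornology.IsBounded Ω) :
    ∃ C, 0 ≤ C ∧ ∀ g, IsTestFunction Ω g →
      eLpNorm (fun x => 1 * g x) 2 (volume.restrict Ω)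
        ≤ ENNReal.ofReal C * eLpNorm (gradient g) 2 (volume.restrict Ω) := by
  obtain ⟨ρ, hρ⟩ := hΩ.subset_ball 0
  refine ⟨_, Real.sqrt_nonneg _, fun g hg =>
    hg.eLpNorm_le (ENNReal.ofReal_ne_top (r := 4 * (max ρ 1) ^ 2)) ?_⟩
  simp only [one_mul]
  exact lintegral_sq_le_of_tsupport_subset_ball hn
    ⟨hg.smooth, hg.compact, hg.support_subset.trans (hρ.trans (ball_subset_ball (le_max_left _ _)))⟩

/-- The Hardy inequality on a set that coincides outside of a ball with a cone whose section has a
complement of positive capacity. Near the origin, the Friedrichs inequality is applied to the product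
with a cutoff. -/
theorem exists_hardy {n : ℕ} (hn : 2 ≤ n) {Γ P : Set (Eucl n)}
    (hc : ∀ x ∈ Γ, ∀ t : ℝ, 0 < t → t • x ∈ Γ) (hΓ : 0 < sphereCapacity (sphericalSection Γ)ᶜ)
    {R : ℝ} (hR : 0 < R) (hP : P ∩ outerBall n R = Γ ∩ outerBall n R) :
    ∃ C, 0 ≤ C ∧ ∀ g, IsTestFunction P g →
      eLpNorm (fun x => decayWeight x * g x) 2 (volume.restrict P)
        ≤ ENNReal.ofReal C * eLpNorm (gradient g) 2 (volume.restrict P) := by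
  obtain ⟨C₁, hC₁, h₁⟩ := exists_lintegral_outerBall_le hn hc hΓ
  let ζ : ContDiffBump (0 : Eucl n) := ⟨2 * R, 4 * R, by positivity, by linarith⟩
  have hζ : ContDiff ℝ ∞ (ζ : Eucl n → ℝ) := ζ.contDiff
  have hζtest : IsTestFunction univ (ζ : Eucl n → ℝ) := ⟨hζ, ζ.hasCompactSupport, subset_univ _⟩
  obtain ⟨M, hM⟩ := (continuous_gradient hζ).bounded_above_of_compact_support
    hζtest.hasCompactSupport_gradient
  have hM0 : 0 ≤ M := (norm_nonneg _).trans (hM 0)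
  have hζsupp : ∀ x ∈ tsupport (ζ : Eucl n → ℝ), ‖x‖ ≤ 4 * R := fun x hx => by
    rw [ζ.tsupport_eq] at hx
    simpa using hx.out
  set C₂ : ℝ≥0∞ := ENNReal.ofReal (4 * (5 * R) ^ 2) *
    (2 + 2 * (ENNReal.ofReal ((M * (4 * R)) ^ 2) * C₁)) with hC₂
  have hC₂t : C₂ ≠ ⊤ := ENNReal.mul_ne_top ENNReal.ofReal_ne_top (ENNReal.add_ne_top.2
    ⟨by simp, ENNReal.mul_ne_top (by simp) (ENNReal.mul_ne_top ENNReal.ofReal_ne_top hC₁)⟩)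
  refine ⟨_, Real.sqrt_nonneg _, fun g hg => hg.eLpNorm_le (ENNReal.add_ne_top.2 ⟨hC₂t, hC₁⟩) ?_⟩
  set I := ∫⁻ x, ENNReal.ofReal (‖gradient g x‖ ^ 2) with hI
  have hm : MeasurableSet (outerBall n R) := (isOpen_outerBall n R).measurableSet
  have hout : ∫⁻ x in outerBall n R, ENNReal.ofReal ((‖x‖⁻¹ * g x) ^ 2) ≤ C₁ * I :=
    h₁ R hR g hg.smooth fun x hx => (hP.subset ⟨hg.support_subset hx.1, hx.2⟩).1
  have hζg : IsTestFunction (ball 0 (5 * R)) fun x => ζ x * g x := by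
    refine hg.mul_left hζ fun x hx => ?_
    have := hζsupp x hx.1
    rw [mem_ball_zero_iff]
    linarith
  have hgm : Measurable g := hg.continuous.measurable
  have hGm : Measurable (gradient g) := (continuous_gradient hg.smooth).measurable
  have hin : ∫⁻ x, ENNReal.ofReal ((ζ x * g x) ^ 2) ≤ C₂ * I := by
    refine (lintegral_sq_le_of_tsupport_subset_ball hn hζg).trans ?_
    rw [hC₂, mul_assoc]
    refine mul_le_mul_right ?_ _
    have hpt : ∀ x, ENNReal.ofReal (‖gradient (fun x => ζ x * g x) x‖ ^ 2)
        ≤ 2 * ENNReal.ofReal (‖gradient g x‖ ^ 2) + 2 * (ENNReal.ofReal ((M * (4 * R)) ^ 2) *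
          (outerBall n R).indicator (fun x => ENNReal.ofReal ((‖x‖⁻¹ * g x) ^ 2)) x) := fun x => by
      have h1 := ENNReal.ofReal_mul_sq_add_le ‖gradient g x‖ ‖g x • gradient ζ x‖ zero_le_one le_rfl
        zero_le_one le_rfl
      simp only [one_mul] at h1
      refine (ENNReal.ofReal_le_ofReal ?_).trans (h1.trans ?_)
      · refine pow_le_pow_left₀ (norm_nonneg _) ?_ 2
        rw [gradient_mul (hζtest.differentiable x) (hg.differentiable x)]
        refine (norm_add_le _ _).trans (add_le_add ?_ le_rfl)
        rw [norm_smul, Real.norm_of_nonneg ζ.nonneg]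
        exact mul_le_of_le_one_left (norm_nonneg _) ζ.le_one
      · gcongr
        by_cases hx : 2 * R ≤ ‖x‖ ∧ ‖x‖ ≤ 4 * R
        · have hxR : x ∈ outerBall n R := by
            change R < ‖x‖
            linarith [hx.1]
          have hx0 : 0 < ‖x‖ := by linarith [hx.1]
          rw [indicator_of_mem hxR, ← ENNReal.ofReal_mul (by positivity), ← mul_pow]
          refine ENNReal.ofReal_le_ofReal ?_
          rw [← sq_abs (_ * _)]
          refine pow_le_pow_left₀ (norm_nonneg _) ?_ 2
          rw [norm_smul, Real.norm_eq_abs, abs_mul (M * (4 * R)), abs_mul ‖x‖⁻¹,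
            abs_of_pos (inv_pos.2 hx0), abs_of_nonneg (show 0 ≤ M * (4 * R) by positivity)]
          calc |g x| * ‖gradient ζ x‖ ≤ |g x| * M := by gcongr; exact hM x
            _ = M * ‖x‖ * (‖x‖⁻¹ * |g x|) := by field_simp
            _ ≤ M * (4 * R) * (‖x‖⁻¹ * |g x|) := by gcongr; exact hx.2
        · have hz : gradient ζ x = 0 := by
            rcases not_and_or.1 hx with hx | hx
            · have h1 : (fun y => ζ y) =ᶠ[𝓝 x] fun _ => (1 : ℝ) :=
                ζ.eventuallyEq_one_of_mem_ball (by simpa using hx)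
              rw [gradient, h1.fderiv_eq]
              simp
            · exact gradient_eq_zero_of_notMem_tsupport fun h => hx (hζsupp x h)
          rw [hz]
          simp
    refine (lintegral_mono hpt).trans ?_
    rw [lintegral_add_left (by fun_prop), lintegral_const_mul _ (by fun_prop),
      lintegral_const_mul' _ _ (by simp), lintegral_const_mul' _ _ ENNReal.ofReal_ne_top,
      lintegral_indicator hm, add_mul, mul_assoc, mul_assoc]
    gcongr
  have hpt : ∀ x, ENNReal.ofReal ((decayWeight x * g x) ^ 2) ≤ ENNReal.ofReal ((ζ x * g x) ^ 2) +
      (outerBall n R).indicator (fun x => ENNReal.ofReal ((‖x‖⁻¹ * g x) ^ 2)) x := fun x => by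
    have hw0 : 0 ≤ decayWeight x := by unfold decayWeight; positivity
    by_cases hx : x ∈ outerBall n R
    · rw [indicator_of_mem hx]
      refine le_add_of_nonneg_of_le zero_le (ENNReal.ofReal_le_ofReal ?_)
      have hx0 : 0 < ‖x‖ := hR.trans hx
      rw [mul_pow, mul_pow]
      gcongr
      unfold decayWeight
      gcongr
      linarith
    · refine le_add_of_le_of_nonneg (ENNReal.ofReal_le_ofReal ?_) zero_le
      have hx1 : ‖x‖ ≤ R := not_lt.1 hx
      have h1 : ζ x = 1 := ζ.one_of_mem_closedBall (by
        rw [mem_closedBall_zero_iff]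
        exact hx1.trans (by linarith))
      have h2 : decayWeight x ≤ 1 := by
        unfold decayWeight
        exact inv_le_one_of_one_le₀ (by linarith [norm_nonneg x])
      rw [h1, mul_pow, mul_pow]
      gcongr
  refine (lintegral_mono hpt).trans ?_
  rw [lintegral_add_right _ (Measurable.indicator (by fun_prop) hm), lintegral_indicator hm, add_mul]
  exact add_le_add hin hout

/-! ### The pattern at infinity and the domain near its vertex -/

theorem sphereCapacity_empty (n : ℕ) : sphereCapacity (∅ : Set (USphere n)) = 0 := by
  refine le_antisymm (iInf_le_of_le (fun _ => 0) (iInf_le_of_le contDiff_const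
    (iInf_le_of_le (by simp) ?_))) zero_le
  have h : ∀ θ : USphere n, tangentialGradient (fun _ : Eucl n => (0 : ℝ)) θ = 0 :=
    fun θ => by simp [tangentialGradient, gradient]
  simp_rw [h]
  simp

/-- The vertex is not in the cone: otherwise the cone is the whole space, and the complement of its
section is empty. -/
theorem zero_notMem_of_capacity_pos {n : ℕ} {Γ : Set (Eucl n)} (hΓ : IsOpen Γ)
    (hc : ∀ x ∈ Γ, ∀ t : ℝ, 0 < t → t • x ∈ Γ) (hcap : 0 < sphereCapacity (sphericalSection Γ)ᶜ) :
    (0 : Eucl n) ∉ Γ := by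
  intro h0
  obtain ⟨ε, hε, hball⟩ := Metric.isOpen_iff.1 hΓ 0 h0
  have huniv : (sphericalSection Γ)ᶜ = ∅ := by
    refine compl_empty_iff.2 (eq_univ_of_forall fun θ => ?_)
    have hθ : ‖(θ : Eucl n)‖ = 1 := by simp
    have h := hc _ (hball (show (ε / 2) • (θ : Eucl n) ∈ ball 0 ε by
      rw [mem_ball_zero_iff, norm_smul, hθ, mul_one, Real.norm_of_nonneg (by positivity)]
      linarith)) (ε / 2)⁻¹ (by positivity)
    rwa [smul_smul, inv_mul_cancel₀ (by positivity), one_smul] at h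
  rw [huniv, sphereCapacity_empty] at hcap
  exact lt_irrefl _ hcap

theorem tsupport_subset_compl_of_eq_zero {n : ℕ} {f : Eucl n → ℝ} {S : Set (Eucl n)} (hS : IsOpen S)
    (h : ∀ x ∈ S, f x = 0) : tsupport f ⊆ Sᶜ :=
  closure_minimal (fun x hx hxS => hx (h x hxS)) hS.isClosed_compl

theorem closure_outerBall {n : ℕ} {R : ℝ} (hR : 0 < R) :
    closure (outerBall n R) = {x | R ≤ ‖x‖} := by
  refine Subset.antisymm (closure_minimal (fun x (hx : R < ‖x‖) => hx.le)
    (isClosed_le continuous_const continuous_norm)) fun x hx => ?_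
  have hlim : Tendsto (fun t : ℝ => t • x) (𝓝[>] 1) (𝓝 x) := by
    have : Tendsto (fun t : ℝ => t • x) (𝓝 1) (𝓝 ((1 : ℝ) • x)) :=
      (continuous_id.smul continuous_const).tendsto 1
    rw [one_smul] at this
    exact this.mono_left nhdsWithin_le_nhds
  refine mem_closure_of_tendsto hlim ?_
  filter_upwards [self_mem_nhdsWithin] with t ht
  have ht1 : (1 : ℝ) < t := ht
  have hx0 : 0 < ‖x‖ := hR.trans_le hx
  change R < ‖t • x‖
  rw [norm_smul, Real.norm_of_nonneg (by linarith)]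
  nlinarith [hx.out]

theorem closure_ball_zero {n : ℕ} {r : ℝ} (hr : 0 < r) :
    closure (ball (0 : Eucl n) r) = {x | ‖x‖ ≤ r} := by
  rw [closure_ball _ hr.ne']
  ext x
  simp

theorem IsCutoffAtInfinity.isEndCutoff {n : ℕ} {R : ℝ} (hR : 0 < R) {Φ : Eucl n → ℝ}
    (hΦ : IsCutoffAtInfinity R Φ) : IsEndCutoff (outerBall n R) Φ := by
  refine ⟨hΦ.smooth, fun x hx => ?_, R / 2, 2 * R + 1, by linarith, by linarith, fun x hx => ?_⟩
  · have h := tsupport_subset_compl_of_eq_zero isOpen_ball hΦ.eq_zero hx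
    rw [closure_outerBall hR]
    simpa using h
  · have h1 := tsupport_subset_compl_of_eq_zero (isOpen_outerBall n (2 * R))
      (fun x hx => by rw [hΦ.eq_one x hx, sub_self]) hx.2
    have h2 := hx.1
    rw [closure_outerBall hR] at h2
    have h3 : ‖x‖ ≤ 2 * R := not_lt.1 h1
    exact ⟨by linarith [h2.out], by linarith⟩

theorem IsCutoffAtVertex.isEndCutoff {n : ℕ} {r : ℝ} (hr : 0 < r) {φ : Eucl n → ℝ}
    (hφ : IsCutoffAtVertex r φ) : IsEndCutoff (ball 0 r) φ := by
  refine ⟨hφ.smooth, fun x hx => ?_, r / 4, 2 * r, by linarith, by linarith, fun x hx => ?_⟩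
  · have h : ¬ r < ‖x‖ := tsupport_subset_compl_of_eq_zero (isOpen_outerBall n r) hφ.eq_zero hx
    rw [closure_ball_zero hr]
    exact not_lt.1 h
  · have h1 := tsupport_subset_compl_of_eq_zero isOpen_ball
      (fun x hx => by rw [hφ.eq_one x hx, sub_self]) hx.2
    have h2 := hx.1
    rw [closure_ball_zero hr] at h2
    have h3 : r / 2 ≤ ‖x‖ := by simpa using h1
    exact ⟨by linarith, by linarith [h2.out]⟩

/-- A cutoff at infinity whose support keeps a distance to the sphere `|x| = R`. -/
theorem exists_isCutoffAtInfinity (n : ℕ) {R : ℝ} (hR : 0 < R) : ∃ η : Eucl n → ℝ,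
    IsCutoffAtInfinity R η ∧ tsupport η ⊆ outerBall n R ∧
      (tsupport fun x => η x - 1) ⊆ ball 0 (3 * R) := by
  let ζ : ContDiffBump (0 : Eucl n) := ⟨3 / 2 * R, 2 * R, by positivity, by linarith⟩
  have h1 : ∀ x ∈ ball (0 : Eucl n) (3 / 2 * R), 1 - ζ x = 0 := fun x hx => by
    rw [ζ.one_of_mem_closedBall (ball_subset_closedBall hx), sub_self]
  have h0 : ∀ x ∈ outerBall n (2 * R), ζ x = 0 := fun x hx =>
    ζ.zero_of_le_dist (by simpa using hx.out.le)
  refine ⟨fun x => 1 - ζ x, ⟨contDiff_const.sub ζ.contDiff, fun x hx => by rw [h0 x hx, sub_zero],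
    fun x hx => h1 x (ball_subset_ball (by linarith) hx)⟩, fun x hx => ?_, fun x hx => ?_⟩
  · have h := tsupport_subset_compl_of_eq_zero isOpen_ball h1 hx
    have h' : 3 / 2 * R ≤ ‖x‖ := by simpa using h
    change R < ‖x‖
    linarith
  · have h : ¬ 2 * R < ‖x‖ := tsupport_subset_compl_of_eq_zero (isOpen_outerBall n (2 * R))
      (fun x hx => by simp [h0 x hx]) hx
    rw [mem_ball_zero_iff]
    linarith

/-- A cutoff at the vertex whose support keeps a distance to the sphere `|x| = r`. -/
theorem exists_isCutoffAtVertex (n : ℕ) {r : ℝ} (hr : 0 < r) : ∃ η : Eucl n → ℝ,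
    IsCutoffAtVertex r η ∧ tsupport η ⊆ ball 0 r ∧
      (tsupport fun x => η x - 1) ⊆ outerBall n (r / 4) := by
  let ζ : ContDiffBump (0 : Eucl n) := ⟨r / 2, 3 / 4 * r, by positivity, by linarith⟩
  have h1 : ∀ x ∈ ball (0 : Eucl n) (r / 2), ζ x = 1 := fun x hx =>
    ζ.one_of_mem_closedBall (ball_subset_closedBall hx)
  have h0 : ∀ x ∈ outerBall n (3 / 4 * r), ζ x = 0 := fun x hx =>
    ζ.zero_of_le_dist (by simpa using hx.out.le)
  refine ⟨ζ, ⟨ζ.contDiff, h1, fun x hx => h0 x ?_⟩, fun x hx => ?_, fun x hx => ?_⟩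
  · have : r < ‖x‖ := hx
    change 3 / 4 * r < ‖x‖
    linarith
  · have h : ¬ 3 / 4 * r < ‖x‖ := tsupport_subset_compl_of_eq_zero
      (isOpen_outerBall n (3 / 4 * r)) h0 hx
    rw [mem_ball_zero_iff]
    linarith
  · have h := tsupport_subset_compl_of_eq_zero isOpen_ball
      (fun x hx => by rw [h1 x hx, sub_self]) hx
    have h' : r / 2 ≤ ‖x‖ := by simpa using h
    change r / 4 < ‖x‖
    linarith

namespace IsGeneratingTriple

variable {n : ℕ} {Γ Ω P : Set (Eucl n)} {r₀ R₀ : ℝ}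

/-- The pattern is a perturbed cone whose end is infinity; it is exhausted by balls of large radius. -/
theorem isPerturbedCone_pattern (hT : IsGeneratingTriple Γ Ω P r₀ R₀) (hn : 2 ≤ n) :
    IsPerturbedCone Γ P (outerBall n R₀) (fun ρ => ball 0 ρ) decayWeight where
  isOpen_cone := hT.isOpen_cone
  cone_smul := hT.cone_smul
  isOpen_domain := hT.isOpen_pattern
  isOpen_end := isOpen_outerBall n R₀
  inter_eq := hT.pattern_inter_outerBall
  isOpen_exhaustion := fun _ => isOpen_ball
  exhausts := fun C _ hC => by
    obtain ⟨ρ, hρ⟩ := hC.isBounded.subset_ball 0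
    exact ⟨max ρ 1, by positivity, hρ.trans (ball_subset_ball (le_max_left _ _))⟩
  subset_annulus := fun ρ _ => by
    have hR := hT.R₀_pos
    refine ⟨R₀ / 2, max ρ R₀, by linarith, by linarith [le_max_right ρ R₀], fun x hx => ?_⟩
    have h2 := hx.2
    rw [closure_outerBall hR] at h2
    exact ⟨by linarith [h2.out], (mem_ball_zero_iff.1 hx.1).trans_le (le_max_left _ _)⟩
  continuous_weight := by
    unfold decayWeight
    exact Continuous.inv₀ (by fun_prop) fun x => by positivity
  weight_pos := fun x => by unfold decayWeight; positivity
  weight_le_one := fun x => by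
    unfold decayWeight
    exact inv_le_one_of_one_le₀ (by linarith [norm_nonneg x])
  weight_lower := fun ρ hρ => by
    refine ⟨(1 + ρ)⁻¹, by positivity, fun x hx => ?_⟩
    have := (mem_ball_zero_iff.1 hx).le
    unfold decayWeight
    gcongr
  dilation := by
    -- contractions
    have hR := hT.R₀_pos
    have h : ∃ᶠ t in 𝓝[<] (1 : ℝ), ∀ x : Eucl n, t • x ∈ closure (outerBall n R₀) →
        x ∈ outerBall n R₀ := by
      refine Eventually.frequently ?_
      filter_upwards [Ioo_mem_nhdsLT (zero_lt_one' ℝ)] with t ht x hx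
      rw [closure_outerBall hR, mem_ofPred_eq, norm_smul, Real.norm_of_nonneg ht.1.le] at hx
      have hx0 : 0 < ‖x‖ := by
        by_contra! h0
        nlinarith [ht.1]
      change R₀ < ‖x‖
      nlinarith [ht.2]
    exact h.filter_mono nhdsWithin_le_nhds
  poincare := exists_hardy hn hT.cone_smul hT.capacity_pos hT.R₀_pos hT.pattern_inter_outerBall

/-- The domain is a perturbed cone whose end is the vertex; it is exhausted by complements of balls
of small radius, because the vertex does not belong to the cone. -/
theorem isPerturbedCone_domain (hT : IsGeneratingTriple Γ Ω P r₀ R₀) (hn : 2 ≤ n) :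
    IsPerturbedCone Γ Ω (ball 0 r₀) (fun ρ => outerBall n ρ) (fun _ => 1) where
  isOpen_cone := hT.isOpen_cone
  cone_smul := hT.cone_smul
  isOpen_domain := hT.isOpen_domain
  isOpen_end := isOpen_ball
  inter_eq := hT.domain_inter_ball
  isOpen_exhaustion := fun ρ => isOpen_outerBall n ρ
  exhausts := fun C hCΩ hC => by
    have h0 : (0 : Eucl n) ∉ C := fun h =>
      zero_notMem_of_capacity_pos hT.isOpen_cone hT.cone_smul hT.capacity_pos
        (hT.domain_inter_ball.subset ⟨hCΩ h, mem_ball_self hT.r₀_pos⟩).1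
    obtain ⟨a, b, ha, -, hab⟩ := exists_subset_openAnnulus hC h0
    exact ⟨a, ha, fun x hx => (hab hx).1⟩
  subset_annulus := fun ρ hρ => by
    refine ⟨ρ, max ρ r₀ + 1, hρ, by linarith [le_max_left ρ r₀], fun x hx => ?_⟩
    have h2 := hx.2
    rw [closure_ball_zero hT.r₀_pos] at h2
    exact ⟨hx.1, by linarith [h2.out, le_max_right ρ r₀]⟩
  continuous_weight := continuous_const
  weight_pos := fun _ => one_pos
  weight_le_one := fun _ => le_rfl
  weight_lower := fun _ _ => ⟨1, one_pos, fun _ _ => le_rfl⟩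
  dilation := by
    -- expansions
    have hr := hT.r₀_pos
    have h : ∃ᶠ t in 𝓝[>] (1 : ℝ), ∀ x : Eucl n, t • x ∈ closure (ball (0 : Eucl n) r₀) →
        x ∈ ball (0 : Eucl n) r₀ := by
      refine Eventually.frequently ?_
      filter_upwards [self_mem_nhdsWithin] with t ht x hx
      have ht1 : (1 : ℝ) < t := ht
      rw [closure_ball_zero hr, mem_ofPred_eq, norm_smul, Real.norm_of_nonneg (by linarith)] at hx
      rw [mem_ball_zero_iff]
      by_contra! h0
      nlinarith
    exact h.filter_mono nhdsWithin_le_nhds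
  poincare := exists_friedrichs hn hT.isBounded_domain

theorem isConeHarmonic (hT : IsGeneratingTriple Γ Ω P r₀ R₀) (hn : 2 ≤ n) {μ : ℝ}
    {ψ : USphere n → ℝ} (hψ : IsDirichletEigenfunction Γ μ ψ) {l : ℝ} (hl : l * (l + n - 2) = μ) :
    IsConeHarmonic Γ (homogeneousExtension l ψ) :=
  isConeHarmonic_homogeneousExtension hn hT.isOpen_cone hT.cone_smul
    (zero_notMem_of_capacity_pos hT.isOpen_cone hT.cone_smul hT.capacity_pos) hψ hl

end IsGeneratingTriple

theorem isKPlus_iff {n : ℕ} {Γ P : Set (Eucl n)} {R₀ : ℝ} {h K : Eucl n → ℝ} :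
    IsKPlus Γ P R₀ h K ↔
      IsAsymptoticSolution Γ P (outerBall n R₀) (fun ρ => ball 0 ρ) decayWeight h K :=
  ⟨fun hK => ⟨hK.memL2Loc, hK.harmonic, hK.dirichlet, hK.atInfinity⟩,
    fun hK => ⟨hK.memL2Loc, hK.harmonic, hK.dirichlet, hK.asymptotic⟩⟩

theorem isKMinus_iff {n : ℕ} {Γ Ω : Set (Eucl n)} {r₀ : ℝ} {h K : Eucl n → ℝ} :
    IsKMinus Γ Ω r₀ h K ↔
      IsAsymptoticSolution Γ Ω (ball 0 r₀) (fun ρ => outerBall n ρ) (fun _ => 1) h K :=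
  ⟨fun hK => ⟨hK.memL2Loc, hK.harmonic, hK.dirichlet, hK.atVertex⟩,
    fun hK => ⟨hK.memL2Loc, hK.harmonic, hK.dirichlet, hK.asymptotic⟩⟩

theorem lemma5p3 (n : ℕ) (hn : 2 ≤ n) (Γ Ω P : Set (Eucl n)) (r₀ R₀ : ℝ)
    (hT : IsGeneratingTriple Γ Ω P r₀ R₀)
    (μ : ℝ) (ψ : USphere n → ℝ) (hψ : IsDirichletEigenfunction Γ μ ψ) :
    (∃ K : Eucl n → ℝ, IsKPlus Γ P R₀ (hPlus μ ψ) K ∧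
      (∀ K' : Eucl n → ℝ, IsKPlus Γ P R₀ (hPlus μ ψ) K' → K' =ᵐ[volume.restrict P] K) ∧
      ∀ Φ : Eucl n → ℝ, IsCutoffAtInfinity R₀ Φ →
        ∃ Y : Eucl n → ℝ, IsCorrectorPlus P Φ (hPlus μ ψ) Y ∧
          (∀ Y' : Eucl n → ℝ, IsCorrectorPlus P Φ (hPlus μ ψ) Y' →
            Y' =ᵐ[volume.restrict P] Y) ∧
          K =ᵐ[volume.restrict P] fun x => Φ x * hPlus μ ψ x - Y x) ∧
    (∃ K : Eucl n → ℝ, IsKMinus Γ Ω r₀ (hMinus μ ψ) K ∧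
      (∀ K' : Eucl n → ℝ, IsKMinus Γ Ω r₀ (hMinus μ ψ) K' → K' =ᵐ[volume.restrict Ω] K) ∧
      ∀ φ : Eucl n → ℝ, IsCutoffAtVertex r₀ φ →
        ∃ Y : Eucl n → ℝ, IsCorrectorMinus Ω φ (hMinus μ ψ) Y ∧
          (∀ Y' : Eucl n → ℝ, IsCorrectorMinus Ω φ (hMinus μ ψ) Y' →
            Y' =ᵐ[volume.restrict Ω] Y) ∧
          K =ᵐ[volume.restrict Ω] fun x => φ x * hMinus μ ψ x - Y x) := by
  have hμ := hψ.eigenvalue_nonneg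
  obtain ⟨η, hη, hηV, hηW⟩ := exists_isCutoffAtInfinity n hT.R₀_pos
  obtain ⟨ζ, hζ, hζV, hζW⟩ := exists_isCutoffAtVertex n hT.r₀_pos
  obtain ⟨K, hK, hKu, hKY⟩ := (hT.isPerturbedCone_pattern hn).exists_unique_asymptoticSolution
    (hT.isConeHarmonic hn hψ (lambdaPlus_mul n hμ)) (hη.isEndCutoff hT.R₀_pos) hηV
    (mul_pos three_pos hT.R₀_pos) hηW
  obtain ⟨L, hL, hLu, hLY⟩ := (hT.isPerturbedCone_domain hn).exists_unique_asymptoticSolution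
    (hT.isConeHarmonic hn hψ (lambdaMinus_mul n hμ)) (hζ.isEndCutoff hT.r₀_pos) hζV
    (div_pos hT.r₀_pos four_pos) hζW
  exact ⟨⟨K, isKPlus_iff.2 hK, fun K' hK' => hKu K' (isKPlus_iff.1 hK'),
      fun Φ hΦ => hKY Φ (hΦ.isEndCutoff hT.R₀_pos)⟩,
    ⟨L, isKMinus_iff.2 hL, fun K' hK' => hLu K' (isKMinus_iff.1 hK'),
      fun φ hφ => hLY φ (hφ.isEndCutoff hT.r₀_pos)⟩⟩
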